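/- **Theorem 3.1 (Interior estimate).** Let $n\ge 2$, $m\ge 0$ be integers and $K,\Lambda\ge 0$. Let $\Omega\subset\mathbb R^n$ be open, $\delta(x)=\operatorname{dist}(x,\partial\Omega)$ (with $\delta=\infty$ if $\partial\Omega=\emptyset$), and let $A=(A^{hk}_{\alpha\beta})$, $B=(B^h_{\alpha\beta})$ ($1\le h,k\le n$, $1\le\alpha,\beta\le m$) be complex-valued measurable coefficients on $\Omega$ with $|A^{hk}_{\alpha\beta}|\le\Lambda$ and $|B^h_{\alpha\beta}(x)|\le K/\delta(x)$ a.e. in $\Omega$ (so $B\in L^\infty_{loc}(\Omega)$). For $\xi=(\xi_h^\alpha),\zeta=(\zeta_h^\alpha)\in\mathbb C^{n\times m}$ put $(A\xi)_h^\alpha=A^{hk}_{\alpha\beta}\xi_k^\beta$, $\langle\xi,\zeta\rangle=\sum_{h,\alpha}\xi_h^\alpha\overline{\zeta_h^\alpha}$. For $1<p<\infty$ and $c>0$ we say that $A$ is *integrally $p$-elliptic with constant $c$* if $$\Re e\int_\Omega\Big\langle A\Big(\nabla v-\big(1-\tfrac2p\big)\tfrac{v}{|v|}\nabla|v|\Big),\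 \nabla v+\big(1-\tfrac2p\big)\tfrac{v}{|v|}\nabla|v|\Big\rangle\,dx\ \ge\ c\int_\Omega|\nabla v|^2\,dx\qquad\text{for all } v\in W^{1,2}_0(\Omega;\mathbb C^m),$$ where $\frac{v}{|v|}\nabla|v|$ is the tensor $\big(\frac{v^\alpha}{|v|^2}\Re e\langle v,\partial_hv\rangle\big)_{h,\alpha}$, read as $0$ where $v=0$; $A$ is *integrally $p$-elliptic* if this holds for some $c>0$. Assume that $A$ is integrally $2$-elliptic, let $p_0=\sup\{p>1: A\text{ is integrally }p\text{-elliptic}\}\in(2,\infty]$, and let $p_0'=p_0/(p_0-1)$ (with $p_0'=1$ if $p_0=\infty$). Let $u\in W^{1,2}_{loc}(\Omega;\mathbb C^m)$ be a weak solution of $\operatorname{div}(A\nabla u)+B\cdot\nabla u=0$ in $\Omega$, i.e. $\int_\Omega \big(A^{hk}_{\alpha\beta}\partial_ku^\beta\,\overline{\partial_hv^\alpha}-B^h_{\alpha\beta}\partial_hu^\beta\,\overline{v^\alpha}\big)dx=0$ for all $v\in C_c^\infty(\Omega;\mathbb C^m)$. Then for all $x\in\Omega$ and $0<r<\delta(x)/3$,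 where $B_\rho$ denotes the ball $B_\rho(x)$: 1. (Caccioppoli-type inequality) If $p\in(p_0',p_0)$ and $A$ is integrally $p$-elliptic with constant $\lambda_p>0$, then $$\fint_{B_r}|u|^{p-2}|\nabla u|^2\,dy\le\frac C{r^2}\fint_{B_{2r}}|u|^p\,dy,$$ where $C$ depends only on $n,m,p,K,\Lambda,\lambda_p$, and $|u|^{p-2}|\nabla u|^2$ is read as $0$ where $u=0$ and $\nabla u=0$. Such a $\lambda_p$ exists for every $p\in[2,p_0)$. 2. (Reverse Hölder inequality) Let $1\le q<\frac{p_0n}{n-2}$ ($1\le q<\infty$ if $n=2$ or $p_0=\infty$). There is $p\in(p_0',p_0)$ with $q<\frac{pn}{n-2}$ (no restriction if $n=2$) such that $A$ is integrally $p$-elliptic, and for every such $p$, if $A$ is integrally $p$-elliptic with constant $\lambda_p>0$, then $$\Big(\fint_{B_r}|u|^q\,dy\Big)^{1/q}\le C\fint_{B_{2r}}|u|\,dy,$$ where $C$ depends only on $n,m,p,q,K,\Lambda,\lambda_p$. -/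

import Mathlib

open MeasureTheory Filter Topology
open scoped ENNReal NNReal ContDiff

noncomputable section

namespace EllipticSystem

/-- The Euclidean space `ℝⁿ`. -/
abbrev Pt (n : ℕ) := EuclideanSpace ℝ (Fin n)

/-- Values in `ℂᵐ`, with the Hermitian norm. -/
abbrev Vec (m : ℕ) := EuclideanSpace ℂ (Fin m)

/-- Tensors `ξ = (ξ_h^α) ∈ ℂ^{n × m}`, indexed by the pairs `(h, α)`, with the Hermitian
(Frobenius) norm. -/
abbrev Tens (n m : ℕ) := EuclideanSpace ℂ (Fin n × Fin m)

/-- A second order coefficient `A^{hk}_{αβ}`; the arguments come in the order `h k α β`. -/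
abbrev Coef2 (n m : ℕ) := Fin n → Fin n → Fin m → Fin m → ℂ

/-- A first order coefficient `B^h_{αβ}`; the arguments come in the order `h α β`. -/
abbrev Coef1 (n m : ℕ) := Fin n → Fin m → Fin m → ℂ

variable {n m : ℕ}

/-- `(A ξ)_h^α = ∑_{k, β} A^{hk}_{αβ} ξ_k^β`. -/
def applyA (A : Coef2 n m) (ξ : Tens n m) : Tens n m :=
  WithLp.toLp 2 fun i => ∑ k, ∑ β, A i.1 k i.2 β * ξ (k, β)

/-- `(B · ξ)^α = ∑_{h, β} B^h_{αβ} ξ_h^β`. -/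
def applyB (B : Coef1 n m) (ξ : Tens n m) : Vec m :=
  WithLp.toLp 2 fun α => ∑ h, ∑ β, B h α β * ξ (h, β)

/-- The classical gradient `(∂_h φ^α)` of a differentiable function `φ : ℝⁿ → ℂᵐ`. -/
def grad (φ : Pt n → Vec m) (x : Pt n) : Tens n m :=
  WithLp.toLp 2 fun i => fderiv ℝ φ x (EuclideanSpace.single i.1 1) i.2

/-- `φ ∈ C_c^∞(Ω; F)`. -/
def IsTest {F : Type*} [NormedAddCommGroup F] [NormedSpace ℝ F]
    (Ω : Set (Pt n)) (φ : Pt n → F) : Prop :=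
  ContDiff ℝ ∞ φ ∧ HasCompactSupport φ ∧ tsupport φ ⊆ Ω

/-- `u ∈ W^{1,2}_loc(Ω; ℂᵐ)` with weak gradient `Du`. -/
structure IsW12Loc (Ω : Set (Pt n)) (u : Pt n → Vec m) (Du : Pt n → Tens n m) : Prop where
  memLp : ∀ S : Set (Pt n), IsCompact S → S ⊆ Ω → MemLp u 2 (volume.restrict S)
  memLp_grad : ∀ S : Set (Pt n), IsCompact S → S ⊆ Ω → MemLp Du 2 (volume.restrict S)
  weak_deriv : ∀ φ : Pt n → ℝ, IsTest Ω φ → ∀ (h : Fin n) (α : Fin m),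
    ∫ x in Ω, ((fderiv ℝ φ x (EuclideanSpace.single h 1) : ℝ) : ℂ) * u x α
      = - ∫ x in Ω, ((φ x : ℝ) : ℂ) * Du x (h, α)

/-- `v ∈ W^{1,2}_0(Ω; ℂᵐ)` with gradient `Dv`: the pair `(v, Dv)` is a limit in `L²(Ω)` of pairs
`(φ, ∇φ)` with `φ ∈ C_c^∞(Ω; ℂᵐ)`. -/
structure IsW12Zero (Ω : Set (Pt n)) (v : Pt n → Vec m) (Dv : Pt n → Tens n m) : Prop where
  memLp : MemLp v 2 (volume.restrict Ω)
  memLp_grad : MemLp Dv 2 (volume.restrict Ω)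
  approx : ∃ φ : ℕ → Pt n → Vec m, (∀ j, IsTest Ω (φ j)) ∧
    Tendsto (fun j => eLpNorm (φ j - v) 2 (volume.restrict Ω)) atTop (𝓝 0) ∧
    Tendsto (fun j => eLpNorm (grad (φ j) - Dv) 2 (volume.restrict Ω)) atTop (𝓝 0)

/-- The tensor `(v / |v|) ∇|v|`, that is `(v^α / |v|²) Re ⟨v, ∂_h v⟩`, at a point with value
`w = v x` and gradient `ξ = ∇v x`. It is `0` where `v = 0` (there `∇v = 0` almost everywhere). -/
def radial (w : Vec m) (ξ : Tens n m) : Tens n m :=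
  WithLp.toLp 2 fun i =>
    w i.2 * (((∑ β, w β * star (ξ (i.1, β))).re / ‖w‖ ^ 2 : ℝ) : ℂ)

/-- The integral `p`-ellipticity condition on `Ω` holds with the constant `c`. As Mathlib's inner
product is conjugate linear in its first argument, `inner ℂ ζ ξ` is `∑ ξ_h^α conj(ζ_h^α)`. -/
def IntEllipticWith (Ω : Set (Pt n)) (A : Pt n → Coef2 n m) (p c : ℝ) : Prop :=
  ∀ (v : Pt n → Vec m) (Dv : Pt n → Tens n m), IsW12Zero Ω v Dv →
    c * ∫ x in Ω, ‖Dv x‖ ^ 2 ≤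
      (∫ x in Ω, inner ℂ
        (Dv x + (1 - 2 / p) • radial (v x) (Dv x))
        (applyA (A x) (Dv x - (1 - 2 / p) • radial (v x) (Dv x)))).re

/-- The integral `p`-ellipticity condition on `Ω`. -/
def IntElliptic (Ω : Set (Pt n)) (A : Pt n → Coef2 n m) (p : ℝ) : Prop :=
  ∃ c : ℝ, 0 < c ∧ IntEllipticWith Ω A p c

/-- `p₀ = sup {p > 1 : A is integrally p-elliptic} ∈ [0, ∞]`. -/
def pZero (Ω : Set (Pt n)) (A : Pt n → Coef2 n m) : ℝ≥0∞ :=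
  sSup (ENNReal.ofReal '' {p : ℝ | 1 < p ∧ IntElliptic Ω A p})

/-- `δ(x)`, the distance of `x` to `∂Ω` (infinite if `∂Ω` is empty). -/
def bdryDist (Ω : Set (Pt n)) (x : Pt n) : ℝ≥0∞ :=
  Metric.infEDist x (frontier Ω)

/-- The hypotheses on the coefficients: `A` is measurable and bounded by `Λ` on the open set `Ω`,
and elliptic in the integral sense; `B` is measurable and `|B^h_{αβ}| ≤ K / δ`
(so that `B ∈ L^∞_loc(Ω)`). -/
structure IsAdmissible (Ω : Set (Pt n)) (A : Pt n → Coef2 n m) (B : Pt n → Coef1 n m)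
    (Λ K : ℝ≥0) : Prop where
  isOpen : IsOpen Ω
  measA : ∀ h k α β, AEStronglyMeasurable (fun x => A x h k α β) (volume.restrict Ω)
  boundA : ∀ h k α β, ∀ᵐ x ∂volume.restrict Ω, ‖A x h k α β‖ ≤ Λ
  elliptic : IntElliptic Ω A 2
  measB : ∀ h α β, AEStronglyMeasurable (fun x => B x h α β) (volume.restrict Ω)
  boundB : ∀ h α β, ∀ᵐ x ∂volume.restrict Ω, ‖B x h α β‖ₑ ≤ K / bdryDist Ω x

/-- `u ∈ W^{1,2}_loc(Ω; ℂᵐ)`, with weak gradient `Du`, is a weak solution of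
`div(A ∇u) + B · ∇u = 0` in `Ω`. -/
structure IsWeakSolution (Ω : Set (Pt n)) (A : Pt n → Coef2 n m) (B : Pt n → Coef1 n m)
    (u : Pt n → Vec m) (Du : Pt n → Tens n m) : Prop where
  sobolev : IsW12Loc Ω u Du
  weak_eq : ∀ v : Pt n → Vec m, IsTest Ω v →
    ∫ x in Ω, (inner ℂ (grad v x) (applyA (A x) (Du x)) - inner ℂ (v x) (applyB (B x) (Du x))) = 0

/-- `⨍_{B_r(x)} |u|^{p-2} |∇u|² ≤ C r⁻² ⨍_{B_{2r}(x)} |u|^p`. In `[0, ∞]` one has `∞ * 0 = 0`, so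
for `p < 2` the integrand on the left is `0` where `u = 0` and `∇u = 0`. -/
def Caccioppoli (u : Pt n → Vec m) (Du : Pt n → Tens n m) (p : ℝ) (C : ℝ≥0)
    (x : Pt n) (r : ℝ) : Prop :=
  ⨍⁻ y in Metric.ball x r, ‖u y‖ₑ ^ (p - 2) * ‖Du y‖ₑ ^ 2 ∂volume
    ≤ C / ENNReal.ofReal r ^ 2 * ⨍⁻ y in Metric.ball x (2 * r), ‖u y‖ₑ ^ p ∂volume

/-- `(⨍_{B_r(x)} |u|^q)^{1/q} ≤ C ⨍_{B_{2r}(x)} |u|`. -/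
def ReverseHolder (u : Pt n → Vec m) (q : ℝ) (C : ℝ≥0) (x : Pt n) (r : ℝ) : Prop :=
  (⨍⁻ y in Metric.ball x r, ‖u y‖ₑ ^ q ∂volume) ^ (1 / q)
    ≤ C * ⨍⁻ y in Metric.ball x (2 * r), ‖u y‖ₑ ∂volume

/-- `s n / (n - 2)` for `n ≥ 2`, which is `∞` for `n = 2` and `s > 0`. -/
def sobolevExp (n : ℕ) (s : ℝ≥0∞) : ℝ≥0∞ :=
  s * n / ((n - 2 : ℕ) : ℝ≥0∞)

end EllipticSystem

end

open MeasureTheory Filter Topology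
open scoped ENNReal NNReal ContDiff

noncomputable section

namespace EllipticSystem

variable {n m : ℕ}

/-! ### Mollification in `L²` -/

/-! Classically one tests the equation with η²|u|^{p-2}u and inserts v = η|u|^{p/2-1}u into the
p-ellipticity condition. Let S be the real form of A, P = `radial u` and t = 1 - 2/p. Both sides
then lead to S(ξ - tPξ, ξ + tPξ) with ξ = ∇v, up to terms that carry ∇η or B, and Young's inequality
finishes. The obstacle is that |u|^{p/2-1} has to be truncated. A truncated weight φ(|u|) with
logarithmic derivative a produces the same form with the variable parameter a/(1 + a), which moves
between 0 and t, whereas ellipticity is an integral condition at a constant parameter.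

The remedy is a slowly varying partition θ₀² + θ₁² = 1, depending on |u| and tied to φ by a/(1 + a)
= tθ₁². Ellipticity at 2 is applied to ηθ₀φ(|u|)u and ellipticity at p to ηθ₁φ(|u|)u. Oscillating
test functions show that ellipticity at 2 implies the Legendre–Hadamard condition
(`IsAdmissible.legendreHadamard`). Since radial tensors have rank one, S(Pξ, Pξ) ≥ 0, so the form is
concave in its parameter: the average of its values at 0 and t with weights θ₀², θ₁² is at most its
value at tθ₁², and this value is what the equation controls. The logarithmic derivatives of θ₀ and
θ₁ are at most ε/2, and the resulting errors are absorbed by the ellipticity constants. This is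
`pointwise_energy`, integrated in `energy_estimate`. The same concavity interpolates ellipticity
between 2 and p.

Explicit weights built from s^ε satisfy all relations exactly (`energyWeights_of_two_le`,
`energyWeights_of_lt_two`). When the truncation is removed, θ₁ tends to 1, and both ε and the
ellipticity constant at 2 disappear from the limit. This is why the final constants involve λ_p
only. Fatou's lemma on one side and dominated convergence on the other give `caccioppoli_of_cutoff`.

Sobolev's inequality for ηθ₁φ(|u|)u turns the energy bound into a gain of integrability from p to Q
= pχ (`exists_gain_const`). The finiteness it needs comes from a bootstrap that starts at L²
(`IsWeakSolution.locRpowIntegrable`). For the reverse Hölder inequality this single gain suffices: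
L^p is interpolated between L¹ and L^Q, and on a growing sequence of balls the L^Q integral
reappears with total power (p - 1)χ/(pχ - 1) < 1, so the recursion closes
(`exists_iteration_const`). -/

open scoped Convolution in
/-- Convolution with a probability density is a contraction of `L²`. -/
theorem eLpNorm_convolution_le {V E : Type*} [NormedAddCommGroup V] [MeasurableSpace V]
    [BorelSpace V] [SecondCountableTopology V] [NormedAddCommGroup E] [NormedSpace ℝ E]
    (μ : Measure V) [SFinite μ] [μ.IsAddHaarMeasure] {ρ : V → ℝ} (hρ : Continuous ρ)
    (hρ0 : ∀ x, 0 ≤ ρ x) (hρ1 : ∫⁻ x, ENNReal.ofReal (ρ x) ∂μ = 1) {f : V → E}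
    (hf : AEStronglyMeasurable f μ) :
    eLpNorm (ρ ⋆[ContinuousLinearMap.lsmul ℝ ℝ, μ] f) 2 μ ≤ eLpNorm f 2 μ := by
  obtain ⟨f', hf', hff'⟩ := hf
  have hcongr : (ρ ⋆[ContinuousLinearMap.lsmul ℝ ℝ, μ] f) =
      (ρ ⋆[ContinuousLinearMap.lsmul ℝ ℝ, μ] f') :=
    convolution_congr _ EventuallyEq.rfl hff'
  rw [hcongr, eLpNorm_congr_ae hff']
  clear hcongr hff' f
  have hmρ : Measurable fun y => ENNReal.ofReal (ρ y) := hρ.measurable.ennreal_ofReal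
  -- Jensen's inequality: for the probability measure ν with density ρ, the L¹ norm is at most the
  -- L² norm. Tonelli's theorem and translation invariance then finish.
  have key : ∀ x, ‖(ρ ⋆[ContinuousLinearMap.lsmul ℝ ℝ, μ] f') x‖ₑ ^ (2 : ℝ) ≤
      ∫⁻ y, ENNReal.ofReal (ρ y) * ‖f' (x - y)‖ₑ ^ (2 : ℝ) ∂μ := by
    intro x
    set ν := μ.withDensity fun y => ENNReal.ofReal (ρ y) with hν
    have : IsProbabilityMeasure ν := ⟨by rw [hν, withDensity_apply _ MeasurableSet.univ]; simpa⟩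
    have hfx : StronglyMeasurable fun y => f' (x - y) :=
      hf'.comp_measurable (measurable_const.sub measurable_id)
    have h1 : ‖(ρ ⋆[ContinuousLinearMap.lsmul ℝ ℝ, μ] f') x‖ₑ ≤
        eLpNorm (fun y => f' (x - y)) 1 ν := by
      rw [eLpNorm_one_eq_lintegral_enorm, hν, lintegral_withDensity_eq_lintegral_mul _ hmρ
        hfx.enorm]
      refine (enorm_integral_le_lintegral_enorm _).trans (lintegral_mono fun y => ?_)
      simp [enorm_smul, Real.enorm_of_nonneg (hρ0 y)]
    have h2 : eLpNorm (fun y => f' (x - y)) 1 ν ≤ eLpNorm (fun y => f' (x - y)) 2 ν :=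
      eLpNorm_le_eLpNorm_of_exponent_le (by norm_num) hfx.aestronglyMeasurable
    refine (ENNReal.rpow_le_rpow (h1.trans h2) (by norm_num)).trans (le_of_eq ?_)
    rw [eLpNorm_eq_lintegral_rpow_enorm_toReal (by norm_num) (by norm_num), ← ENNReal.rpow_mul]
    simp only [ENNReal.toReal_ofNat]
    rw [show (1 / 2 : ℝ) * 2 = 1 by norm_num, ENNReal.rpow_one, hν,
      lintegral_withDensity_eq_lintegral_mul _ hmρ (hfx.enorm.pow_const _)]
    rfl
  rw [eLpNorm_eq_lintegral_rpow_enorm_toReal (by norm_num) (by norm_num),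
    eLpNorm_eq_lintegral_rpow_enorm_toReal (by norm_num) (by norm_num)]
  simp only [ENNReal.toReal_ofNat]
  gcongr ?_ ^ _
  calc ∫⁻ x, ‖(ρ ⋆[ContinuousLinearMap.lsmul ℝ ℝ, μ] f') x‖ₑ ^ (2 : ℝ) ∂μ
      ≤ ∫⁻ x, ∫⁻ y, ENNReal.ofReal (ρ y) * ‖f' (x - y)‖ₑ ^ (2 : ℝ) ∂μ ∂μ := lintegral_mono key
    _ = ∫⁻ y, ∫⁻ x, ENNReal.ofReal (ρ y) * ‖f' (x - y)‖ₑ ^ (2 : ℝ) ∂μ ∂μ := by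
        apply lintegral_lintegral_swap
        apply Measurable.aemeasurable
        apply Measurable.mul
        · exact hmρ.comp measurable_snd
        · exact ((hf'.comp_measurable (measurable_fst.sub measurable_snd)).enorm).pow_const _
    _ = ∫⁻ y, ENNReal.ofReal (ρ y) * ∫⁻ x, ‖f' x‖ₑ ^ (2 : ℝ) ∂μ ∂μ := by
        congr 1 with y
        rw [lintegral_const_mul]
        · rw [lintegral_sub_right_eq_self (fun x => ‖f' x‖ₑ ^ (2 : ℝ)) y]
        · exact ((hf'.comp_measurable (measurable_id.sub measurable_const)).enorm).pow_const _
    _ = ∫⁻ x, ‖f' x‖ₑ ^ (2 : ℝ) ∂μ := by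
        rw [lintegral_mul_const _ hmρ, hρ1, one_mul]

open scoped Convolution in
/-- Mollifications converge in `L²`. -/
theorem tendsto_eLpNorm_convolution_sub {V E : Type*} [NormedAddCommGroup V] [NormedSpace ℝ V]
    [FiniteDimensional ℝ V] [MeasurableSpace V] [BorelSpace V]
    [NormedAddCommGroup E] [NormedSpace ℝ E] [CompleteSpace E] (μ : Measure V)
    [μ.IsAddHaarMeasure] {ρ : ℕ → ContDiffBump (0 : V)}
    (hρ : Tendsto (fun j => (ρ j).rOut) atTop (𝓝 0)) {f : V → E} (hf : MemLp f 2 μ) :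
    Tendsto (fun j => eLpNorm (((ρ j).normed μ ⋆[ContinuousLinearMap.lsmul ℝ ℝ, μ] f) - f) 2 μ)
      atTop (𝓝 0) := by
  have hone : ∀ j, ∫⁻ x, ENNReal.ofReal ((ρ j).normed μ x) ∂μ = 1 := fun j => by
    rw [← ofReal_integral_eq_lintegral_ofReal (ρ j).integrable_normed
      (Eventually.of_forall (ρ j).nonneg_normed), (ρ j).integral_normed, ENNReal.ofReal_one]
  have hce : ∀ (j : ℕ) {g : V → E}, MemLp g 2 μ →
      ConvolutionExists ((ρ j).normed μ) g (ContinuousLinearMap.lsmul ℝ ℝ) μ := fun j g hg =>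
    (ρ j).hasCompactSupport_normed.convolutionExists_left _ (ρ j).continuous_normed
      (hg.locallyIntegrable (by norm_num))
  rw [ENNReal.tendsto_nhds_zero]
  intro e he
  by_cases het : e = ⊤
  · simp [het]
  have he4 : e / 4 ≠ 0 := by simp [he.ne']
  obtain ⟨g, hgs, hfg, hgc, hg⟩ := hf.exists_hasCompactSupport_eLpNorm_sub_le (by norm_num) he4
  have hgu : UniformContinuous g := hgs.uniformContinuous_of_continuous hgc
  -- a large ball containing the supports
  obtain ⟨R, hR⟩ : ∃ R, tsupport g ⊆ Metric.closedBall (0 : V) R :=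
    hgs.isCompact.isBounded.subset_closedBall 0
  set D := Metric.closedBall (0 : V) (R + 1)
  have hD : μ D ≠ ⊤ := (isCompact_closedBall _ _).measure_lt_top.ne
  -- A uniform error δ on D costs μ(D)^{1/2} δ in L². The radius R + 1 of D leaves room for kernels
  -- of radius below 1.
  obtain ⟨δ, hδ, hδe⟩ : ∃ δ : ℝ, 0 < δ ∧ μ D ^ (1 / 2 : ℝ) * ENNReal.ofReal δ ≤ e / 4 := by
    have hfin : μ D ^ (1 / 2 : ℝ) ≠ ⊤ := ENNReal.rpow_ne_top_of_nonneg (by norm_num) hD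
    have : Tendsto (fun δ : ℝ => μ D ^ (1 / 2 : ℝ) * ENNReal.ofReal δ) (𝓝[>] 0) (𝓝 0) := by
      have h : Tendsto (fun δ : ℝ => μ D ^ (1 / 2 : ℝ) * ENNReal.ofReal δ) (𝓝 0)
          (𝓝 (μ D ^ (1 / 2 : ℝ) * ENNReal.ofReal 0)) :=
        ENNReal.Tendsto.const_mul (ENNReal.continuous_ofReal.tendsto 0) (Or.inr hfin)
      simpa using h.mono_left nhdsWithin_le_nhds
    obtain ⟨δ, h1, h2⟩ := ((ENNReal.tendsto_nhds_zero.1 this (e / 4) (pos_iff_ne_zero.2 he4)).and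
      self_mem_nhdsWithin).exists
    exact ⟨δ, h2, h1⟩
  obtain ⟨r, hr, hrδ⟩ := Metric.uniformContinuous_iff.1 hgu δ hδ
  filter_upwards [hρ.eventually (gt_mem_nhds (lt_min hr one_pos))] with j hj
  set cf := ((ρ j).normed μ ⋆[ContinuousLinearMap.lsmul ℝ ℝ, μ] f)
  set cg := ((ρ j).normed μ ⋆[ContinuousLinearMap.lsmul ℝ ℝ, μ] g)
  have hcg : ∀ x, ‖cg x - g x‖ ≤ D.indicator (fun _ => δ) x := by
    intro x
    by_cases hx : x ∈ D
    · rw [Set.indicator_of_mem hx, ← dist_eq_norm]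
      refine (ρ j).dist_normed_convolution_le hgc.aestronglyMeasurable fun y hy => ?_
      exact (hrδ ((Metric.mem_ball.1 hy).trans (hj.trans_le (min_le_left _ _)))).le
    · rw [Set.indicator_of_notMem hx]
      have hz : ∀ y ∈ Metric.ball x (ρ j).rOut, g y = 0 := fun y hy => by
        by_contra hne
        apply hx
        have h1 := hR (subset_tsupport g hne)
        simp only [D, Metric.mem_closedBall, Metric.mem_ball] at *
        have h2 : (ρ j).rOut < 1 := hj.trans_le (min_le_right _ _)
        linarith [dist_triangle_left x 0 y]
      have h0 : g x = 0 := hz x (Metric.mem_ball_self (ρ j).rOut_pos)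
      have : cg x = g x :=
        (ρ j).normed_convolution_eq_right fun y hy => by rw [hz y hy, h0]
      simp [this]
  have h3 : eLpNorm (cg - g) 2 μ ≤ e / 4 := by
    refine le_trans ?_ hδe
    calc eLpNorm (cg - g) 2 μ ≤ eLpNorm (D.indicator fun _ => δ) 2 μ :=
          eLpNorm_mono_real hcg
      _ = μ D ^ (1 / 2 : ℝ) * ENNReal.ofReal δ := by
          rw [eLpNorm_indicator_const Metric.isClosed_closedBall.measurableSet (by norm_num)
            (by norm_num), Real.enorm_of_nonneg hδ.le, mul_comm]
          simp [D]
  have h4 : eLpNorm (cf - cg) 2 μ ≤ e / 4 := by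
    have : cf - cg = ((ρ j).normed μ ⋆[ContinuousLinearMap.lsmul ℝ ℝ, μ] (f - g)) := by
      ext x
      simp only [cf, cg, Pi.sub_apply, convolution_def, map_sub]
      exact (integral_sub (hce j hf x) (hce j hg x)).symm
    rw [this]
    exact (eLpNorm_convolution_le μ (ρ j).continuous_normed (ρ j).nonneg_normed (hone j)
      (hf.sub hg).aestronglyMeasurable).trans hfg
  have hmf : AEStronglyMeasurable f μ := hf.aestronglyMeasurable
  have hmcf : AEStronglyMeasurable cf μ :=
    ((ρ j).hasCompactSupport_normed.continuous_convolution_left _ (ρ j).continuous_normed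
      (hf.locallyIntegrable (by norm_num))).aestronglyMeasurable
  have hmcg : AEStronglyMeasurable cg μ :=
    ((ρ j).hasCompactSupport_normed.continuous_convolution_left _ (ρ j).continuous_normed
      (hg.locallyIntegrable (by norm_num))).aestronglyMeasurable
  have hdec : cf - f = (cf - cg) + ((cg - g) - (f - g)) := by abel
  rw [hdec]
  calc _ ≤ eLpNorm (cf - cg) 2 μ + eLpNorm ((cg - g) - (f - g)) 2 μ :=
        eLpNorm_add_le (hmcf.sub hmcg) ((hmcg.sub hgc.aestronglyMeasurable).sub
          (hmf.sub hgc.aestronglyMeasurable)) (by norm_num)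
    _ ≤ e / 4 + (e / 4 + e / 4) := by
        gcongr
        exact (eLpNorm_sub_le (hmcg.sub hgc.aestronglyMeasurable)
          (hmf.sub hgc.aestronglyMeasurable) (by norm_num)).trans (add_le_add h3 hfg)
    _ ≤ e / 4 + (e / 4 + e / 4) + e / 4 := le_self_add
    _ = e := by
        rw [← ENNReal.add_div, ← ENNReal.add_div, ← ENNReal.add_div]
        rw [show e + (e + e) + e = e * 4 by ring]
        exact ENNReal.mul_div_cancel_right (by norm_num) (by norm_num)

/-! ### Pointwise algebra -/

/-- Young's inequality with weight `c`. -/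
theorem young_absorb {c M w y b : ℝ} (hc0 : 0 < c) (hc1 : c ≤ 1) (hM : 1 ≤ M) :
    12 * M * w * y + 2 * b * w + 10 * M * y ^ 2 ≤
      c / 4 * w ^ 2 + 300 * M ^ 2 / c * (y ^ 2 + b ^ 2) := by
  -- Each product with w is absorbed by completing a square with weight c/8. Two of them use up the
  -- allowance c/4.
  have hy1 : 12 * M * w * y ≤ c / 8 * w ^ 2 + 288 * M ^ 2 / c * y ^ 2 := by
    have h : 0 ≤ (c / 8) * (w - 48 * M * y / c) ^ 2 := by positivity
    have e4 : (c / 8) * (w - 48 * M * y / c) ^ 2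
        = c / 8 * w ^ 2 - 12 * M * w * y + 288 * M ^ 2 / c * y ^ 2 := by
      field_simp; ring
    linarith
  have hy2 : 2 * b * w ≤ c / 8 * w ^ 2 + 8 / c * b ^ 2 := by
    have h : 0 ≤ (c / 8) * (w - 8 * b / c) ^ 2 := by positivity
    have e4 : (c / 8) * (w - 8 * b / c) ^ 2
        = c / 8 * w ^ 2 - 2 * b * w + 8 / c * b ^ 2 := by
      field_simp; ring
    linarith
  have hy3 : 10 * M * y ^ 2 ≤ 10 * M ^ 2 / c * y ^ 2 := by
    have : 10 * M ≤ 10 * M ^ 2 / c := by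
      rw [le_div_iff₀ hc0]; nlinarith
    gcongr
  have hy4 : 8 / c * b ^ 2 ≤ 300 * M ^ 2 / c * b ^ 2 := by
    have : (8 : ℝ) ≤ 300 * M ^ 2 := by nlinarith
    gcongr
  have hy5 : 288 * M ^ 2 / c * y ^ 2 + 10 * M ^ 2 / c * y ^ 2 ≤ 300 * M ^ 2 / c * y ^ 2 := by
    rw [← add_mul, ← add_div]
    gcongr
    linarith [sq_nonneg M]
  have : 300 * M ^ 2 / c * (y ^ 2 + b ^ 2) = 300 * M ^ 2 / c * y ^ 2 + 300 * M ^ 2 / c * b ^ 2 := by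
    ring
  rw [this]
  linarith

set_option maxHeartbeats 1000000 in
/-- The pointwise inequality behind the energy estimate. -/
theorem pointwise_energy {V : Type*} [NormedAddCommGroup V] [NormedSpace ℝ V]
    (S : V →ₗ[ℝ] V →ₗ[ℝ] ℝ) (P : V →ₗ[ℝ] V) {M : ℝ} (hM : 1 ≤ M)
    (hS : ∀ ξ ζ, |S ξ ζ| ≤ M * ‖ξ‖ * ‖ζ‖) (hP : ∀ ξ, ‖P ξ‖ ≤ ‖ξ‖) (hPP : ∀ ξ, P (P ξ) = P ξ)
    (hpos : ∀ ξ, 0 ≤ S (P ξ) (P ξ)) {t a ε θ₀ θ₁ α₀ α₁ l₀ l₁ β b : ℝ} (ht : |t| ≤ 1)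
    (hθ : θ₀ ^ 2 + θ₁ ^ 2 = 1) (ha : a * (1 - t * θ₁ ^ 2) = t * θ₁ ^ 2)
    (hα₀ : |α₀| ≤ ε / 2) (hα₁ : |α₁| ≤ ε / 2) (hε : ε ≤ 1) (hl₀ : 0 < l₀) (hl₁ : 0 < l₁)
    (hl₀' : l₀ ≤ 1) (hl₁' : l₁ ≤ 1) (hεl₀ : 144 * M * ε ≤ l₀) (hεl₁ : 144 * M * ε ≤ l₁)
    (X Y : V) (hb : 0 ≤ b) (hβ : |β| ≤ b * ‖X‖) :
    let W := X + a • P X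
    let D₀ := θ₀ • (W + α₀ • P X + Y)
    let D₁ := θ₁ • (W + α₁ • P X + Y)
    let c := θ₀ ^ 2 * l₀ + θ₁ ^ 2 * l₁
    S D₀ D₀ - l₀ * ‖D₀‖ ^ 2 + (S (D₁ - t • P D₁) (D₁ + t • P D₁) - l₁ * ‖D₁‖ ^ 2)
        - (S X (X + (2 * a) • P X) + 2 * S X Y - β)
      ≤ -(c / 8 * ‖W‖ ^ 2) + 300 * M ^ 2 / c * (‖Y‖ ^ 2 + b ^ 2) := by
  intro W D₀ D₁ c
  set s := t * θ₁ ^ 2 with hs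
  have hθ₁ : θ₁ ^ 2 ≤ 1 := by linarith [sq_nonneg θ₀]
  have hs1 : |s| ≤ 1 := by
    rw [hs, abs_mul, abs_of_nonneg (sq_nonneg θ₁)]
    exact mul_le_one₀ ht (sq_nonneg _) hθ₁
  have hPW : P W = (1 + a) • P X := by simp [W, hPP, add_smul]
  -- Here s = a/(1 + a). As PW = (1 + a)PX, it follows that X = W - sPW and X + 2aPX = W + sPW: the
  -- form coming from the equation is the elliptic form with parameter s, evaluated at W.
  have has : a = s * (1 + a) := by linarith
  have hX : X = W - s • P W := by
    rw [hPW, smul_smul, ← has]; simp [W]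
  have hX2 : X + (2 * a) • P X = W + s • P W := by
    rw [hPW, smul_smul, ← has]; simp only [W]; rw [two_mul, add_smul, add_assoc]
  have hXW : ‖X‖ ≤ 2 * ‖W‖ := by
    calc ‖X‖ = ‖W - s • P W‖ := by rw [← hX]
      _ ≤ ‖W‖ + |s| * ‖P W‖ := by
        refine (norm_sub_le _ _).trans ?_
        rw [norm_smul, Real.norm_eq_abs]
      _ ≤ ‖W‖ + 1 * ‖W‖ := by
        gcongr
        exact hP W
      _ = 2 * ‖W‖ := by ring
  set w := ‖W‖ with hw
  set y := ‖Y‖ with hy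
  have hw0 : 0 ≤ w := norm_nonneg _
  have hy0 : 0 ≤ y := norm_nonneg _
  have hε0 : 0 ≤ ε := by linarith [abs_nonneg α₀]
  -- the form `F τ`
  let F : ℝ → V → ℝ := fun τ Z => S (Z - τ • P Z) (Z + τ • P Z)
  have hFexp : ∀ τ Z, F τ Z = S Z Z + τ * (S Z (P Z) - S (P Z) Z) - τ ^ 2 * S (P Z) (P Z) := by
    intro τ Z
    simp only [F, map_sub, map_add, map_smul, LinearMap.sub_apply, LinearMap.smul_apply,
      smul_eq_mul]
    ring
  have hFsmul : ∀ τ (κ : ℝ) Z, F τ (κ • Z) = κ ^ 2 * F τ Z := by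
    intro τ κ Z
    simp only [hFexp, map_smul, LinearMap.smul_apply, smul_eq_mul]
    ring
  have hside : ∀ τ : ℝ, |τ| ≤ 1 → ∀ Z, ‖Z - τ • P Z‖ ≤ 2 * ‖Z‖ ∧ ‖Z + τ • P Z‖ ≤ 2 * ‖Z‖ := by
    intro τ hτ Z
    have h : ‖τ • P Z‖ ≤ ‖Z‖ := by
      rw [norm_smul, Real.norm_eq_abs]
      exact (mul_le_of_le_one_left (norm_nonneg _) hτ).trans (hP Z)
    constructor
    · linarith [norm_sub_le Z (τ • P Z)]
    · linarith [norm_add_le Z (τ • P Z)]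
  have hbil : ∀ τ : ℝ, |τ| ≤ 1 → ∀ Z Z', |S (Z - τ • P Z) (Z' + τ • P Z')| ≤ 4 * M * ‖Z‖ * ‖Z'‖ := by
    intro τ hτ Z Z'
    calc _ ≤ M * ‖Z - τ • P Z‖ * ‖Z' + τ • P Z'‖ := hS _ _
      _ ≤ M * (2 * ‖Z‖) * (2 * ‖Z'‖) := by
        gcongr
        · exact (hside τ hτ Z).1
        · exact (hside τ hτ Z').2
      _ = 4 * M * ‖Z‖ * ‖Z'‖ := by ring
  have hFadd : ∀ τ : ℝ, |τ| ≤ 1 → ∀ Z E, F τ (Z + E) ≤ F τ Z + 8 * M * ‖Z‖ * ‖E‖ + 4 * M * ‖E‖ ^ 2 := by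
    intro τ hτ Z E
    have e1 : F τ (Z + E) = F τ Z + S (Z - τ • P Z) (E + τ • P E)
        + S (E - τ • P E) (Z + τ • P Z) + S (E - τ • P E) (E + τ • P E) := by
      simp only [F, map_sub, map_add, map_smul, LinearMap.sub_apply, LinearMap.add_apply,
        LinearMap.smul_apply, smul_eq_mul]
      ring
    have h1 := (abs_le.1 (hbil τ hτ Z E)).2
    have h2 := (abs_le.1 (hbil τ hτ E Z)).2
    have h3 := (abs_le.1 (hbil τ hτ E E)).2
    rw [e1]
    linarith [sq ‖E‖, congrArg (4 * M * ·) (sq ‖E‖)]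
  -- This bounds every perturbation αPX + Y with |α| ≤ ε/2, because ‖X‖ ≤ 2w.
  set e := ε * w + y with he
  have he0 : 0 ≤ e := by positivity
  have hE : ∀ α : ℝ, |α| ≤ ε / 2 → ‖α • P X + Y‖ ≤ e := by
    intro α hα
    refine (norm_add_le _ _).trans ?_
    rw [norm_smul, Real.norm_eq_abs]
    have := hP X
    have h2 : |α| * ‖P X‖ ≤ ε / 2 * (2 * w) := by
      gcongr
      linarith
    linarith
  have hstep : ∀ τ : ℝ, |τ| ≤ 1 → ∀ α : ℝ, |α| ≤ ε / 2 → ∀ l : ℝ, 0 < l → l ≤ 1 →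
      F τ (W + α • P X + Y) - l * ‖W + α • P X + Y‖ ^ 2
        ≤ F τ W + 8 * M * w * e + 5 * M * e ^ 2 - l / 2 * w ^ 2 := by
    intro τ hτ α hα l hl hl1
    have h1 := hFadd τ hτ W (α • P X + Y)
    have h2 := hE α hα
    rw [← add_assoc] at h1
    have h3 : ‖W‖ ≤ ‖W + α • P X + Y‖ + ‖α • P X + Y‖ := by
      have := norm_sub_le (W + α • P X + Y) (α • P X + Y)
      rwa [add_assoc, add_sub_cancel_right, ← add_assoc] at this
    set q := ‖W + α • P X + Y‖
    set k := ‖α • P X + Y‖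
    have hk0 : 0 ≤ k := norm_nonneg _
    have hq0 : 0 ≤ q := norm_nonneg _
    have h4 : w ^ 2 ≤ 2 * q ^ 2 + 2 * e ^ 2 := by
      have : w ≤ q + e := by linarith
      linarith [sq_nonneg (q - e), pow_le_pow_left₀ hw0 this 2]
    have h5 : 8 * M * w * k ≤ 8 * M * w * e := by gcongr
    have h6 : 4 * M * k ^ 2 ≤ 4 * M * e ^ 2 := by gcongr
    have h7 : l * e ^ 2 ≤ M * e ^ 2 := by
      gcongr
      linarith
    have h8 : l * w ^ 2 ≤ l * (2 * q ^ 2 + 2 * e ^ 2) := by gcongr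
    linarith
  have hS0 : S D₀ D₀ - l₀ * ‖D₀‖ ^ 2 =
      θ₀ ^ 2 * (F 0 (W + α₀ • P X + Y) - l₀ * ‖W + α₀ • P X + Y‖ ^ 2) := by
    have : S D₀ D₀ = F 0 D₀ := by simp [F]
    rw [this, hFsmul, norm_smul, mul_pow, Real.norm_eq_abs, sq_abs]
    ring
  have hS1 : S (D₁ - t • P D₁) (D₁ + t • P D₁) - l₁ * ‖D₁‖ ^ 2 =
      θ₁ ^ 2 * (F t (W + α₁ • P X + Y) - l₁ * ‖W + α₁ • P X + Y‖ ^ 2) := by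
    have : S (D₁ - t • P D₁) (D₁ + t • P D₁) = F t D₁ := rfl
    rw [this, hFsmul, norm_smul, mul_pow, Real.norm_eq_abs, sq_abs]
    ring
  -- Concavity of τ ↦ F τ W between 0 and t, at the point s = tθ₁². The defect is exactly θ₁²(1 -
  -- θ₁²)t² S(PW, PW), nonnegative by `hpos`.
  have hconc : θ₀ ^ 2 * F 0 W + θ₁ ^ 2 * F t W ≤ S X (X + (2 * a) • P X) := by
    have e1 : S X (X + (2 * a) • P X) = F s W := by
      rw [hX2]
      conv_lhs => rw [hX]
    rw [e1, hFexp, hFexp, hFexp]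
    have e2 : θ₀ ^ 2 = 1 - θ₁ ^ 2 := by linarith
    have h := hpos W
    have : 0 ≤ θ₁ ^ 2 * (1 - θ₁ ^ 2) * t ^ 2 * S (P W) (P W) := by
      have : 0 ≤ 1 - θ₁ ^ 2 := by linarith
      positivity
    rw [e2, hs]
    linarith
  have hXY : -(2 * S X Y) ≤ 4 * M * w * y := by
    have := (abs_le.1 (hS X Y)).1
    have h2 : M * ‖X‖ * ‖Y‖ ≤ M * (2 * w) * y := by gcongr
    linarith
  have hβ' : β ≤ 2 * b * w := by
    have := (abs_le.1 hβ).2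
    have h2 : b * ‖X‖ ≤ b * (2 * w) := by gcongr
    linarith
  have g0 := mul_le_mul_of_nonneg_left (hstep 0 (by simp) α₀ hα₀ l₀ hl₀ hl₀') (sq_nonneg θ₀)
  have g1 := mul_le_mul_of_nonneg_left (hstep t ht α₁ hα₁ l₁ hl₁ hl₁') (sq_nonneg θ₁)
  have hcM : 144 * M * ε ≤ c := by
    have e2 : θ₀ ^ 2 = 1 - θ₁ ^ 2 := by linarith
    have := mul_le_mul_of_nonneg_left hεl₀ (sq_nonneg θ₀)
    have := mul_le_mul_of_nonneg_left hεl₁ (sq_nonneg θ₁)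
    simp only [c]
    rw [e2] at *
    linarith
  have hc0 : 0 < c := by
    have h1 := sq_nonneg θ₀
    have h2 := sq_nonneg θ₁
    simp only [c]
    rcases h1.lt_or_eq with h | h
    · positivity
    · rw [← h] at hθ ⊢
      have : θ₁ ^ 2 = 1 := by linarith
      rw [this]; linarith
  have hc1 : c ≤ 1 := by
    have := mul_le_mul_of_nonneg_left hl₀' (sq_nonneg θ₀)
    have := mul_le_mul_of_nonneg_left hl₁' (sq_nonneg θ₁)
    simp only [c]; linarith
  rw [hS0, hS1]
  have hsum : θ₀ ^ 2 * (F 0 (W + α₀ • P X + Y) - l₀ * ‖W + α₀ • P X + Y‖ ^ 2)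
      + θ₁ ^ 2 * (F t (W + α₁ • P X + Y) - l₁ * ‖W + α₁ • P X + Y‖ ^ 2)
      ≤ S X (X + (2 * a) • P X) + 8 * M * w * e + 5 * M * e ^ 2 - c / 2 * w ^ 2 := by
    have e3 : θ₀ ^ 2 * (F 0 W + 8 * M * w * e + 5 * M * e ^ 2 - l₀ / 2 * w ^ 2)
      + θ₁ ^ 2 * (F t W + 8 * M * w * e + 5 * M * e ^ 2 - l₁ / 2 * w ^ 2)
      = θ₀ ^ 2 * F 0 W + θ₁ ^ 2 * F t W
        + (θ₀ ^ 2 + θ₁ ^ 2) * (8 * M * w * e + 5 * M * e ^ 2) - c / 2 * w ^ 2 := by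
      simp only [c]; ring
    rw [hθ] at e3
    linarith
  have he1 : 8 * M * w * e + 5 * M * e ^ 2 ≤ 18 * M * ε * w ^ 2 + 8 * M * w * y
      + 10 * M * y ^ 2 := by
    have h1 : e ^ 2 ≤ 2 * (ε * w ^ 2) + 2 * y ^ 2 := by
      have : (ε * w) ^ 2 ≤ ε * w ^ 2 := by
        rw [mul_pow]
        have : ε ^ 2 ≤ ε := pow_le_of_le_one hε0 hε two_ne_zero
        gcongr
      rw [he]
      linarith [sq_nonneg (ε * w - y)]
    have h2 : 5 * M * e ^ 2 ≤ 5 * M * (2 * (ε * w ^ 2) + 2 * y ^ 2) := by gcongr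
    have h3 : 8 * M * w * e = 8 * (M * ε * w ^ 2) + 8 * M * w * y := by rw [he]; ring
    linarith
  -- The factor 144 = 18 · 8 in the smallness of ε is used here. Of the available -c/2, this term
  -- takes c/8 and Young's inequality takes c/4, which leaves -c/8.
  have he2 : 18 * M * ε * w ^ 2 ≤ c / 8 * w ^ 2 := by
    have : 18 * M * ε ≤ c / 8 := by linarith
    gcongr
  have := young_absorb (w := w) (y := y) (b := b) hc0 hc1 hM
  linarith

section

/-! ### Tensors -/

/-- A vector of `ℂᴺ` is bounded by the sum of its components. -/
theorem norm_le_sum_norm {ι : Type*} [Fintype ι] (x : EuclideanSpace ℂ ι) :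
    ‖x‖ ≤ ∑ i, ‖x i‖ := by
  rw [EuclideanSpace.norm_eq]
  refine Real.sqrt_le_iff.2 ⟨Finset.sum_nonneg fun i _ => norm_nonneg _, ?_⟩
  exact Finset.sum_sq_le_sq_sum_of_nonneg fun i _ => norm_nonneg _

theorem norm_component_le {ι : Type*} [Fintype ι] (x : EuclideanSpace ℂ ι) (i : ι) : ‖x i‖ ≤ ‖x‖ :=
  PiLp.norm_apply_le x i

theorem aestronglyMeasurable_euclidean {ι X : Type*} [Fintype ι] [MeasurableSpace X]
    {μ : Measure X} {f : X → EuclideanSpace ℂ ι}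
    (hf : ∀ i, AEStronglyMeasurable (fun x => f x i) μ) : AEStronglyMeasurable f μ := by
  have h : AEStronglyMeasurable (fun x i => f x i) μ :=
    (aemeasurable_pi_iff.2 fun i => (hf i).aemeasurable).aestronglyMeasurable
  exact (PiLp.continuous_toLp 2 (fun _ : ι => ℂ)).comp_aestronglyMeasurable h

theorem aestronglyMeasurable_component {ι X : Type*} [Fintype ι] [MeasurableSpace X]
    {μ : Measure X} {f : X → EuclideanSpace ℂ ι} (hf : AEStronglyMeasurable f μ) (i : ι) :
    AEStronglyMeasurable (fun x => f x i) μ :=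
  (EuclideanSpace.proj (𝕜 := ℂ) i).continuous.comp_aestronglyMeasurable hf

/-- The tensor `(a_h w^α)` with a real vector `a`. -/
def tens (w : Vec m) (a : Fin n → ℝ) : Tens n m :=
  WithLp.toLp 2 fun i => (a i.1 : ℂ) * w i.2

/-- The classical gradient of a real function. -/
def gradR (η : Pt n → ℝ) (x : Pt n) : Fin n → ℝ :=
  fun h => fderiv ℝ η x (EuclideanSpace.single h 1)

@[simp] theorem tens_apply (w : Vec m) (a : Fin n → ℝ) (i : Fin n × Fin m) :
    tens w a i = (a i.1 : ℂ) * w i.2 := rfl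

@[simp] theorem grad_apply (φ : Pt n → Vec m) (x : Pt n) (i : Fin n × Fin m) :
    grad φ x i = fderiv ℝ φ x (EuclideanSpace.single i.1 1) i.2 := rfl

@[simp] theorem radial_apply (w : Vec m) (ξ : Tens n m) (i : Fin n × Fin m) :
    radial w ξ i =
      w i.2 * (((∑ β, w β * star (ξ (i.1, β))).re / ‖w‖ ^ 2 : ℝ) : ℂ) := rfl

@[simp] theorem applyA_apply (A : Coef2 n m) (ξ : Tens n m) (i : Fin n × Fin m) :
    applyA A ξ i = ∑ k, ∑ β, A i.1 k i.2 β * ξ (k, β) := rfl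

@[simp] theorem applyB_apply (B : Coef1 n m) (ξ : Tens n m) (α : Fin m) :
    applyB B ξ α = ∑ h, ∑ β, B h α β * ξ (h, β) := rfl

theorem tens_smul_left (c : ℝ) (w : Vec m) (a : Fin n → ℝ) : tens (c • w) a = c • tens w a := by
  ext i; simp; ring

theorem tens_smul_right (c : ℝ) (w : Vec m) (a : Fin n → ℝ) : tens w (c • a) = c • tens w a := by
  ext i; simp; ring

@[simp] theorem tens_zero_left (a : Fin n → ℝ) : tens (0 : Vec m) a = 0 := by
  ext i; simp

@[simp] theorem tens_zero_right (w : Vec m) : tens w (0 : Fin n → ℝ) = 0 := by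
  ext i; simp

theorem norm_tens_sq (w : Vec m) (a : Fin n → ℝ) :
    ‖tens w a‖ ^ 2 = (∑ h, a h ^ 2) * ‖w‖ ^ 2 := by
  rw [EuclideanSpace.norm_sq_eq, EuclideanSpace.norm_sq_eq, Fintype.sum_prod_type,
    Finset.sum_mul_sum]
  simp [mul_pow]

/-- `radial w` as a real linear map. -/
def radialL (w : Vec m) : Tens n m →ₗ[ℝ] Tens n m where
  toFun := radial w
  map_add' ξ ζ := by
    ext i
    simp only [radial_apply, PiLp.add_apply, star_add, mul_add, Finset.sum_add_distrib,
      Complex.add_re, add_div, Complex.ofReal_add]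
  map_smul' c ξ := by
    ext i
    simp only [radial_apply, PiLp.smul_apply, RingHom.id_apply]
    have : ∑ β, w β * star (c • ξ (i.1, β)) = (c : ℂ) * ∑ β, w β * star (ξ (i.1, β)) := by
      rw [Finset.mul_sum]
      refine Finset.sum_congr rfl fun β _ => ?_
      simp; ring
    rw [this, Complex.re_ofReal_mul, mul_div_assoc]
    simp; ring

/-- The real coefficients of `radial w ξ` along `w`. -/
def radialCoef (w : Vec m) (ξ : Tens n m) : Fin n → ℝ :=
  fun h => (∑ β, w β * star (ξ (h, β))).re / ‖w‖ ^ 2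

/-- The coefficients along `w` are real, so a radial tensor has rank one with a real direction. This
is what brings the Legendre–Hadamard condition into play. -/
theorem radial_eq_tens (w : Vec m) (ξ : Tens n m) : radial w ξ = tens w (radialCoef w ξ) := by
  ext i; simp [radialCoef]; ring

@[simp] theorem radial_zero_left (ξ : Tens n m) : radial (0 : Vec m) ξ = 0 := by
  ext i; simp

theorem radialCoef_tens {w : Vec m} (hw : w ≠ 0) (a : Fin n → ℝ) : radialCoef w (tens w a) = a := by
  ext h
  have h1 : ∑ β, w β * star (tens w a (h, β)) = ((a h * ‖w‖ ^ 2 : ℝ) : ℂ) := by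
    rw [EuclideanSpace.norm_sq_eq, Finset.mul_sum]
    push_cast
    refine Finset.sum_congr rfl fun β _ => ?_
    rw [← Complex.mul_conj']
    simp; ring
  have hw' : ‖w‖ ^ 2 ≠ 0 := by positivity
  rw [radialCoef, h1, Complex.ofReal_re, mul_div_cancel_right₀ _ hw']

theorem radial_tens (w : Vec m) (a : Fin n → ℝ) : radial w (tens w a) = tens w a := by
  by_cases hw : w = 0
  · simp [hw]
  · rw [radial_eq_tens, radialCoef_tens hw]

theorem radial_radial (w : Vec m) (ξ : Tens n m) : radial w (radial w ξ) = radial w ξ := by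
  rw [radial_eq_tens w ξ, radial_tens]

/-- The radial part depends only on the real line through `w`. A test function η g(|u|)u therefore
defines the same projection as u wherever the scalar factor does not vanish. -/
theorem radial_smul_left {c : ℝ} (hc : c ≠ 0) (w : Vec m) (ξ : Tens n m) :
    radial (c • w) ξ = radial w ξ := by
  ext i
  simp only [radial_apply, PiLp.smul_apply]
  have : ∑ β, (c • w β) * star (ξ (i.1, β)) = (c : ℂ) * ∑ β, w β * star (ξ (i.1, β)) := by
    rw [Finset.mul_sum]
    refine Finset.sum_congr rfl fun β _ => ?_
    simp; ring
  rw [this, Complex.re_ofReal_mul, norm_smul, mul_pow, Real.norm_eq_abs, sq_abs]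
  have e : c * (∑ β, w β * star (ξ (i.1, β))).re / (c ^ 2 * ‖w‖ ^ 2)
      = c⁻¹ * ((∑ β, w β * star (ξ (i.1, β))).re / ‖w‖ ^ 2) := by
    field_simp
  rw [e]
  have hc' : (c : ℂ) ≠ 0 := by exact_mod_cast hc
  simp only [Complex.ofReal_mul, Complex.ofReal_inv, Complex.real_smul]
  field_simp

/-- For `w ≠ 0` the map `radial w` is the real orthogonal projection onto the tensors `tens w a`;
row by row this is the Cauchy–Schwarz inequality. -/
theorem norm_radial_le (w : Vec m) (ξ : Tens n m) : ‖radial w ξ‖ ≤ ‖ξ‖ := by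
  by_cases hw : w = 0
  · simp [hw]
  have hw' : 0 < ‖w‖ ^ 2 := by positivity
  refine le_of_sq_le_sq ?_ (norm_nonneg _)
  rw [radial_eq_tens, norm_tens_sq, Finset.sum_mul, EuclideanSpace.norm_sq_eq ξ,
    Fintype.sum_prod_type]
  refine Finset.sum_le_sum fun h _ => ?_
  set ξh : Vec m := WithLp.toLp 2 fun β => ξ (h, β)
  have e1 : ∑ β, w β * star (ξ (h, β)) = inner ℂ ξh w := by
    simp [PiLp.inner_apply, ξh]
  have e2 : ∑ β, ‖ξ (h, β)‖ ^ 2 = ‖ξh‖ ^ 2 := by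
    rw [EuclideanSpace.norm_sq_eq]
  rw [radialCoef, e1, e2, div_pow, div_mul_eq_mul_div, div_le_iff₀ (by positivity)]
  have h1 : (inner ℂ ξh w).re ^ 2 ≤ (‖ξh‖ * ‖w‖) ^ 2 := by
    rw [sq_le_sq, abs_of_nonneg (by positivity : (0 : ℝ) ≤ ‖ξh‖ * ‖w‖)]
    exact (Complex.abs_re_le_norm _).trans (norm_inner_le_norm _ _)
  calc (inner ℂ ξh w).re ^ 2 * ‖w‖ ^ 2 ≤ (‖ξh‖ * ‖w‖) ^ 2 * ‖w‖ ^ 2 := by gcongr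
    _ = ‖ξh‖ ^ 2 * (‖w‖ ^ 2) ^ 2 := by ring

/-- The real part of the form of `A` as a real bilinear map. -/
def formA (A : Coef2 n m) : Tens n m →ₗ[ℝ] Tens n m →ₗ[ℝ] ℝ :=
  LinearMap.mk₂ ℝ (fun ξ ζ => (inner ℂ ζ (applyA A ξ)).re)
    (fun ξ ξ' ζ => by
      have : applyA A (ξ + ξ') = applyA A ξ + applyA A ξ' := by
        ext i; simp [mul_add, Finset.sum_add_distrib]
      simp [this])
    (fun c ξ ζ => by
      have : applyA A (c • ξ) = (c : ℂ) • applyA A ξ := by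
        ext i
        simp only [applyA_apply, PiLp.smul_apply, smul_eq_mul, Finset.mul_sum]
        refine Finset.sum_congr rfl fun k _ => Finset.sum_congr rfl fun β _ => ?_
        simp; ring
      simp [this])
    (fun ξ ζ ζ' => by simp)
    (fun c ξ ζ => by
      have : c • ζ = (c : ℂ) • ζ := by ext i; simp
      rw [this, inner_smul_left]
      simp)

theorem formA_apply (A : Coef2 n m) (ξ ζ : Tens n m) :
    formA A ξ ζ = (inner ℂ ζ (applyA A ξ)).re := rfl

theorem norm_applyA_le {A : Coef2 n m} {Λ : ℝ} (hA : ∀ h k α β, ‖A h k α β‖ ≤ Λ) (ξ : Tens n m) :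
    ‖applyA A ξ‖ ≤ (n * m) ^ 2 * Λ * ‖ξ‖ := by
  refine (norm_le_sum_norm _).trans ?_
  have : ∀ i, ‖applyA A ξ i‖ ≤ n * m * (Λ * ‖ξ‖) := by
    intro i
    rw [applyA_apply]
    refine (norm_sum_le _ _).trans ?_
    calc _ ≤ ∑ k : Fin n, ∑ β : Fin m, Λ * ‖ξ‖ := by
          refine Finset.sum_le_sum fun k _ => (norm_sum_le _ _).trans
            (Finset.sum_le_sum fun β _ => ?_)
          rw [norm_mul]
          exact mul_le_mul (hA _ _ _ _) (norm_component_le _ _) (norm_nonneg _)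
            ((norm_nonneg _).trans (hA i.1 k i.2 β))
      _ = _ := by simp; ring
  refine (Finset.sum_le_sum fun i _ => this i).trans (le_of_eq ?_)
  simp [Fintype.card_prod]; ring

theorem norm_applyB_le {B : Coef1 n m} {K : ℝ} (hB : ∀ h α β, ‖B h α β‖ ≤ K) (ξ : Tens n m) :
    ‖applyB B ξ‖ ≤ n * m ^ 2 * K * ‖ξ‖ := by
  refine (norm_le_sum_norm _).trans ?_
  have : ∀ i, ‖applyB B ξ i‖ ≤ n * m * (K * ‖ξ‖) := by
    intro i
    rw [applyB_apply]
    refine (norm_sum_le _ _).trans ?_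
    calc _ ≤ ∑ k : Fin n, ∑ β : Fin m, K * ‖ξ‖ := by
          refine Finset.sum_le_sum fun k _ => (norm_sum_le _ _).trans
            (Finset.sum_le_sum fun β _ => ?_)
          rw [norm_mul]
          exact mul_le_mul (hB _ _ _) (norm_component_le _ _) (norm_nonneg _)
            ((norm_nonneg _).trans (hB k i β))
      _ = _ := by simp; ring
  refine (Finset.sum_le_sum fun i _ => this i).trans (le_of_eq ?_)
  simp; ring

theorem abs_formA_le {A : Coef2 n m} {Λ : ℝ} (hA : ∀ h k α β, ‖A h k α β‖ ≤ Λ)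
    (ξ ζ : Tens n m) : |formA A ξ ζ| ≤ (n * m) ^ 2 * Λ * ‖ξ‖ * ‖ζ‖ := by
  rw [formA_apply]
  calc _ ≤ ‖inner ℂ ζ (applyA A ξ)‖ := Complex.abs_re_le_norm _
    _ ≤ ‖ζ‖ * ‖applyA A ξ‖ := norm_inner_le_norm _ _
    _ ≤ ‖ζ‖ * ((n * m) ^ 2 * Λ * ‖ξ‖) := by gcongr; exact norm_applyA_le hA ξ
    _ = _ := by ring

/-! ### Measurability of the tensor operations -/

section Measurability

variable {X : Type*} [MeasurableSpace X] {μ : Measure X}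

theorem aestronglyMeasurable_applyA {A : X → Coef2 n m} {ξ : X → Tens n m}
    (hA : ∀ h k α β, AEStronglyMeasurable (fun x => A x h k α β) μ)
    (hξ : AEStronglyMeasurable ξ μ) : AEStronglyMeasurable (fun x => applyA (A x) (ξ x)) μ := by
  refine aestronglyMeasurable_euclidean fun i => ?_
  simp only [applyA_apply]
  exact Finset.aestronglyMeasurable_fun_sum _ fun k _ =>
    Finset.aestronglyMeasurable_fun_sum _ fun β _ => (hA _ _ _ _).mul (aestronglyMeasurable_component hξ _)

theorem aestronglyMeasurable_applyB {B : X → Coef1 n m} {ξ : X → Tens n m}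
    (hB : ∀ h α β, AEStronglyMeasurable (fun x => B x h α β) μ)
    (hξ : AEStronglyMeasurable ξ μ) : AEStronglyMeasurable (fun x => applyB (B x) (ξ x)) μ := by
  refine aestronglyMeasurable_euclidean fun i => ?_
  simp only [applyB_apply]
  exact Finset.aestronglyMeasurable_fun_sum _ fun k _ =>
    Finset.aestronglyMeasurable_fun_sum _ fun β _ => (hB _ _ _).mul (aestronglyMeasurable_component hξ _)

theorem aestronglyMeasurable_radial {w : X → Vec m} {ξ : X → Tens n m}
    (hw : AEStronglyMeasurable w μ)
    (hξ : AEStronglyMeasurable ξ μ) : AEStronglyMeasurable (fun x => radial (w x) (ξ x)) μ := by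
  refine aestronglyMeasurable_euclidean fun i => ?_
  simp only [radial_apply]
  refine (aestronglyMeasurable_component hw _).mul ?_
  refine Complex.continuous_ofReal.comp_aestronglyMeasurable ?_
  refine AEMeasurable.aestronglyMeasurable (AEMeasurable.div ?_ ?_)
  · refine Complex.measurable_re.comp_aemeasurable (AEStronglyMeasurable.aemeasurable ?_)
    exact Finset.aestronglyMeasurable_fun_sum _ fun β _ =>
      (aestronglyMeasurable_component hw _).mul (aestronglyMeasurable_component hξ _).star
  · exact hw.norm.aemeasurable.pow_const 2

theorem aestronglyMeasurable_tens {w : X → Vec m} {a : X → Fin n → ℝ}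
    (hw : AEStronglyMeasurable w μ) (ha : ∀ h, AEStronglyMeasurable (fun x => a x h) μ) :
    AEStronglyMeasurable (fun x => tens (w x) (a x)) μ := by
  refine aestronglyMeasurable_euclidean fun i => ?_
  simp only [tens_apply]
  exact (Complex.continuous_ofReal.comp_aestronglyMeasurable (ha _)).mul (aestronglyMeasurable_component hw _)

theorem aestronglyMeasurable_formA {A : X → Coef2 n m} {ξ ζ : X → Tens n m}
    (hA : ∀ h k α β, AEStronglyMeasurable (fun x => A x h k α β) μ)
    (hξ : AEStronglyMeasurable ξ μ) (hζ : AEStronglyMeasurable ζ μ) :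
    AEStronglyMeasurable (fun x => formA (A x) (ξ x) (ζ x)) μ := by
  simp only [formA_apply]
  exact Complex.continuous_re.comp_aestronglyMeasurable
    (hζ.inner (aestronglyMeasurable_applyA hA hξ))

end Measurability

end

section

/-! ### Radial maps `w ↦ g(|w|) w` -/

/-- A bounded weight `g` on `[0, ∞)` with logarithmic derivative `s g'(s) = β(s) g(s)`, such that
`w ↦ g(|w|) w` is continuously differentiable with bounded derivative. -/
structure RadialWeight (g β : ℝ → ℝ) (M : ℝ) : Prop where
  hasDerivAt : ∀ s, 0 < s → HasDerivAt g (β s * g s / s) s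
  continuousOn : ContinuousOn β (Set.Ioi 0)
  tendsto_zero : Tendsto g (𝓝[>] 0) (𝓝 (g 0))
  tendsto_mul_zero : Tendsto (fun s => β s * g s) (𝓝[>] 0) (𝓝 0)
  abs_le : ∀ s, 0 ≤ s → |g s| ≤ M
  abs_mul_le : ∀ s, 0 < s → |β s * g s| ≤ M

section RadialMap

variable {V : Type*} [NormedAddCommGroup V] [InnerProductSpace ℝ V] {g β : ℝ → ℝ} {M : ℝ}

/-- The map `w ↦ g(|w|) w`. -/
def radialMap (g : ℝ → ℝ) (w : V) : V := g ‖w‖ • w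

/-- The derivative of `w ↦ g(|w|) w`. -/
def radialMapDeriv (g β : ℝ → ℝ) (w : V) : V →L[ℝ] V :=
  g ‖w‖ • ContinuousLinearMap.id ℝ V +
    (β ‖w‖ * g ‖w‖ / ‖w‖ ^ 2) • (innerSL ℝ w).smulRight w

theorem radialMapDeriv_apply (w h : V) : radialMapDeriv g β w h =
    g ‖w‖ • h + (β ‖w‖ * g ‖w‖) • (inner ℝ w h / ‖w‖ ^ 2) • w := by
  simp only [radialMapDeriv, add_apply, smul_apply, ContinuousLinearMap.smulRight_apply,
    ContinuousLinearMap.id_apply, smul_smul, innerSL_apply_apply]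
  congr 2; ring

theorem RadialWeight.continuousWithinAt (hg : RadialWeight g β M) :
    ContinuousWithinAt g (Set.Ici 0) 0 := by
  have h : ContinuousWithinAt g (Set.Ioi 0) 0 := hg.tendsto_zero
  exact continuousWithinAt_Ioi_iff_Ici.1 h

theorem RadialWeight.continuousOn_Ici (hg : RadialWeight g β M) :
    ContinuousOn g (Set.Ici 0) := by
  intro s hs
  rcases (Set.mem_Ici.1 hs).eq_or_lt with rfl | h
  · exact hg.continuousWithinAt
  · exact (hg.hasDerivAt s h).continuousAt.continuousWithinAt

theorem RadialWeight.continuous_comp_norm {V : Type*} [NormedAddCommGroup V] (hg : RadialWeight g β M) :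
    Continuous fun w : V => g ‖w‖ :=
  hg.continuousOn_Ici.comp_continuous continuous_norm fun w => norm_nonneg w

theorem RadialWeight.continuous_radialMap (hg : RadialWeight g β M) :
    Continuous (radialMap g : V → V) :=
  hg.continuous_comp_norm.smul continuous_id

/-- Away from 0 this is the product rule. At 0 continuity of `g` suffices, because (g(|h|) - g(0))h
= o(|h|), and the derivative is g(0) times the identity. -/
theorem RadialWeight.hasFDerivAt (hg : RadialWeight g β M) (w : V) :
    HasFDerivAt (radialMap g) (radialMapDeriv g β w) w := by
  by_cases hw : w = 0
  · subst hw
    have e : radialMapDeriv g β (0 : V) = g 0 • ContinuousLinearMap.id ℝ V := by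
      simp [radialMapDeriv]
    rw [e, hasFDerivAt_iff_isLittleO_nhds_zero]
    simp only [radialMap, zero_add, norm_zero, smul_zero, sub_zero, smul_apply,
      ContinuousLinearMap.id_apply, ← sub_smul]
    have h0 : Tendsto (fun h : V => g ‖h‖ - g 0) (𝓝 0) (𝓝 0) := by
      have := (hg.continuous_comp_norm (V := V)).tendsto 0
      simpa using this.sub_const (g 0)
    have h1 : (fun h : V => g ‖h‖ - g 0) =o[𝓝 0] (fun _ => (1 : ℝ)) :=
      (Asymptotics.isLittleO_one_iff ℝ).2 h0
    simpa using h1.smul_isBigO (Asymptotics.isBigO_refl (fun h : V => h) (𝓝 0))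
  · have hs : 0 < ‖w‖ := norm_pos_iff.2 hw
    have hn : HasFDerivAt (fun w : V => ‖w‖) (‖w‖⁻¹ • innerSL ℝ w) w := by
      have h1 : HasFDerivAt (fun w : V => ‖w‖ ^ 2) (2 • innerSL ℝ w) w :=
        (hasStrictFDerivAt_norm_sq w).hasFDerivAt
      have h2 := h1.sqrt (by positivity)
      have e : (fun w : V => √(‖w‖ ^ 2)) = fun w => ‖w‖ := by
        ext x; exact Real.sqrt_sq (norm_nonneg x)
      rw [e, Real.sqrt_sq hs.le] at h2
      refine h2.congr_fderiv ?_
      ext h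
      simp
      ring
    have h3 : HasFDerivAt (fun w : V => g ‖w‖) ((β ‖w‖ * g ‖w‖ / ‖w‖) • ‖w‖⁻¹ • innerSL ℝ w) w :=
      (hg.hasDerivAt _ hs).comp_hasFDerivAt w hn
    refine (h3.smul (hasFDerivAt_id w)).congr_fderiv ?_
    ext h
    simp only [radialMapDeriv, add_apply, smul_apply,
      ContinuousLinearMap.smulRight_apply, ContinuousLinearMap.id_apply, id, smul_smul,
      innerSL_apply_apply, smul_eq_mul]
    congr 2
    field_simp

theorem RadialWeight.norm_radialMapDeriv_le (hg : RadialWeight g β M) (w : V) :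
    ‖radialMapDeriv g β w‖ ≤ 2 * M := by
  have hM : 0 ≤ M := (abs_nonneg _).trans (hg.abs_le 0 le_rfl)
  refine ContinuousLinearMap.opNorm_le_bound _ (by positivity) fun h => ?_
  rw [radialMapDeriv_apply]
  refine (norm_add_le _ _).trans ?_
  have h1 : ‖g ‖w‖ • h‖ ≤ M * ‖h‖ := by
    rw [norm_smul]; gcongr; exact hg.abs_le _ (norm_nonneg _)
  have h2 : ‖(β ‖w‖ * g ‖w‖) • (inner ℝ w h / ‖w‖ ^ 2) • w‖ ≤ M * ‖h‖ := by
    by_cases hw : w = 0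
    · subst hw; simp; positivity
    have hs : 0 < ‖w‖ := norm_pos_iff.2 hw
    rw [norm_smul, norm_smul, norm_div]
    have h3 := hg.abs_mul_le _ hs
    have h4 : ‖(inner ℝ w h : ℝ)‖ / ‖‖w‖ ^ 2‖ * ‖w‖ ≤ ‖h‖ := by
      have : ‖(inner ℝ w h : ℝ)‖ ≤ ‖w‖ * ‖h‖ := norm_inner_le_norm _ _
      rw [norm_pow, norm_norm, div_mul_eq_mul_div, div_le_iff₀ (by positivity)]
      nlinarith
    exact mul_le_mul h3 h4 (by positivity) hM
  linarith

/-- Only the origin needs an argument: the rank-one term has norm at most |β(|w|) g(|w|)|, which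
tends to 0 by the field `tendsto_mul_zero` of the weight. -/
theorem RadialWeight.continuous_radialMapDeriv (hg : RadialWeight g β M) :
    Continuous (radialMapDeriv g β : V → V →L[ℝ] V) := by
  rw [continuous_iff_continuousAt]
  intro w
  by_cases hw : w = 0
  · subst hw
    have e : radialMapDeriv g β (0 : V) = g 0 • ContinuousLinearMap.id ℝ V := by
      simp [radialMapDeriv]
    have h0 : Tendsto (fun w : V => |g ‖w‖ - g 0|) (𝓝 0) (𝓝 0) := by
      have := (hg.continuous_comp_norm (V := V)).tendsto 0
      simpa using (this.sub_const (g 0)).abs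
    classical
    have h1 : Tendsto (fun w : V => |if w = 0 then 0 else β ‖w‖ * g ‖w‖|) (𝓝 0) (𝓝 0) := by
      rw [show (0 : ℝ) = |0| by simp]
      refine Tendsto.abs ?_
      rw [Metric.tendsto_nhds_nhds]
      intro ε hε
      obtain ⟨δ, hδ, h⟩ := (Metric.tendsto_nhdsWithin_nhds.1 hg.tendsto_mul_zero) ε hε
      refine ⟨δ, hδ, fun {w} hwδ => ?_⟩
      by_cases hw : w = 0
      · simp [hw, hε]
      · rw [if_neg hw]
        refine h (norm_pos_iff.2 hw) ?_
        simpa using hwδ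
    rw [ContinuousAt, e, tendsto_iff_norm_sub_tendsto_zero]
    refine squeeze_zero (fun _ => norm_nonneg _) (fun w => ?_) (by simpa using h0.add h1)
    refine ContinuousLinearMap.opNorm_le_bound _ (by positivity) fun h => ?_
    have e2 : (radialMapDeriv g β w - g 0 • ContinuousLinearMap.id ℝ V) h =
        (g ‖w‖ - g 0) • h + (β ‖w‖ * g ‖w‖) • (inner ℝ w h / ‖w‖ ^ 2) • w := by
      simp only [sub_apply, radialMapDeriv_apply, sub_smul,
        smul_apply, ContinuousLinearMap.id_apply]
      abel
    rw [e2, add_mul]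
    refine (norm_add_le _ _).trans (add_le_add ?_ ?_)
    · rw [norm_smul, Real.norm_eq_abs]
    · by_cases hw : w = 0
      · simp [hw]
      have hs : 0 < ‖w‖ := norm_pos_iff.2 hw
      rw [norm_smul, norm_smul, norm_div, if_neg hw, Real.norm_eq_abs]
      gcongr
      have : ‖(inner ℝ w h : ℝ)‖ ≤ ‖w‖ * ‖h‖ := norm_inner_le_norm _ _
      rw [norm_pow, norm_norm, div_mul_eq_mul_div, div_le_iff₀ (by positivity)]
      nlinarith
  · have hs : 0 < ‖w‖ := norm_pos_iff.2 hw
    have hβ : ContinuousAt (fun w : V => β ‖w‖) w :=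
      ContinuousAt.comp (f := fun w : V => ‖w‖)
        (hg.continuousOn.continuousAt (Ioi_mem_nhds hs)) continuous_norm.continuousAt
    have hg' : ContinuousAt (fun w : V => g ‖w‖) w := hg.continuous_comp_norm.continuousAt
    have h2 : ContinuousAt (fun w : V => ‖w‖ ^ 2) w := (continuous_norm.pow 2).continuousAt
    have h3 : Continuous fun w : V => (innerSL ℝ w).smulRight w := by
      have : Continuous fun w : V => ContinuousLinearMap.smulRightL ℝ V V (innerSL ℝ w) w :=
        ((ContinuousLinearMap.smulRightL ℝ V V).continuous.comp (innerSL ℝ).continuous).clm_apply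
          continuous_id
      exact this
    exact (hg'.smul continuousAt_const).add
      (((hβ.mul hg').div h2 (by positivity)).smul h3.continuousAt)

theorem RadialWeight.norm_radialMap_sub_le (hg : RadialWeight g β M) (w w' : V) :
    ‖radialMap g w - radialMap g w'‖ ≤ 2 * M * ‖w - w'‖ :=
  convex_univ.norm_image_sub_le_of_norm_hasFDerivWithin_le
    (fun x _ => (hg.hasFDerivAt x).hasFDerivWithinAt) (fun x _ => hg.norm_radialMapDeriv_le x)
    (Set.mem_univ _) (Set.mem_univ _)

end RadialMap

/-! ### The tensor form of the chain rule -/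

/-- The row `(ξ_h^α)_α` of a tensor. -/
def row (ξ : Tens n m) (h : Fin n) : Vec m := WithLp.toLp 2 fun α => ξ (h, α)

/-- The gradient of `g(|u|) u` at a point where `u` has value `w` and gradient `ξ`. -/
def chainTens (g β : ℝ → ℝ) (w : Vec m) (ξ : Tens n m) : Tens n m :=
  g ‖w‖ • (ξ + β ‖w‖ • radial w ξ)

theorem real_inner_eq (w h : Vec m) : inner ℝ w h = (∑ β, w β * star (h β)).re := by
  rw [PiLp.inner_apply, Complex.re_sum]
  refine Finset.sum_congr rfl fun β _ => ?_
  rw [Complex.inner]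
  simp [mul_comm]

/-- Row by row, the tensor is the Fréchet derivative of the radial map applied to the row.
Continuity of `chainTens` and the agreement with classical gradients are both read off from this. -/
theorem chainTens_apply (g β : ℝ → ℝ) (w : Vec m) (ξ : Tens n m) (i : Fin n × Fin m) :
    chainTens g β w ξ i = radialMapDeriv g β w (row ξ i.1) i.2 := by
  rw [radialMapDeriv_apply, real_inner_eq]
  simp only [chainTens, PiLp.smul_apply, PiLp.add_apply, radial_apply, row, smul_add, smul_smul]
  congr 1
  simp only [Complex.real_smul]
  push_cast
  ring

end

/-! ### Sobolev functions with compact support -/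

/-- `Dv` is the weak gradient of `v` on the whole space. -/
def WeakGrad (v : Pt n → Vec m) (Dv : Pt n → Tens n m) : Prop :=
  ∀ ψ : Pt n → ℝ, ContDiff ℝ ∞ ψ → HasCompactSupport ψ → ∀ (h : Fin n) (α : Fin m),
    ∫ x, ((fderiv ℝ ψ x (EuclideanSpace.single h 1) : ℝ) : ℂ) * v x α
      = - ∫ x, ((ψ x : ℝ) : ℂ) * Dv x (h, α)

/-- `v` is a `W^{1,2}` function with gradient `Dv` and compact support in `Ω`; the approximating
test functions are supported in a common compact set. -/
structure H1c (Ω : Set (Pt n)) (v : Pt n → Vec m) (Dv : Pt n → Tens n m) : Prop where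
  memLp : MemLp v 2 volume
  memLp_grad : MemLp Dv 2 volume
  approx : ∃ S : Set (Pt n), IsCompact S ∧ S ⊆ Ω ∧ (∀ x, x ∉ S → v x = 0) ∧
    (∀ x, x ∉ S → Dv x = 0) ∧ ∃ φ : ℕ → Pt n → Vec m, (∀ j, IsTest Ω (φ j)) ∧
    (∀ j, tsupport (φ j) ⊆ S) ∧
    Tendsto (fun j => eLpNorm (φ j - v) 2 volume) atTop (𝓝 0) ∧
    Tendsto (fun j => eLpNorm (grad (φ j) - Dv) 2 volume) atTop (𝓝 0)

theorem H1c.isW12Zero {Ω : Set (Pt n)} {v : Pt n → Vec m} {Dv : Pt n → Tens n m}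
    (h : H1c Ω v Dv) : IsW12Zero Ω v Dv := by
  obtain ⟨S, -, -, -, -, φ, h1, -, h2, h3⟩ := h.approx
  refine ⟨h.memLp.restrict Ω, h.memLp_grad.restrict Ω, φ, h1, ?_, ?_⟩
  · exact tendsto_of_tendsto_of_tendsto_of_le_of_le tendsto_const_nhds h2 (fun _ => zero_le)
      fun j => eLpNorm_mono_measure _ Measure.restrict_le_self
  · exact tendsto_of_tendsto_of_tendsto_of_le_of_le tendsto_const_nhds h3 (fun _ => zero_le)
      fun j => eLpNorm_mono_measure _ Measure.restrict_le_self

theorem integral_component {ι X : Type*} [Fintype ι] [MeasurableSpace X] {μ : Measure X}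
    {f : X → EuclideanSpace ℂ ι} (hf : Integrable f μ) (i : ι) :
    (∫ x, f x ∂μ) i = ∫ x, f x i ∂μ :=
  ((EuclideanSpace.proj (𝕜 := ℂ) i).integral_comp_comm hf).symm

theorem exists_cutoff {S U : Set (Pt n)} (hS : IsCompact S) (hU : IsOpen U) (hSU : S ⊆ U) :
    ∃ χ : Pt n → ℝ, IsTest U χ ∧ (∀ x ∈ S, χ x = 1) ∧ ∀ x, χ x ∈ Set.Icc (0 : ℝ) 1 := by
  obtain ⟨T, hT, hST, hTU⟩ := exists_compact_between hS hU hSU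
  obtain ⟨f, h1, h0, hf⟩ := exists_contMDiffMap_one_nhds_of_subset_interior (n := ⊤)
    (modelWithCornersSelf ℝ (Pt n)) hS.isClosed hST
  have hts : tsupport f ⊆ T := closure_minimal
    (fun x hx => by by_contra hxT; exact hx (h0 x hxT)) hT.isClosed
  exact ⟨f, ⟨f.contMDiff.contDiff, HasCompactSupport.of_support_subset_isCompact hT
    ((subset_tsupport _).trans hts), hts.trans hTU⟩,
    fun x hx => h1.self_of_nhdsSet x hx, hf⟩

-- The derivative falls on the kernel, and the reflected kernel t ↦ ρ(x - t) is an admissible test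
-- function in `WeakGrad`. The sign from the reflection cancels the one from integration by parts.
open scoped Convolution in
theorem grad_convolution {v : Pt n → Vec m} {Dv : Pt n → Tens n m} (hv : LocallyIntegrable v)
    (hDv : LocallyIntegrable Dv) (hw : WeakGrad v Dv) {ρ : Pt n → ℝ} (hρ : ContDiff ℝ ∞ ρ)
    (hρc : HasCompactSupport ρ) :
    grad (ρ ⋆[ContinuousLinearMap.lsmul ℝ ℝ, volume] v)
      = ρ ⋆[ContinuousLinearMap.lsmul ℝ ℝ, volume] Dv := by
  ext x i
  have hρ1 : ContDiff ℝ 1 ρ := hρ.of_le (by norm_cast)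
  have hd := (hρc.hasFDerivAt_convolution_left (μ := volume)
    (ContinuousLinearMap.lsmul ℝ ℝ : ℝ →L[ℝ] Vec m →L[ℝ] Vec m) hρ1 hv x).fderiv
  have hex : ConvolutionExistsAt (fderiv ℝ ρ) v x
      ((ContinuousLinearMap.lsmul ℝ ℝ : ℝ →L[ℝ] Vec m →L[ℝ] Vec m).precompL (Pt n)) volume :=
    (hρc.fderiv ℝ).convolutionExists_left _ (hρ1.continuous_fderiv one_ne_zero) hv x
  have hexD : ConvolutionExistsAt ρ Dv x
      (ContinuousLinearMap.lsmul ℝ ℝ : ℝ →L[ℝ] Tens n m →L[ℝ] Tens n m) volume :=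
    hρc.convolutionExists_left _ hρ.continuous hDv x
  set e : Pt n := EuclideanSpace.single i.1 1
  have e1 : grad (ρ ⋆[ContinuousLinearMap.lsmul ℝ ℝ, volume] v) x i =
      ∫ t, ((fderiv ℝ ρ (x - t) e : ℝ) : ℂ) * v t i.2 := by
    rw [grad_apply, hd, convolution_def, ← integral_sub_left_eq_self _ volume x]
    have hint := (integrable_comp_sub_left (fun t => (((ContinuousLinearMap.lsmul ℝ ℝ :
      ℝ →L[ℝ] Vec m →L[ℝ] Vec m).precompL (Pt n)) (fderiv ℝ ρ t)) (v (x - t))) x).2 hex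
    rw [ContinuousLinearMap.integral_apply hint]
    have hint2 := hint.apply_continuousLinearMap e
    rw [integral_component hint2]
    congr 1 with t
    simp [e]
  have e2 : (ρ ⋆[ContinuousLinearMap.lsmul ℝ ℝ, volume] Dv) x i =
      ∫ t, ((ρ (x - t) : ℝ) : ℂ) * Dv t i := by
    rw [convolution_def, ← integral_sub_left_eq_self _ volume x]
    have hint := (integrable_comp_sub_left (fun t => ((ContinuousLinearMap.lsmul ℝ ℝ :
      ℝ →L[ℝ] Tens n m →L[ℝ] Tens n m) (ρ t)) (Dv (x - t))) x).2 hexD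
    rw [integral_component hint]
    congr 1 with t
    simp
  rw [e1, e2]
  have h := hw (fun t => ρ (x - t)) (hρ.comp (contDiff_const.sub contDiff_id))
    (hρc.comp_homeomorph (Homeomorph.subLeft x)) i.1 i.2
  have hder : ∀ t, fderiv ℝ (fun t => ρ (x - t)) t e = - fderiv ℝ ρ (x - t) e := by
    intro t
    have h1 : HasFDerivAt (fun t : Pt n => x - t) (-ContinuousLinearMap.id ℝ (Pt n)) t :=
      (hasFDerivAt_id t).const_sub x
    have h2 := ((hρ1.differentiable one_ne_zero (x - t)).hasFDerivAt).comp t h1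
    rw [show (fun t => ρ (x - t)) = ρ ∘ (fun t => x - t) from rfl, h2.fderiv]
    simp
  simp only [e] at hder
  simp only [hder, Complex.ofReal_neg, neg_mul, integral_neg, neg_inj] at h
  exact h

/-- Mollification with radii δ/(j + 1) commutes with the weak gradient, and all supports stay in one
closed thickening of `S` inside Ω. The common compact support matters because `B` is bounded only
locally. -/
theorem h1c_of_weakGrad {Ω S : Set (Pt n)} (hΩ : IsOpen Ω) (hS : IsCompact S) (hSΩ : S ⊆ Ω)
    {v : Pt n → Vec m} {Dv : Pt n → Tens n m} (hv : MemLp v 2 volume) (hDv : MemLp Dv 2 volume)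
    (hv0 : ∀ x, x ∉ S → v x = 0) (hDv0 : ∀ x, x ∉ S → Dv x = 0) (hw : WeakGrad v Dv) :
    H1c Ω v Dv := by
  obtain ⟨δ, hδ, hδΩ⟩ := hS.exists_cthickening_subset_open hΩ hSΩ
  have hST : S ⊆ Metric.cthickening δ S := Metric.self_subset_cthickening _
  have hT : IsCompact (Metric.cthickening δ S) := hS.cthickening
  let ρ : ℕ → ContDiffBump (0 : Pt n) := fun j =>
    { rIn := δ / (j + 1) / 2
      rOut := δ / (j + 1)
      rIn_pos := by positivity
      rIn_lt_rOut := half_lt_self (by positivity) }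
  have hρ : Tendsto (fun j => (ρ j).rOut) atTop (𝓝 0) := by
    have := (tendsto_one_div_add_atTop_nhds_zero_nat (𝕜 := ℝ)).const_mul δ
    simpa [ρ, div_eq_mul_inv] using this
  have hρδ : ∀ j, (ρ j).rOut ≤ δ := fun j => div_le_self hδ.le (by simp)
  have hvl : LocallyIntegrable v := hv.locallyIntegrable (by norm_num)
  have hDvl : LocallyIntegrable Dv := hDv.locallyIntegrable (by norm_num)
  let φ : ℕ → Pt n → Vec m := fun j =>
    convolution ((ρ j).normed volume) v (ContinuousLinearMap.lsmul ℝ ℝ) volume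
  have hts : ∀ j, tsupport (φ j) ⊆ Metric.cthickening δ S := by
    intro j
    refine closure_minimal ?_ Metric.isClosed_cthickening
    refine (support_convolution_subset _).trans ?_
    rintro _ ⟨a, ha, b, hb, rfl⟩
    rw [(ρ j).support_normed_eq, Metric.mem_ball, dist_zero_right] at ha
    have hbS : b ∈ S := by by_contra h; exact hb (hv0 b h)
    refine Metric.mem_cthickening_of_dist_le _ b _ _ hbS ?_
    simpa using (ha.le.trans (hρδ j))
  refine ⟨hv, hDv, Metric.cthickening δ S, hT, hδΩ, fun x hx => hv0 x fun h => hx (hST h),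
    fun x hx => hDv0 x fun h => hx (hST h), φ, fun j => ⟨?_, ?_, (hts j).trans hδΩ⟩, hts, ?_, ?_⟩
  · exact (ρ j).hasCompactSupport_normed.contDiff_convolution_left _ (ρ j).contDiff_normed hvl
  · exact HasCompactSupport.of_support_subset_isCompact hT ((subset_tsupport _).trans (hts j))
  · exact tendsto_eLpNorm_convolution_sub volume hρ hv
  · have : ∀ j, grad (φ j) =
        convolution ((ρ j).normed volume) Dv (ContinuousLinearMap.lsmul ℝ ℝ) volume := fun j =>
      grad_convolution hvl hDvl hw (ρ j).contDiff_normed (ρ j).hasCompactSupport_normed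
    simp only [this]
    exact tendsto_eLpNorm_convolution_sub volume hρ hDv

/-! ### Passing to the limit in `L²` pairings -/

theorem integrable_pairing {X E F G : Type*} [MeasurableSpace X] {μ : Measure X}
    [NormedAddCommGroup E] [NormedAddCommGroup F] [NormedAddCommGroup G]
    {b : E → F → G} (hb : ∀ x y, ‖b x y‖ ≤ ‖x‖ * ‖y‖) (hbc : Continuous (Function.uncurry b))
    {f : X → E} {k : X → F} (hf : MemLp f 2 μ) (hk : MemLp k 2 μ) :
    Integrable (fun x => b (f x) (k x)) μ := by
  have h := hf.norm.integrable_mul hk.norm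
  refine h.mono' (hbc.comp_aestronglyMeasurable
    (hf.aestronglyMeasurable.prodMk hk.aestronglyMeasurable)) (Eventually.of_forall fun x => ?_)
  exact hb _ _

theorem lintegral_pairing_le {X E F : Type*} [MeasurableSpace X] {μ : Measure X}
    [NormedAddCommGroup E] [NormedAddCommGroup F]
    {f : X → E} {k : X → F} (hf : AEStronglyMeasurable f μ) (hk : AEStronglyMeasurable k μ) :
    ∫⁻ x, ‖f x‖ₑ * ‖k x‖ₑ ∂μ ≤ eLpNorm f 2 μ * eLpNorm k 2 μ := by
  have h := ENNReal.lintegral_mul_le_Lp_mul_Lq μ Real.HolderConjugate.two_two hf.enorm hk.enorm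
  rw [eLpNorm_eq_lintegral_rpow_enorm_toReal (by norm_num) (by norm_num),
    eLpNorm_eq_lintegral_rpow_enorm_toReal (by norm_num) (by norm_num)]
  simpa using h

/-- Only the first factor varies, so Hölder's inequality bounds the L¹ distance of the integrands by
‖f_j - g‖₂ ‖k‖₂. Compatibility with differences in the first variable is the only algebra required.
-/
theorem tendsto_integral_pairing {X E F G : Type*} [MeasurableSpace X] {μ : Measure X}
    [NormedAddCommGroup E] [NormedAddCommGroup F] [NormedAddCommGroup G] [NormedSpace ℝ G]
    {b : E → F → G} (hbs : ∀ x x' y, b x y - b x' y = b (x - x') y)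
    (hb : ∀ x y, ‖b x y‖ ≤ ‖x‖ * ‖y‖) (hbc : Continuous (Function.uncurry b))
    {f : ℕ → X → E} {g : X → E} {k : X → F} (hf : ∀ j, MemLp (f j) 2 μ) (hg : MemLp g 2 μ)
    (hfg : Tendsto (fun j => eLpNorm (f j - g) 2 μ) atTop (𝓝 0)) (hk : MemLp k 2 μ) :
    Tendsto (fun j => ∫ x, b (f j x) (k x) ∂μ) atTop (𝓝 (∫ x, b (g x) (k x) ∂μ)) := by
  refine tendsto_integral_of_L1 _ (integrable_pairing hb hbc hg hk).aestronglyMeasurable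
    (Eventually.of_forall fun j => integrable_pairing hb hbc (hf j) hk) ?_
  have h0 : Tendsto (fun j => eLpNorm (f j - g) 2 μ * eLpNorm k 2 μ) atTop (𝓝 0) := by
    simpa using ENNReal.Tendsto.mul_const hfg (Or.inr hk.eLpNorm_ne_top)
  refine tendsto_of_tendsto_of_tendsto_of_le_of_le tendsto_const_nhds h0 (fun _ => zero_le)
    fun j => ?_
  refine le_trans (lintegral_mono fun x => ?_) (lintegral_pairing_le
    ((hf j).sub hg).aestronglyMeasurable hk.aestronglyMeasurable)
  rw [hbs, Pi.sub_apply]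
  simp only [← ofReal_norm, ← ENNReal.ofReal_mul (norm_nonneg _)]
  exact ENNReal.ofReal_le_ofReal (hb _ _)

/-! ### Cutoffs -/

theorem memLp_of_restrict {E : Type*} [NormedAddCommGroup E] {S : Set (Pt n)} (hS : IsCompact S)
    {f : Pt n → E} (hf : MemLp f 2 (volume.restrict S)) (h0 : ∀ x, x ∉ S → f x = 0) :
    MemLp f 2 volume := by
  have : f = S.indicator f := by
    ext x
    by_cases hx : x ∈ S
    · simp [hx]
    · simp [hx, h0 x hx]
  rw [this]
  exact (memLp_indicator_iff_restrict hS.measurableSet).2 hf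

theorem continuous_gradR {η : Pt n → ℝ} (hη : ContDiff ℝ ∞ η) : Continuous (gradR η) :=
  continuous_pi fun h =>
    (hη.continuous_fderiv (by simp)).clm_apply continuous_const

theorem gradR_eq_zero {η : Pt n → ℝ} {x : Pt n} (hx : x ∉ tsupport η) : gradR η x = 0 := by
  ext h
  have : fderiv ℝ η x = 0 := by
    by_contra hne
    exact hx (support_fderiv_subset ℝ hne)
  simp [gradR, this]

theorem norm_tens_le (w : Vec m) (a : Fin n → ℝ) : ‖tens w a‖ ≤ (∑ h, |a h|) * ‖w‖ := by
  refine le_of_sq_le_sq ?_ (by positivity)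
  rw [norm_tens_sq, mul_pow]
  gcongr
  have := Finset.sum_sq_le_sq_sum_of_nonneg (s := Finset.univ) (f := fun h => |a h|)
    fun i _ => abs_nonneg _
  simpa using this

theorem exists_gradR_bound {η : Pt n → ℝ} (hη : ContDiff ℝ ∞ η) (hc : HasCompactSupport η) :
    ∃ C, 0 ≤ C ∧ (∀ x, |η x| ≤ C) ∧ ∀ x, ∑ h, |gradR η x h| ≤ C := by
  obtain ⟨C₁, h₁⟩ := hc.exists_bound_of_continuous hη.continuous
  have hc2 : HasCompactSupport fun x => ∑ h, |gradR η x h| :=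
    HasCompactSupport.intro hc.isCompact fun x hx => by
      rw [gradR_eq_zero hx]; simp
  have hcont : Continuous fun x => ∑ h, |gradR η x h| :=
    continuous_finsetSum _ fun h _ => ((continuous_apply h).comp (continuous_gradR hη)).abs
  obtain ⟨C₂, h₂⟩ := hc2.exists_bound_of_continuous hcont
  refine ⟨max C₁ C₂, ?_, fun x => (h₁ x).trans (le_max_left _ _), fun x => ?_⟩
  · exact ((norm_nonneg _).trans (h₁ 0)).trans (le_max_left _ _)
  · exact (le_abs_self _).trans ((h₂ x).trans (le_max_right _ _))

/-- Multiplication of a `W^{1,2}_loc` function by a smooth cutoff. -/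
theorem IsW12Loc.h1c_smul {Ω : Set (Pt n)} (hΩ : IsOpen Ω) {u : Pt n → Vec m}
    {Du : Pt n → Tens n m} (hu : IsW12Loc Ω u Du) {χ : Pt n → ℝ} (hχ : IsTest Ω χ) :
    H1c Ω (fun x => χ x • u x) (fun x => χ x • Du x + tens (u x) (gradR χ x)) := by
  obtain ⟨hχs, hχc, hχΩ⟩ := hχ
  set S := tsupport χ with hS
  have hSc : IsCompact S := hχc
  have hu2 := hu.memLp S hSc hχΩ
  have hDu2 := hu.memLp_grad S hSc hχΩ
  obtain ⟨C, hC, hC1, hC2⟩ := exists_gradR_bound hχs hχc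
  have hmχ : AEStronglyMeasurable χ (volume.restrict S) := hχs.continuous.aestronglyMeasurable
  have hmg : ∀ h, AEStronglyMeasurable (fun x => gradR χ x h) (volume.restrict S) := fun h =>
    ((continuous_apply h).comp (continuous_gradR hχs)).aestronglyMeasurable
  have m1 : MemLp (fun x => χ x • u x) 2 (volume.restrict S) :=
    hu2.of_le_mul (c := C) (hmχ.smul hu2.aestronglyMeasurable) (Eventually.of_forall fun x => by
      rw [norm_smul]; gcongr; exact hC1 x)
  have m2 : MemLp (fun x => χ x • Du x) 2 (volume.restrict S) :=
    hDu2.of_le_mul (c := C) (hmχ.smul hDu2.aestronglyMeasurable) (Eventually.of_forall fun x => by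
      rw [norm_smul]; gcongr; exact hC1 x)
  have m3 : MemLp (fun x => tens (u x) (gradR χ x)) 2 (volume.restrict S) :=
    hu2.of_le_mul (c := C) (aestronglyMeasurable_tens hu2.aestronglyMeasurable hmg)
      (Eventually.of_forall fun x => (norm_tens_le _ _).trans (by gcongr; exact hC2 x))
  have z1 : ∀ x, x ∉ S → χ x = 0 := fun x hx => image_eq_zero_of_notMem_tsupport hx
  have z2 : ∀ x, x ∉ S → gradR χ x = 0 := fun x hx => gradR_eq_zero hx
  refine h1c_of_weakGrad hΩ hSc hχΩ
    (memLp_of_restrict hSc m1 fun x hx => by simp [z1 x hx])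
    (memLp_of_restrict hSc (m2.add m3) fun x hx => by simp [z1 x hx, z2 x hx])
    (fun x hx => by simp [z1 x hx]) (fun x hx => by simp [z1 x hx, z2 x hx]) ?_
  intro ψ hψ hψc h α
  -- The test function ψ lives on the whole space; the product with χ brings its support into Ω,
  -- where the weak derivative of u is defined.
  have hprod : IsTest Ω fun x => ψ x * χ x :=
    ⟨hψ.mul hχs, hχc.mul_left, (tsupport_mul_subset_right).trans hχΩ⟩
  have hw := hu.weak_deriv _ hprod h α
  have hder : ∀ x, fderiv ℝ (fun x => ψ x * χ x) x (EuclideanSpace.single h 1) =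
      ψ x * gradR χ x h + χ x * fderiv ℝ ψ x (EuclideanSpace.single h 1) := by
    intro x
    rw [fderiv_fun_mul (hψ.differentiable (by simp) x) (hχs.differentiable (by simp) x)]
    simp [gradR]
  -- integrability on the support
  have int : ∀ {f : Pt n → ℂ}, MemLp f 2 (volume.restrict S) → ∀ {k : Pt n → ℝ}, Continuous k →
      (∀ x, x ∉ S → k x = 0) → Integrable (fun x => (k x : ℂ) * f x) (volume.restrict Ω) := by
    intro f hf k hk hk0
    have hf1 : Integrable f (volume.restrict S) := by
      have : IsFiniteMeasure (volume.restrict S) := ⟨by simpa using hSc.measure_lt_top⟩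
      exact hf.integrable (by norm_num)
    have hkc : HasCompactSupport k := HasCompactSupport.intro hSc hk0
    obtain ⟨D, hD⟩ := hkc.exists_bound_of_continuous hk
    have h1 : Integrable (fun x => (k x : ℂ) * f x) (volume.restrict S) :=
      hf1.bdd_mul (c := D) (Complex.continuous_ofReal.comp hk).aestronglyMeasurable
        (Eventually.of_forall fun x => by simpa using hD x)
    have h2 : IntegrableOn (fun x => (k x : ℂ) * f x) S volume := h1
    have h3 : Integrable (fun x => (k x : ℂ) * f x) volume :=
      (integrableOn_iff_integrable_of_support_subset fun x hx => by
        by_contra hxS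
        exact hx (by simp [hk0 x hxS])).1 h2
    exact h3.restrict
  have full : ∀ {f : Pt n → ℂ}, (∀ x, x ∉ S → f x = 0) → ∫ x, f x = ∫ x in Ω, f x := by
    intro f hf
    exact (setIntegral_eq_integral_of_forall_compl_eq_zero fun x hx =>
      hf x fun h => hx (hχΩ h)).symm
  have cψ : Continuous ψ := hψ.continuous
  have cψ' : Continuous fun x => fderiv ℝ ψ x (EuclideanSpace.single h 1) :=
    (hψ.continuous_fderiv (by simp)).clm_apply continuous_const
  have cχ : Continuous χ := hχs.continuous
  have cχ' : Continuous fun x => gradR χ x h :=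
    (continuous_apply h).comp (continuous_gradR hχs)
  have hu2α : MemLp (fun x => u x α) 2 (volume.restrict S) :=
    hu2.of_le (aestronglyMeasurable_component hu2.aestronglyMeasurable _)
      (Eventually.of_forall fun x => norm_component_le _ _)
  have hDu2α : MemLp (fun x => Du x (h, α)) 2 (volume.restrict S) :=
    hDu2.of_le (aestronglyMeasurable_component hDu2.aestronglyMeasurable _)
      (Eventually.of_forall fun x => norm_component_le _ _)
  have i1 := int hu2α (k := fun x => ψ x * gradR χ x h) (cψ.mul cχ')
    fun x hx => by simp [z2 x hx]
  have i2 := int hu2α (k := fun x => χ x * fderiv ℝ ψ x (EuclideanSpace.single h 1)) (cχ.mul cψ')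
    fun x hx => by simp [z1 x hx]
  have i3 := int hDu2α (k := fun x => ψ x * χ x) (cψ.mul cχ) fun x hx => by simp [z1 x hx]
  rw [full (fun x hx => by simp [z1 x hx]), full (fun x hx => by simp [z1 x hx, z2 x hx])]
  have hL : ∀ x, ((fderiv ℝ (fun x => ψ x * χ x) x (EuclideanSpace.single h 1) : ℝ) : ℂ) * u x α
      = ((ψ x * gradR χ x h : ℝ) : ℂ) * u x α +
        ((χ x * fderiv ℝ ψ x (EuclideanSpace.single h 1) : ℝ) : ℂ) * u x α := by
    intro x; rw [hder]; push_cast; ring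
  simp only [hL] at hw
  rw [integral_add i1 i2] at hw
  have e1 : ∫ x in Ω, ((fderiv ℝ ψ x (EuclideanSpace.single h 1) : ℝ) : ℂ) * (χ x • u x) α
      = ∫ x in Ω, ((χ x * fderiv ℝ ψ x (EuclideanSpace.single h 1) : ℝ) : ℂ) * u x α := by
    congr 1 with x; simp; ring
  have e2 : ∫ x in Ω, ((ψ x : ℝ) : ℂ) * (χ x • Du x + tens (u x) (gradR χ x)) (h, α)
      = (∫ x in Ω, ((ψ x * χ x : ℝ) : ℂ) * Du x (h, α)) +
        ∫ x in Ω, ((ψ x * gradR χ x h : ℝ) : ℂ) * u x α := by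
    rw [← integral_add i3 i1]
    congr 1 with x; simp; ring
  rw [e1, e2, neg_add, ← hw]
  ring

section

/-! ### The chain rule for weak gradients -/

variable {g β : ℝ → ℝ} {M : ℝ}

theorem RadialWeight.norm_chainTens_le (hg : RadialWeight g β M) (w : Vec m) (ξ : Tens n m) :
    ‖chainTens g β w ξ‖ ≤ 2 * M * ‖ξ‖ := by
  have hM : 0 ≤ M := (abs_nonneg _).trans (hg.abs_le 0 le_rfl)
  rw [chainTens, smul_add, smul_smul]
  refine (norm_add_le _ _).trans ?_
  have h1 : ‖g ‖w‖ • ξ‖ ≤ M * ‖ξ‖ := by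
    rw [norm_smul]; gcongr; exact hg.abs_le _ (norm_nonneg _)
  have h2 : ‖(g ‖w‖ * β ‖w‖) • radial w ξ‖ ≤ M * ‖ξ‖ := by
    by_cases hw : w = 0
    · subst hw; simp; positivity
    rw [norm_smul, mul_comm (g _)]
    exact mul_le_mul (hg.abs_mul_le _ (norm_pos_iff.2 hw)) (norm_radial_le _ _) (norm_nonneg _) hM
  linarith

theorem RadialWeight.norm_radialMap_le (hg : RadialWeight g β M) (w : Vec m) :
    ‖radialMap g w‖ ≤ M * ‖w‖ := by
  rw [radialMap, norm_smul]; gcongr; exact hg.abs_le _ (norm_nonneg _)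

theorem RadialWeight.continuous_chainTens (hg : RadialWeight g β M) :
    Continuous fun q : Vec m × Tens n m => chainTens g β q.1 q.2 := by
  have : ∀ i, Continuous fun q : Vec m × Tens n m => chainTens g β q.1 q.2 i := by
    intro i
    simp only [chainTens_apply]
    have h1 : Continuous fun q : Vec m × Tens n m => radialMapDeriv g β q.1 :=
      hg.continuous_radialMapDeriv.comp continuous_fst
    have h2 : Continuous fun q : Vec m × Tens n m => row q.2 i.1 := by
      refine (PiLp.continuous_toLp 2 _).comp (continuous_pi fun α => ?_)
      exact (EuclideanSpace.proj (𝕜 := ℂ) (i.1, α)).continuous.comp continuous_snd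
    exact (EuclideanSpace.proj (𝕜 := ℂ) i.2).continuous.comp (h1.clm_apply h2)
  exact (PiLp.continuous_toLp 2 _).comp (continuous_pi this)

theorem RadialWeight.aestronglyMeasurable_chainTens {X : Type*} [MeasurableSpace X]
    {μ : Measure X} (hg : RadialWeight g β M) {w : X → Vec m} {ξ : X → Tens n m}
    (hw : AEStronglyMeasurable w μ) (hξ : AEStronglyMeasurable ξ μ) :
    AEStronglyMeasurable (fun x => chainTens g β (w x) (ξ x)) μ :=
  Continuous.comp_aestronglyMeasurable (f := fun x => (w x, ξ x)) hg.continuous_chainTens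
    (hw.prodMk hξ)

theorem RadialWeight.tendsto_chainTens (hg : RadialWeight g β M) {w : ℕ → Vec m} {w₀ : Vec m}
    (hw : Tendsto w atTop (𝓝 w₀)) (ξ : Tens n m) :
    Tendsto (fun j => chainTens g β (w j) ξ) atTop (𝓝 (chainTens g β w₀ ξ)) := by
  have h : Continuous fun w : Vec m => chainTens g β w ξ :=
    Continuous.comp (g := fun q : Vec m × Tens n m => chainTens g β q.1 q.2)
      (f := fun w => (w, ξ)) hg.continuous_chainTens (by fun_prop)
  exact (h.tendsto w₀).comp hw

theorem chainTens_sub (w : Vec m) (ξ ζ : Tens n m) :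
    chainTens g β w (ξ - ζ) = chainTens g β w ξ - chainTens g β w ζ := by
  have : radial w (ξ - ζ) = radial w ξ - radial w ζ := (radialL w).map_sub ξ ζ
  rw [chainTens, chainTens, chainTens, this, ← smul_sub, smul_sub (β _)]
  congr 1; abel

/-- The classical chain rule for `η g(|φ|) φ`. -/
theorem RadialWeight.hasFDerivAt_comp (hg : RadialWeight g β M) {η : Pt n → ℝ}
    (hη : ContDiff ℝ ∞ η) {φ : Pt n → Vec m} (hφ : ContDiff ℝ ∞ φ) (x : Pt n) :
    HasFDerivAt (fun x => η x • radialMap g (φ x))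
      (η x • (radialMapDeriv g β (φ x)).comp (fderiv ℝ φ x) +
        (fderiv ℝ η x).smulRight (radialMap g (φ x))) x :=
  ((hη.differentiable (by simp) x).hasFDerivAt).smul
    ((hg.hasFDerivAt (φ x)).comp x (hφ.differentiable (by simp) x).hasFDerivAt)

/-- For smooth φ the function η g(|φ|)φ is continuously differentiable, so classical integration by
parts applies. Compactness of supports is supplied by the test function alone. -/
theorem RadialWeight.integral_by_parts (hg : RadialWeight g β M) {η : Pt n → ℝ}
    (hη : ContDiff ℝ ∞ η) {φ : Pt n → Vec m} (hφ : ContDiff ℝ ∞ φ) :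
    WeakGrad (fun x => η x • radialMap g (φ x))
      (fun x => η x • chainTens g β (φ x) (grad φ x) + tens (radialMap g (φ x)) (gradR η x)) := by
  intro ψ hψ hψc h α
  set e : Pt n := EuclideanSpace.single h 1
  set F : Pt n → Vec m := fun x => η x • radialMap g (φ x)
  set F' : Pt n → Pt n →L[ℝ] Vec m := fun x =>
    η x • (radialMapDeriv g β (φ x)).comp (fderiv ℝ φ x) +
        (fderiv ℝ η x).smulRight (radialMap g (φ x))
  have cη := hη.continuous
  have cφ := hφ.continuous
  have cψ := hψ.continuous
  have cG : Continuous fun x => radialMap g (φ x) := hg.continuous_radialMap.comp cφ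
  have cF : Continuous F := cη.smul cG
  have cF' : Continuous fun x => F' x e := by
    have h1 : Continuous fun x => radialMapDeriv g β (φ x) := hg.continuous_radialMapDeriv.comp cφ
    have h2 : Continuous fun x => fderiv ℝ φ x e :=
      (hφ.continuous_fderiv (by simp)).clm_apply continuous_const
    have h3 : Continuous fun x => fderiv ℝ η x e :=
      (hη.continuous_fderiv (by simp)).clm_apply continuous_const
    exact (cη.smul (h1.clm_apply h2)).add (h3.smul cG)
  have cψ' : Continuous fun x => fderiv ℝ ψ x e :=
    (hψ.continuous_fderiv (by simp)).clm_apply continuous_const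
  have sψ' : HasCompactSupport fun x => fderiv ℝ ψ x e := (hψc.fderiv_apply ℝ e)
  have i1 : Integrable (fun x => fderiv ℝ ψ x e • F x) volume :=
    (cψ'.smul cF).integrable_of_hasCompactSupport sψ'.smul_right
  have i2 : Integrable (fun x => ψ x • F' x e) volume :=
    (cψ.smul cF').integrable_of_hasCompactSupport hψc.smul_right
  have i3 : Integrable (fun x => ψ x • F x) volume :=
    (cψ.smul cF).integrable_of_hasCompactSupport hψc.smul_right
  have key := integral_bilinear_hasFDerivAt_right_eq_neg_left_of_integrable
    (B := (ContinuousLinearMap.lsmul ℝ ℝ : ℝ →L[ℝ] Vec m →L[ℝ] Vec m)) (f := ψ) (g := F)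
    (f' := fderiv ℝ ψ) (g' := F') (v := e) (μ := volume) i1 i2 i3
    (fun x _ => (hψ.differentiable (by simp) x).hasFDerivAt)
    (fun x _ => hg.hasFDerivAt_comp hη hφ x)
  simp only [ContinuousLinearMap.lsmul_apply] at key
  have key2 := congrArg (fun w : Vec m => w α) key
  simp only [PiLp.neg_apply] at key2
  rw [integral_component i1, integral_component i2] at key2
  have e1 : ∀ x, ((fderiv ℝ ψ x e : ℝ) : ℂ) * F x α = (fderiv ℝ ψ x e • F x) α := by
    intro x; simp
  have e2 : ∀ x, ((ψ x : ℝ) : ℂ) * (η x • chainTens g β (φ x) (grad φ x) +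
      tens (radialMap g (φ x)) (gradR η x)) (h, α) = (ψ x • F' x e) α := by
    intro x
    have hrow : row (grad φ x) h = fderiv ℝ φ x e := by ext α; simp [row, e]
    simp [F', chainTens_apply, hrow, gradR, e]
    ring
  simp only [e1, e2]
  rw [key2, neg_neg]

theorem isTest_memLp {E : Type*} [NormedAddCommGroup E] [NormedSpace ℝ E] {Ω : Set (Pt n)}
    {φ : Pt n → E} (hφ : IsTest Ω φ) : MemLp φ 2 volume :=
  hφ.1.continuous.memLp_of_hasCompactSupport hφ.2.1

theorem continuous_grad {φ : Pt n → Vec m} (hφ : ContDiff ℝ ∞ φ) : Continuous (grad φ) := by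
  refine (PiLp.continuous_toLp 2 _).comp (continuous_pi fun i => ?_)
  exact (EuclideanSpace.proj (𝕜 := ℂ) i.2).continuous.comp
    ((hφ.continuous_fderiv (by simp)).clm_apply continuous_const)

theorem grad_eq_zero {φ : Pt n → Vec m} {x : Pt n} (hx : x ∉ tsupport φ) : grad φ x = 0 := by
  have : fderiv ℝ φ x = 0 := by
    by_contra hne
    exact hx (support_fderiv_subset ℝ hne)
  ext i
  simp [this]

theorem isTest_memLp_grad {Ω : Set (Pt n)} {φ : Pt n → Vec m} (hφ : IsTest Ω φ) :
    MemLp (grad φ) 2 volume :=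
  (continuous_grad hφ.1).memLp_of_hasCompactSupport
    (HasCompactSupport.intro hφ.2.1.isCompact fun _ hx => grad_eq_zero hx)

/-- If `|f j - f| ≤ C |k j|` and `k j → 0` in `L²`, then `f j → f` in `L²`. -/
theorem tendsto_eLpNorm_sub_of_le {X E F : Type*} [MeasurableSpace X] {μ : Measure X}
    [NormedAddCommGroup E] [NormedAddCommGroup F] {f : ℕ → X → E} {f₀ : X → E} {k : ℕ → X → F}
    {C : ℝ} (h : ∀ j x, ‖f j x - f₀ x‖ ≤ C * ‖k j x‖)
    (hk : Tendsto (fun j => eLpNorm (k j) 2 μ) atTop (𝓝 0)) :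
    Tendsto (fun j => eLpNorm (f j - f₀) 2 μ) atTop (𝓝 0) := by
  have h0 : Tendsto (fun j => ENNReal.ofReal C * eLpNorm (k j) 2 μ) atTop (𝓝 0) := by
    simpa using ENNReal.Tendsto.const_mul hk (Or.inr ENNReal.ofReal_ne_top)
  refine tendsto_of_tendsto_of_tendsto_of_le_of_le tendsto_const_nhds h0 (fun _ => zero_le)
    fun j => ?_
  exact eLpNorm_le_mul_eLpNorm_of_ae_le_mul (Eventually.of_forall (h j)) 2

end

section

variable {g β : ℝ → ℝ} {M : ℝ}

set_option maxHeartbeats 800000 in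
/-- The chain rule for the weak gradient of `η g(|U|) U`. -/
theorem H1c.weakGrad_chain {Ω : Set (Pt n)} {U : Pt n → Vec m} {DU : Pt n → Tens n m}
    (hU : H1c Ω U DU) (hg : RadialWeight g β M) {η : Pt n → ℝ} (hη : ContDiff ℝ ∞ η)
    (hηc : HasCompactSupport η) :
    WeakGrad (fun x => η x • radialMap g (U x))
      (fun x => η x • chainTens g β (U x) (DU x) + tens (radialMap g (U x)) (gradR η x)) := by
  obtain ⟨S, -, -, -, -, φ₀, ht₀, -, hφ₀, hDφ₀⟩ := hU.approx
  have hM : 0 ≤ M := (abs_nonneg _).trans (hg.abs_le 0 le_rfl)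
  -- an almost everywhere convergent subsequence
  obtain ⟨ns, hns, hae⟩ := (tendstoInMeasure_of_tendsto_eLpNorm (p := 2) (by norm_num)
    (fun j => (isTest_memLp (ht₀ j)).aestronglyMeasurable) hU.memLp.aestronglyMeasurable
    hφ₀).exists_seq_tendsto_ae
  set φ : ℕ → Pt n → Vec m := fun j => φ₀ (ns j)
  have ht : ∀ j, IsTest Ω (φ j) := fun j => ht₀ _
  have hφ : Tendsto (fun j => eLpNorm (φ j - U) 2 volume) atTop (𝓝 0) :=
    hφ₀.comp hns.tendsto_atTop
  have hDφ : Tendsto (fun j => eLpNorm (grad (φ j) - DU) 2 volume) atTop (𝓝 0) :=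
    hDφ₀.comp hns.tendsto_atTop
  obtain ⟨C, hC, hC1, hC2⟩ := exists_gradR_bound hη hηc
  have mU := hU.memLp.aestronglyMeasurable
  have mDU := hU.memLp_grad.aestronglyMeasurable
  have mη : AEStronglyMeasurable η volume := hη.continuous.aestronglyMeasurable
  have mη' : ∀ h, AEStronglyMeasurable (fun x => gradR η x h) volume := fun h =>
    ((continuous_apply h).comp (continuous_gradR hη)).aestronglyMeasurable
  have mG : ∀ {w : Pt n → Vec m}, AEStronglyMeasurable w volume →
      AEStronglyMeasurable (fun x => radialMap g (w x)) volume := fun hw =>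
    hg.continuous_radialMap.comp_aestronglyMeasurable hw
  -- the three families of functions
  have lF : ∀ {w : Pt n → Vec m}, MemLp w 2 volume →
      MemLp (fun x => η x • radialMap g (w x)) 2 volume := fun {w} hw =>
    hw.of_le_mul (c := C * M) (mη.smul (mG hw.aestronglyMeasurable))
      (Eventually.of_forall fun x => by
        rw [norm_smul, mul_assoc]
        exact mul_le_mul (hC1 x) (hg.norm_radialMap_le _) (norm_nonneg _) hC)
  have lT : ∀ {w : Pt n → Vec m}, MemLp w 2 volume →
      MemLp (fun x => tens (radialMap g (w x)) (gradR η x)) 2 volume := fun {w} hw =>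
    hw.of_le_mul (c := C * M) (aestronglyMeasurable_tens (mG hw.aestronglyMeasurable) mη')
      (Eventually.of_forall fun x => by
        rw [mul_assoc]
        exact (norm_tens_le _ _).trans
          (mul_le_mul (hC2 x) (hg.norm_radialMap_le _) (norm_nonneg _) hC))
  have lD : ∀ {w : Pt n → Vec m} {ξ : Pt n → Tens n m}, AEStronglyMeasurable w volume →
      MemLp ξ 2 volume → MemLp (fun x => η x • chainTens g β (w x) (ξ x)) 2 volume :=
    fun {w ξ} hw hξ => hξ.of_le_mul (c := C * (2 * M))
      (mη.smul (hg.aestronglyMeasurable_chainTens hw hξ.aestronglyMeasurable))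
      (Eventually.of_forall fun x => by
        rw [norm_smul, mul_assoc]
        exact mul_le_mul (hC1 x) (hg.norm_chainTens_le _ _) (norm_nonneg _) hC)
  have tF : Tendsto (fun j => eLpNorm ((fun x => η x • radialMap g (φ j x)) -
      fun x => η x • radialMap g (U x)) 2 volume) atTop (𝓝 0) :=
    tendsto_eLpNorm_sub_of_le (C := C * (2 * M)) (fun j x => by
      rw [← smul_sub, norm_smul, mul_assoc]
      exact mul_le_mul (hC1 x) (hg.norm_radialMap_sub_le _ _) (norm_nonneg _) hC) hφ
  have tT : Tendsto (fun j => eLpNorm ((fun x => tens (radialMap g (φ j x)) (gradR η x)) -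
      fun x => tens (radialMap g (U x)) (gradR η x)) 2 volume) atTop (𝓝 0) :=
    tendsto_eLpNorm_sub_of_le (C := C * (2 * M)) (fun j x => by
      have : tens (radialMap g (φ j x)) (gradR η x) - tens (radialMap g (U x)) (gradR η x)
          = tens (radialMap g (φ j x) - radialMap g (U x)) (gradR η x) := by
        ext i; simp; ring
      rw [this, mul_assoc]
      exact (norm_tens_le _ _).trans
        (mul_le_mul (hC2 x) (hg.norm_radialMap_sub_le _ _) (norm_nonneg _) hC)) hφ
  -- The gradient term is split: the part with ∇φ_j - DU tends to 0 in L² by the uniform bound on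
  -- `chainTens`, while the part with the fixed tensor DU is handled in `L4` by dominated
  -- convergence along the almost everywhere convergent subsequence.
  have tD : Tendsto (fun j => eLpNorm ((fun x => η x • chainTens g β (φ j x)
      (grad (φ j) x - DU x)) - fun _ => (0 : Tens n m)) 2 volume) atTop (𝓝 0) :=
    tendsto_eLpNorm_sub_of_le (C := C * (2 * M)) (fun j x => by
      rw [sub_zero, norm_smul, mul_assoc]
      exact mul_le_mul (hC1 x) (hg.norm_chainTens_le _ _) (norm_nonneg _) hC) hDφ
  intro ψ hψ hψc h α
  have hbp := fun j => hg.integral_by_parts hη (ht j).1 ψ hψ hψc h α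
  set e : Pt n := EuclideanSpace.single h 1
  have kψ : MemLp (fun x => ((ψ x : ℝ) : ℂ)) 2 volume :=
    (Complex.continuous_ofReal.comp hψ.continuous).memLp_of_hasCompactSupport
      (hψc.comp_left (g := fun t : ℝ => (t : ℂ)) (by simp))
  have kψ' : MemLp (fun x => ((fderiv ℝ ψ x e : ℝ) : ℂ)) 2 volume :=
    (Complex.continuous_ofReal.comp ((hψ.continuous_fderiv (by simp)).clm_apply
      continuous_const)).memLp_of_hasCompactSupport
      ((hψc.fderiv_apply ℝ e).comp_left (g := fun t : ℝ => (t : ℂ)) (by simp))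
  have pair : ∀ {ι : Type} [Fintype ι] (i : ι) {f : ℕ → Pt n → EuclideanSpace ℂ ι}
      {f₀ : Pt n → EuclideanSpace ℂ ι} {k : Pt n → ℂ}, (∀ j, MemLp (f j) 2 volume) →
      MemLp f₀ 2 volume → Tendsto (fun j => eLpNorm (f j - f₀) 2 volume) atTop (𝓝 0) →
      MemLp k 2 volume →
      Tendsto (fun j => ∫ x, k x * f j x i) atTop (𝓝 (∫ x, k x * f₀ x i)) := by
    intro ι _ i f f₀ k hf hf₀ hff hk
    refine tendsto_integral_pairing (b := fun (w : EuclideanSpace ℂ ι) (c : ℂ) => c * w i)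
      (fun x x' y => by simp; ring) (fun x y => ?_) ?_ hf hf₀ hff hk
    · rw [norm_mul, mul_comm]
      exact mul_le_mul_of_nonneg_right (norm_component_le _ _) (norm_nonneg _)
    · exact continuous_snd.mul ((EuclideanSpace.proj (𝕜 := ℂ) i).continuous.comp continuous_fst)
  have L1 := pair α (fun j => lF (isTest_memLp (ht j))) (lF hU.memLp) tF kψ'
  have L2 := pair (h, α) (fun j => lT (isTest_memLp (ht j))) (lT hU.memLp) tT kψ
  have L3 := pair (h, α) (fun j => lD (isTest_memLp (ht j)).aestronglyMeasurable
    ((isTest_memLp_grad (ht j)).sub hU.memLp_grad)) (MemLp.zero' (ε := Tens n m)) tD kψ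
  have int : ∀ {f : Pt n → Tens n m}, MemLp f 2 volume →
      Integrable (fun x => ((ψ x : ℝ) : ℂ) * f x (h, α)) volume := by
    intro f hf
    have h1 : MemLp (fun x => f x (h, α)) 2 volume :=
      hf.of_le (aestronglyMeasurable_component hf.aestronglyMeasurable _)
        (Eventually.of_forall fun x => norm_component_le _ _)
    exact kψ.integrable_mul h1
  have L4 : Tendsto (fun j => ∫ x, ((ψ x : ℝ) : ℂ) * (η x • chainTens g β (φ j x) (DU x)) (h, α))
      atTop (𝓝 (∫ x, ((ψ x : ℝ) : ℂ) * (η x • chainTens g β (U x) (DU x)) (h, α))) := by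
    refine tendsto_integral_of_dominated_convergence
      (fun x => ‖((ψ x : ℝ) : ℂ)‖ * (C * (2 * M) * ‖DU x‖))
      (fun j => (int (lD (isTest_memLp (ht j)).aestronglyMeasurable
        hU.memLp_grad)).aestronglyMeasurable) ?_ (fun j => Eventually.of_forall fun x => ?_) ?_
    · exact kψ.norm.integrable_mul (hU.memLp_grad.norm.const_mul (C * (2 * M)))
    · rw [norm_mul]
      refine mul_le_mul_of_nonneg_left ((norm_component_le _ _).trans ?_) (norm_nonneg _)
      rw [norm_smul, mul_assoc]
      exact mul_le_mul (hC1 x) (hg.norm_chainTens_le _ _) (norm_nonneg _) hC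
    · filter_upwards [hae] with x hx
      have h1 : Tendsto (fun j => chainTens g β (φ j x) (DU x)) atTop
          (𝓝 (chainTens g β (U x) (DU x))) := hg.tendsto_chainTens hx _
      have h3 := ((EuclideanSpace.proj (𝕜 := ℂ) (h, α)).continuous.tendsto _).comp
        (h1.const_smul (η x))
      exact h3.const_mul _
  have hR : Tendsto (fun j => - ∫ x, ((ψ x : ℝ) : ℂ) * (η x • chainTens g β (φ j x)
      (grad (φ j) x) + tens (radialMap g (φ j x)) (gradR η x)) (h, α)) atTop
      (𝓝 (-∫ x, ((ψ x : ℝ) : ℂ) * (η x • chainTens g β (U x) (DU x) +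
        tens (radialMap g (U x)) (gradR η x)) (h, α))) := by
    have hsum := ((L3.add L4).add L2).neg
    have e0 : ∫ x, ((ψ x : ℝ) : ℂ) * (0 : Tens n m) (h, α) = 0 := by simp
    rw [e0, zero_add, ← integral_add (int (lD mU hU.memLp_grad)) (int (lT hU.memLp))] at hsum
    convert hsum using 2 with j
    · rw [← integral_add, ← integral_add]
      · congr 2 with x
        rw [Pi.sub_apply, chainTens_sub]
        simp only [PiLp.add_apply, PiLp.smul_apply, PiLp.sub_apply, smul_sub]
        ring
      · exact (int (lD (isTest_memLp (ht j)).aestronglyMeasurable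
          ((isTest_memLp_grad (ht j)).sub hU.memLp_grad))).add
          (int (lD (isTest_memLp (ht j)).aestronglyMeasurable hU.memLp_grad))
      · exact int (lT (isTest_memLp (ht j)))
      · exact int (lD (isTest_memLp (ht j)).aestronglyMeasurable
          ((isTest_memLp_grad (ht j)).sub hU.memLp_grad))
      · exact int (lD (isTest_memLp (ht j)).aestronglyMeasurable hU.memLp_grad)
    · congr 2 with x
      simp only [PiLp.add_apply]
      ring
  refine tendsto_nhds_unique L1 ?_
  simp only [hbp]
  exact hR

end

section

variable {g β : ℝ → ℝ} {M : ℝ}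

/-- The chain rule with a cutoff, for `W^{1,2}_loc` functions. -/
theorem IsW12Loc.h1c_chain {Ω : Set (Pt n)} (hΩ : IsOpen Ω) {u : Pt n → Vec m}
    {Du : Pt n → Tens n m} (hu : IsW12Loc Ω u Du) (hg : RadialWeight g β M) {η : Pt n → ℝ}
    (hη : IsTest Ω η) :
    H1c Ω (fun x => η x • radialMap g (u x))
      (fun x => η x • chainTens g β (u x) (Du x) + tens (radialMap g (u x)) (gradR η x)) := by
  obtain ⟨hηs, hηc, hηΩ⟩ := hη
  have hM : 0 ≤ M := (abs_nonneg _).trans (hg.abs_le 0 le_rfl)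
  set S := tsupport η with hS
  have hSc : IsCompact S := hηc
  -- The auxiliary cutoff makes u globally W^{1,2}, so that the chain rule on the whole space
  -- applies. As χ = 1 on the support of η, it leaves no trace in the result.
  obtain ⟨χ, hχ, hχ1, -⟩ := exists_cutoff hSc hΩ hηΩ
  have hU := hu.h1c_smul hΩ hχ
  have hw := hU.weakGrad_chain hg hηs hηc
  have hu2 := hu.memLp S hSc hηΩ
  have hDu2 := hu.memLp_grad S hSc hηΩ
  have z1 : ∀ x, x ∉ S → η x = 0 := fun x hx => image_eq_zero_of_notMem_tsupport hx
  have z2 : ∀ x, x ∉ S → gradR η x = 0 := fun x hx => gradR_eq_zero hx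
  have e1 : (fun x => η x • radialMap g (χ x • u x)) = fun x => η x • radialMap g (u x) := by
    ext1 x
    by_cases hx : x ∈ S
    · rw [hχ1 x hx, one_smul]
    · rw [z1 x hx, zero_smul, zero_smul]
  have e2 : (fun x => η x • chainTens g β (χ x • u x) (χ x • Du x + tens (u x) (gradR χ x)) +
        tens (radialMap g (χ x • u x)) (gradR η x)) =
      fun x => η x • chainTens g β (u x) (Du x) + tens (radialMap g (u x)) (gradR η x) := by
    ext1 x
    by_cases hx : x ∈ S
    · rw [hχ1 x hx, one_smul, one_smul]
      by_cases hη0 : η x = 0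
      · rw [hη0, zero_smul, zero_smul]
      -- The cutoff χ equals 1 near x only because {η ≠ 0} is open. Where η = 0, the term with ∇χ is
      -- multiplied by zero.
      · have hev : χ =ᶠ[𝓝 x] fun _ => 1 := by
          filter_upwards [hηs.continuous.isOpen_support.mem_nhds hη0] with y hy
          exact hχ1 y (subset_tsupport _ hy)
        have : gradR χ x = 0 := by
          ext h
          simp [gradR, hev.fderiv_eq]
        rw [this, tens_zero_right, add_zero]
    · rw [z1 x hx, z2 x hx, zero_smul, zero_smul, tens_zero_right, tens_zero_right]
  rw [e1, e2] at hw
  obtain ⟨C, hC, hC1, hC2⟩ := exists_gradR_bound hηs hηc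
  have mη : AEStronglyMeasurable η (volume.restrict S) := hηs.continuous.aestronglyMeasurable
  have mη' : ∀ h, AEStronglyMeasurable (fun x => gradR η x h) (volume.restrict S) := fun h =>
    ((continuous_apply h).comp (continuous_gradR hηs)).aestronglyMeasurable
  have mG := hg.continuous_radialMap.comp_aestronglyMeasurable hu2.aestronglyMeasurable
  have l1 : MemLp (fun x => η x • radialMap g (u x)) 2 (volume.restrict S) :=
    hu2.of_le_mul (c := C * M) (mη.smul mG) (Eventually.of_forall fun x => by
      rw [norm_smul, mul_assoc]
      exact mul_le_mul (hC1 x) (hg.norm_radialMap_le _) (norm_nonneg _) hC)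
  have l2 : MemLp (fun x => tens (radialMap g (u x)) (gradR η x)) 2 (volume.restrict S) :=
    hu2.of_le_mul (c := C * M) (aestronglyMeasurable_tens mG mη')
      (Eventually.of_forall fun x => by
        rw [mul_assoc]
        exact (norm_tens_le _ _).trans
          (mul_le_mul (hC2 x) (hg.norm_radialMap_le _) (norm_nonneg _) hC))
  have l3 : MemLp (fun x => η x • chainTens g β (u x) (Du x)) 2 (volume.restrict S) :=
    hDu2.of_le_mul (c := C * (2 * M)) (mη.smul
      (hg.aestronglyMeasurable_chainTens hu2.aestronglyMeasurable hDu2.aestronglyMeasurable))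
      (Eventually.of_forall fun x => by
        rw [norm_smul, mul_assoc]
        exact mul_le_mul (hC1 x) (hg.norm_chainTens_le _ _) (norm_nonneg _) hC)
  exact h1c_of_weakGrad hΩ hSc hηΩ
    (memLp_of_restrict hSc l1 fun x hx => by simp [z1 x hx])
    (memLp_of_restrict hSc (l3.add l2) fun x hx => by simp [z1 x hx, z2 x hx])
    (fun x hx => by simp [z1 x hx]) (fun x hx => by simp [z1 x hx, z2 x hx]) hw

end

section

/-! ### Coefficients on measures and the extended weak formulation -/

theorem memLp_applyA {X : Type*} [MeasurableSpace X] {μ : Measure X} {A : X → Coef2 n m} {Λ : ℝ}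
    (hA : ∀ h k α β, AEStronglyMeasurable (fun x => A x h k α β) μ)
    (hΛ : ∀ᵐ x ∂μ, ∀ h k α β, ‖A x h k α β‖ ≤ Λ) {ξ : X → Tens n m} (hξ : MemLp ξ 2 μ) :
    MemLp (fun x => applyA (A x) (ξ x)) 2 μ :=
  hξ.of_le_mul (c := (n * m) ^ 2 * Λ) (aestronglyMeasurable_applyA hA hξ.aestronglyMeasurable)
    (hΛ.mono fun _ hx => norm_applyA_le hx _)

theorem memLp_applyB {X : Type*} [MeasurableSpace X] {μ : Measure X} {B : X → Coef1 n m} {K : ℝ}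
    (hB : ∀ h α β, AEStronglyMeasurable (fun x => B x h α β) μ)
    (hK : ∀ᵐ x ∂μ, ∀ h α β, ‖B x h α β‖ ≤ K) {ξ : X → Tens n m} (hξ : MemLp ξ 2 μ) :
    MemLp (fun x => applyB (B x) (ξ x)) 2 μ :=
  hξ.of_le_mul (c := n * m ^ 2 * K) (aestronglyMeasurable_applyB hB hξ.aestronglyMeasurable)
    (hK.mono fun _ hx => norm_applyB_le hx _)

theorem integrable_inner {X : Type*} [MeasurableSpace X] {μ : Measure X} {ι : Type*} [Fintype ι]
    {f k : X → EuclideanSpace ℂ ι} (hf : MemLp f 2 μ) (hk : MemLp k 2 μ) :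
    Integrable (fun x => inner ℂ (f x) (k x)) μ :=
  integrable_pairing (b := fun x y => inner ℂ x y) (fun x y => norm_inner_le_norm x y)
    continuous_inner hf hk

variable {Ω : Set (Pt n)} {A : Pt n → Coef2 n m} {B : Pt n → Coef1 n m} {Λ K : ℝ≥0}

theorem IsAdmissible.ae_boundA (h : IsAdmissible Ω A B Λ K) :
    ∀ᵐ x ∂volume.restrict Ω, ∀ h k α β, ‖A x h k α β‖ ≤ Λ := by
  simp only [ae_all_iff]
  exact h.boundA

theorem IsAdmissible.ae_boundB (h : IsAdmissible Ω A B Λ K) :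
    ∀ᵐ x ∂volume.restrict Ω, ∀ h α β, ‖B x h α β‖ₑ ≤ K / bdryDist Ω x := by
  simp only [ae_all_iff]
  exact h.boundB

/-- `|B| ≤ K / d` where the distance to the boundary is at least `d`. -/
theorem IsAdmissible.ae_boundB_of_le (h : IsAdmissible Ω A B Λ K) {S : Set (Pt n)} (hSΩ : S ⊆ Ω)
    (hS : MeasurableSet S) {d : ℝ} (hd : 0 < d)
    (hSd : ∀ x ∈ S, ENNReal.ofReal d ≤ bdryDist Ω x) :
    ∀ᵐ x ∂volume.restrict S, ∀ h α β, ‖B x h α β‖ ≤ K / d := by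
  filter_upwards [ae_restrict_of_ae_restrict_of_subset hSΩ h.ae_boundB, ae_restrict_mem hS]
    with x hx hxS h' α β
  have h1 := hx h' α β
  have h2 : (K : ℝ≥0∞) / bdryDist Ω x ≤ K / ENNReal.ofReal d :=
    ENNReal.div_le_div_left (hSd x hxS) _
  have h3 := h1.trans h2
  rw [← ofReal_norm, ← ENNReal.ofReal_coe_nnreal, ← ENNReal.ofReal_div_of_pos hd] at h3
  exact (ENNReal.ofReal_le_ofReal_iff (by positivity)).1 h3

/-- A closed thickening of the compact set lies in the open set Ω, while frontier points lie outside
Ω. This gives the bound on `B` over compact sets. -/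
theorem exists_le_bdryDist (hΩ : IsOpen Ω) {S : Set (Pt n)} (hS : IsCompact S) (hSΩ : S ⊆ Ω) :
    ∃ d : ℝ, 0 < d ∧ ∀ x ∈ S, ENNReal.ofReal d ≤ bdryDist Ω x := by
  obtain ⟨δ, hδ, hδΩ⟩ := hS.exists_cthickening_subset_open hΩ hSΩ
  refine ⟨δ, hδ, fun x hx => Metric.le_infEDist.2 fun y hy => ?_⟩
  by_contra hlt
  have hy' : y ∉ Ω := by
    rw [frontier, hΩ.interior_eq] at hy
    exact hy.2
  refine hy' (hδΩ (Metric.mem_cthickening_of_edist_le y x δ S hx ?_))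
  rw [edist_comm]
  exact (not_le.1 hlt).le

/-- The weak formulation holds for all `W^{1,2}` functions with compact support in `Ω`. -/
theorem IsWeakSolution.weak_eq_h1c (hadm : IsAdmissible Ω A B Λ K) {u : Pt n → Vec m}
    {Du : Pt n → Tens n m} (hu : IsWeakSolution Ω A B u Du) {v : Pt n → Vec m}
    {Dv : Pt n → Tens n m} (hv : H1c Ω v Dv) :
    ∫ x in Ω, (inner ℂ (Dv x) (applyA (A x) (Du x)) - inner ℂ (v x) (applyB (B x) (Du x))) = 0 := by
  obtain ⟨S, hS, hSΩ, hv0, hDv0, φ, hφ, hφS, hφv, hDφv⟩ := hv.approx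
  obtain ⟨d, hd, hdS⟩ := exists_le_bdryDist hadm.isOpen hS hSΩ
  have hsub : volume.restrict S ≤ volume.restrict Ω := Measure.restrict_mono_set _ hSΩ
  have lDu := hu.sobolev.memLp_grad S hS hSΩ
  have lA : MemLp (fun x => applyA (A x) (Du x)) 2 (volume.restrict S) :=
    memLp_applyA (fun h k α β => (hadm.measA h k α β).mono_measure hsub)
      (ae_restrict_of_ae_restrict_of_subset hSΩ hadm.ae_boundA) lDu
  have lB : MemLp (fun x => applyB (B x) (Du x)) 2 (volume.restrict S) :=
    memLp_applyB (fun h α β => (hadm.measB h α β).mono_measure hsub)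
      (hadm.ae_boundB_of_le hSΩ hS.measurableSet hd hdS) lDu
  -- All functions vanish off S, and on S the coefficient `B` is bounded. Both terms can then be
  -- integrated separately and passed to the limit.
  have toS : ∀ {w : Pt n → Vec m} {Dw : Pt n → Tens n m}, (∀ x, x ∉ S → w x = 0) →
      (∀ x, x ∉ S → Dw x = 0) → MemLp w 2 volume → MemLp Dw 2 volume →
      ∫ x in Ω, (inner ℂ (Dw x) (applyA (A x) (Du x)) - inner ℂ (w x) (applyB (B x) (Du x)))
        = (∫ x in S, inner ℂ (Dw x) (applyA (A x) (Du x)))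
          - ∫ x in S, inner ℂ (w x) (applyB (B x) (Du x)) := by
    intro w Dw hw hDw lw lDw
    rw [setIntegral_eq_of_subset_of_forall_sdiff_eq_zero hadm.isOpen.measurableSet hSΩ
      fun x hx => by simp [hw x hx.2, hDw x hx.2]]
    exact integral_sub (integrable_inner (lDw.restrict S) lA) (integrable_inner (lw.restrict S) lB)
  have restr : ∀ {ι : Type} [Fintype ι] {f : ℕ → Pt n → EuclideanSpace ℂ ι}
      {f₀ : Pt n → EuclideanSpace ℂ ι}, Tendsto (fun j => eLpNorm (f j - f₀) 2 volume) atTop (𝓝 0) →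
      Tendsto (fun j => eLpNorm (f j - f₀) 2 (volume.restrict S)) atTop (𝓝 0) := fun h =>
    tendsto_of_tendsto_of_tendsto_of_le_of_le tendsto_const_nhds h (fun _ => zero_le)
      fun j => eLpNorm_mono_measure _ Measure.restrict_le_self
  have t1 := tendsto_integral_pairing (b := fun x y : Tens n m => inner ℂ x y)
    (fun x x' y => (inner_sub_left x x' y).symm) (fun x y => norm_inner_le_norm x y)
    continuous_inner (fun j => (isTest_memLp_grad (hφ j)).restrict S) (hv.memLp_grad.restrict S)
    (restr hDφv) lA
  have t2 := tendsto_integral_pairing (b := fun x y : Vec m => inner ℂ x y)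
    (fun x x' y => (inner_sub_left x x' y).symm) (fun x y => norm_inner_le_norm x y)
    continuous_inner (fun j => (isTest_memLp (hφ j)).restrict S) (hv.memLp.restrict S)
    (restr hφv) lB
  rw [toS hv0 hDv0 hv.memLp hv.memLp_grad]
  refine tendsto_nhds_unique (t1.sub t2) ?_
  refine tendsto_const_nhds.congr fun j => ?_
  rw [← toS (fun x hx => image_eq_zero_of_notMem_tsupport fun h => hx (hφS j h))
    (fun x hx => grad_eq_zero fun h => hx (hφS j h)) (isTest_memLp (hφ j))
    (isTest_memLp_grad (hφ j)), hu.weak_eq _ (hφ j)]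

/-! ### The integral ellipticity condition in real form -/

theorem IsW12Zero.of_isTest {v : Pt n → Vec m} (hv : IsTest Ω v) : IsW12Zero Ω v (grad v) :=
  ⟨(isTest_memLp hv).restrict Ω, (isTest_memLp_grad hv).restrict Ω, fun _ => v, fun _ => hv,
    by simp, by simp⟩

/-- The quadratic form `Re ⟨A(ξ - t R), ξ + t R⟩` with `R = radial w ξ`. -/
def quad (A : Coef2 n m) (t : ℝ) (w : Vec m) (ξ : Tens n m) : ℝ :=
  formA A (ξ - t • radial w ξ) (ξ + t • radial w ξ)

theorem memLp_radial {X : Type*} [MeasurableSpace X] {μ : Measure X} {v : X → Vec m}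
    {ξ : X → Tens n m} (hv : AEStronglyMeasurable v μ) (hξ : MemLp ξ 2 μ) :
    MemLp (fun x => radial (v x) (ξ x)) 2 μ :=
  hξ.of_le (aestronglyMeasurable_radial hv hξ.aestronglyMeasurable)
    (Eventually.of_forall fun _ => norm_radial_le _ _)

theorem integrable_inner_applyA {X : Type*} [MeasurableSpace X] {μ : Measure X}
    {A : X → Coef2 n m} {Λ : ℝ}
    (hA : ∀ h k α β, AEStronglyMeasurable (fun x => A x h k α β) μ)
    (hΛ : ∀ᵐ x ∂μ, ∀ h k α β, ‖A x h k α β‖ ≤ Λ) {ξ ζ : X → Tens n m} (hξ : MemLp ξ 2 μ)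
    (hζ : MemLp ζ 2 μ) : Integrable (fun x => inner ℂ (ζ x) (applyA (A x) (ξ x))) μ :=
  integrable_inner hζ (memLp_applyA hA hΛ hξ)

theorem integrable_formA {X : Type*} [MeasurableSpace X] {μ : Measure X}
    {A : X → Coef2 n m} {Λ : ℝ}
    (hA : ∀ h k α β, AEStronglyMeasurable (fun x => A x h k α β) μ)
    (hΛ : ∀ᵐ x ∂μ, ∀ h k α β, ‖A x h k α β‖ ≤ Λ) {ξ ζ : X → Tens n m} (hξ : MemLp ξ 2 μ)
    (hζ : MemLp ζ 2 μ) : Integrable (fun x => formA (A x) (ξ x) (ζ x)) μ :=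
  (integrable_inner_applyA hA hΛ hξ hζ).re

theorem IsAdmissible.integrable_quad (hadm : IsAdmissible Ω A B Λ K) (t : ℝ) {v : Pt n → Vec m}
    {Dv : Pt n → Tens n m} (hv : AEStronglyMeasurable v (volume.restrict Ω))
    (hDv : MemLp Dv 2 (volume.restrict Ω)) :
    Integrable (fun x => quad (A x) t (v x) (Dv x)) (volume.restrict Ω) :=
  integrable_formA hadm.measA hadm.ae_boundA (hDv.sub ((memLp_radial hv hDv).const_smul t))
    (hDv.add ((memLp_radial hv hDv).const_smul t))

theorem IsAdmissible.intEllipticWith_iff (hadm : IsAdmissible Ω A B Λ K) {p c : ℝ} :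
    IntEllipticWith Ω A p c ↔ ∀ (v : Pt n → Vec m) (Dv : Pt n → Tens n m), IsW12Zero Ω v Dv →
      c * ∫ x in Ω, ‖Dv x‖ ^ 2 ≤ ∫ x in Ω, quad (A x) (1 - 2 / p) (v x) (Dv x) := by
  refine forall₂_congr fun v Dv => imp_congr_right fun hv => ?_
  have hr := memLp_radial hv.memLp.aestronglyMeasurable hv.memLp_grad
  have hint := integrable_inner_applyA hadm.measA hadm.ae_boundA
    (hv.memLp_grad.sub (hr.const_smul (1 - 2 / p))) (hv.memLp_grad.add (hr.const_smul (1 - 2 / p)))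
  have := Complex.reCLM.integral_comp_comm hint
  simp only [Complex.reCLM_apply] at this
  exact iff_of_eq (congrArg _ this.symm)

theorem IntEllipticWith.mono {p c c' : ℝ} (h : IntEllipticWith Ω A p c) (hc : c' ≤ c) :
    IntEllipticWith Ω A p c' := fun v Dv hv =>
  (mul_le_mul_of_nonneg_right hc (integral_nonneg fun _ => by positivity)).trans (h v Dv hv)

end

section

/-! ### The Legendre–Hadamard condition -/

/-- A bounded function is nonnegative if its integrals against squares of test functions are. -/
theorem ae_nonneg_of_integral_sq_mul_nonneg {Ω : Set (Pt n)} (hΩ : IsOpen Ω) {f : Pt n → ℝ}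
    (hf : AEStronglyMeasurable f (volume.restrict Ω)) {C : ℝ}
    (hC : ∀ᵐ x ∂volume.restrict Ω, |f x| ≤ C)
    (h : ∀ φ : Pt n → ℝ, IsTest Ω φ → 0 ≤ ∫ x in Ω, φ x ^ 2 * f x) :
    ∀ᵐ x ∂volume.restrict Ω, 0 ≤ f x := by
  wlog hC0 : 0 ≤ C generalizing C
  · exact this (hC.mono fun x hx => hx.trans (le_abs_self C)) (abs_nonneg C)
  set ν := volume.restrict Ω
  have hint : ∀ s, MeasurableSet s → ν s < ⊤ → IntegrableOn f s ν := fun s hs hsν =>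
    Measure.integrableOn_of_bounded (M := C) hsν.ne hf
      (ae_restrict_of_ae (hC.mono fun x hx => by simpa using hx))
  refine ae_nonneg_of_forall_setIntegral_nonneg_of_sigmaFinite hint fun s hs hsν => ?_
  have hsΩ : volume (s ∩ Ω) ≠ ⊤ := by
    rw [← Measure.restrict_apply hs]; exact hsν.ne
  refine le_of_forall_pos_le_add fun ε hε => ?_
  -- approximation of the set from inside and outside
  have hε' : (0 : ℝ) < ε / (2 * C + 1) := by positivity
  set δ := ENNReal.ofReal (ε / (2 * C + 1))
  have hδ : δ ≠ 0 := by simp [δ, hε']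
  obtain ⟨S, hSs, hS, hSδ⟩ := (hs.inter hΩ.measurableSet).exists_isCompact_sdiff_lt hsΩ hδ
  obtain ⟨U₀, hSU₀, hU₀, hU₀δ⟩ := hS.exists_isOpen_lt_add (μ := volume) hδ
  set U := U₀ ∩ Ω
  have hU : IsOpen U := hU₀.inter hΩ
  have hSU : S ⊆ U := Set.subset_inter hSU₀ (hSs.trans Set.inter_subset_right)
  have hUδ : volume (U \ S) ≤ δ := by
    rw [measure_sdiff hSU hS.measurableSet.nullMeasurableSet hS.measure_lt_top.ne]
    refine tsub_le_iff_left.2 ((measure_mono Set.inter_subset_left).trans hU₀δ.le)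
  obtain ⟨φ, hφ, hφ1, hφ01⟩ := exists_cutoff hS hU hSU
  have hφΩ : IsTest Ω φ := ⟨hφ.1, hφ.2.1, hφ.2.2.trans Set.inter_subset_right⟩
  have h0 := h φ hφΩ
  -- Within Ω, φ² and the indicator of s differ only on T, and there φ² f exceeds 1_s f by at most
  -- C. As |T| ≤ 2ε/(2C + 1), the total error is at most ε.
  set T := ((s ∩ Ω) \ S) ∪ (U \ S)
  have hT : MeasurableSet T := ((hs.inter hΩ.measurableSet).diff hS.measurableSet).union
    (hU.measurableSet.diff hS.measurableSet)
  have hTν : volume T ≤ δ + δ :=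
    (measure_union_le _ _).trans (add_le_add hSδ.le hUδ)
  have hTfin : ν T < ⊤ := ((Measure.restrict_apply_le _ _).trans hTν).trans_lt
    (by simp [δ])
  have i1 : Integrable (fun x => φ x ^ 2 * f x) ν := by
    have hint1 : IntegrableOn f (tsupport φ) ν := hint _ (isClosed_tsupport _).measurableSet
      ((Measure.restrict_apply_le _ _).trans_lt hφ.2.1.isCompact.measure_lt_top)
    have hint2 : IntegrableOn (fun x => φ x ^ 2 * f x) (tsupport φ) ν := by
      refine hint1.bdd_mul (c := 1) (hφ.1.continuous.pow 2).aestronglyMeasurable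
        (Eventually.of_forall fun x => ?_)
      rw [norm_pow, Real.norm_eq_abs, sq_abs]
      exact pow_le_one₀ (hφ01 x).1 (hφ01 x).2
    refine (integrableOn_iff_integrable_of_support_subset fun x hx => ?_).1 hint2
    by_contra hxS
    exact hx (by simp [image_eq_zero_of_notMem_tsupport hxS])
  have i2 : Integrable (s.indicator f) ν := (integrable_indicator_iff hs).2 (hint s hs hsν)
  have i3 : Integrable (T.indicator fun _ => C) ν :=
    (integrable_indicator_iff hT).2 (integrableOn_const hTfin.ne)
  have hle : ∫ x, φ x ^ 2 * f x ∂ν ≤ ∫ x, (s.indicator f x + T.indicator (fun _ => C) x) ∂ν := by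
    refine integral_mono_ae i1 (i2.add i3) ?_
    filter_upwards [hC, ae_restrict_mem hΩ.measurableSet] with x hx hxΩ
    have hφ2 : φ x ^ 2 ≤ 1 := pow_le_one₀ (hφ01 x).1 (hφ01 x).2
    have hφ2' : 0 ≤ φ x ^ 2 := sq_nonneg _
    have hx1 := abs_le.1 hx
    show φ x ^ 2 * f x ≤ s.indicator f x + T.indicator (fun _ => C) x
    by_cases hxS : x ∈ S
    · have : x ∈ s := (hSs hxS).1
      have hxT : x ∉ T := fun h => h.elim (fun h => h.2 hxS) fun h => h.2 hxS
      simp [this, hxT, hφ1 x hxS]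
    · by_cases hxs : x ∈ s
      · have hxT : x ∈ T := Or.inl ⟨⟨hxs, hxΩ⟩, hxS⟩
        simp only [hxs, hxT, Set.indicator_of_mem]
        nlinarith
      · by_cases hxU : x ∈ U
        · have hxT : x ∈ T := Or.inr ⟨hxU, hxS⟩
          simp only [hxs, hxT, Set.indicator_of_mem, not_false_eq_true, Set.indicator_of_notMem]
          nlinarith
        · have : φ x = 0 := image_eq_zero_of_notMem_tsupport fun h => hxU (hφ.2.2 h)
          simp only [this, hxs, not_false_eq_true, Set.indicator_of_notMem]
          have : 0 ≤ T.indicator (fun _ => C) x := Set.indicator_nonneg (fun _ _ => hC0) x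
          simpa using this
  rw [integral_add i2 i3, integral_indicator hs, integral_indicator_const _ hT] at hle
  have hTr : ν.real T * C ≤ ε := by
    have h1 : ν.real T ≤ 2 * (ε / (2 * C + 1)) := by
      refine ENNReal.toReal_le_of_le_ofReal (by positivity) ?_
      refine ((Measure.restrict_apply_le _ _).trans hTν).trans (le_of_eq ?_)
      rw [← ENNReal.ofReal_add hε'.le hε'.le]
      congr 1; ring
    calc ν.real T * C ≤ 2 * (ε / (2 * C + 1)) * C := by gcongr
      _ = ε * (2 * C / (2 * C + 1)) := by ring
      _ ≤ ε * 1 := by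
          gcongr
          rw [div_le_one (by positivity)]; linarith
      _ = ε := mul_one _
  have := h0.trans hle
  simp only [smul_eq_mul] at this
  linarith

variable {Ω : Set (Pt n)} {A : Pt n → Coef2 n m} {B : Pt n → Coef1 n m} {Λ K : ℝ≥0}

/-- A test function that oscillates in the direction `a`. -/
def planeWave (φ : Pt n → ℝ) (s : ℝ) (a : Pt n) (w : Vec m) (x : Pt n) : Vec m :=
  ((φ x : ℂ) * Complex.exp (((s * inner ℝ a x : ℝ) : ℂ) * Complex.I)) • w

theorem isTest_planeWave {φ : Pt n → ℝ} (hφ : IsTest Ω φ) (s : ℝ) (a : Pt n) (w : Vec m) :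
    IsTest Ω (planeWave φ s a w) := by
  have h0 : ∀ x, x ∉ tsupport φ → planeWave φ s a w x = 0 := fun x hx => by
    simp [planeWave, image_eq_zero_of_notMem_tsupport hx]
  have hts : tsupport (planeWave φ s a w) ⊆ tsupport φ :=
    closure_minimal (fun x hx => by by_contra h; exact hx (h0 x h)) (isClosed_tsupport _)
  refine ⟨?_, HasCompactSupport.intro hφ.2.1.isCompact h0, hts.trans hφ.2.2⟩
  have h1 : ContDiff ℝ ∞ fun x => ((φ x : ℝ) : ℂ) := Complex.ofRealCLM.contDiff.comp hφ.1
  have h2 : ContDiff ℝ ∞ fun x : Pt n => ((s * inner ℝ a x : ℝ) : ℂ) * Complex.I :=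
    (Complex.ofRealCLM.contDiff.comp (contDiff_const.mul
      (contDiff_const.inner ℝ contDiff_id))).mul contDiff_const
  exact (h1.mul h2.cexp).smul contDiff_const

theorem grad_planeWave {φ : Pt n → ℝ} (hφ : ContDiff ℝ ∞ φ) (s : ℝ) (a : Pt n) (w : Vec m)
    (x : Pt n) : grad (planeWave φ s a w) x =
      Complex.exp (((s * inner ℝ a x : ℝ) : ℂ) * Complex.I) •
        (tens w (gradR φ x) + (Complex.I * (s * φ x : ℝ)) • tens w a) := by
  have h1 : HasFDerivAt (fun x => ((φ x : ℝ) : ℂ)) (Complex.ofRealCLM.comp (fderiv ℝ φ x)) x :=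
    Complex.ofRealCLM.hasFDerivAt.comp x (hφ.differentiable (by simp) x).hasFDerivAt
  have h2 : HasFDerivAt (fun x : Pt n => ((s * inner ℝ a x : ℝ) : ℂ))
      (Complex.ofRealCLM.comp (s • innerSL ℝ a)) x :=
    Complex.ofRealCLM.hasFDerivAt.comp x (((innerSL ℝ a).hasFDerivAt).const_mul s)
  have h3 := ((h1.mul (h2.mul_const Complex.I).cexp).smul_const w).fderiv
  ext i
  rw [grad_apply]
  have e0 : planeWave φ s a w = fun y => ((φ y : ℂ) *
    Complex.exp (((s * inner ℝ a y : ℝ) : ℂ) * Complex.I)) • w := rfl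
  rw [e0]
  refine (congrArg (fun L : Pt n →L[ℝ] Vec m => L (EuclideanSpace.single i.1 1) i.2) h3).trans ?_
  have e4 : inner ℝ a (EuclideanSpace.single i.1 (1 : ℝ)) = a i.1 := by
    rw [EuclideanSpace.inner_single_right]; simp
  simp [gradR, e4]
  ring

theorem applyA_smul (A : Coef2 n m) (z : ℂ) (ξ : Tens n m) :
    applyA A (z • ξ) = z • applyA A ξ := by
  ext i
  simp only [applyA_apply, PiLp.smul_apply, smul_eq_mul, Finset.mul_sum]
  exact Finset.sum_congr rfl fun k _ => Finset.sum_congr rfl fun β _ => by ring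

/-- A complex phase common to both arguments cancels. This removes the oscillating exponential from
the form of a plane wave. -/
theorem formA_smul_smul (A : Coef2 n m) (z : ℂ) (ξ ζ : Tens n m) :
    formA A (z • ξ) (z • ζ) = ‖z‖ ^ 2 * formA A ξ ζ := by
  rw [formA_apply, formA_apply, applyA_smul, inner_smul_left, inner_smul_right, ← mul_assoc,
    Complex.conj_mul', ← Complex.ofReal_pow, Complex.re_ofReal_mul]

theorem quad_zero (A : Coef2 n m) (w : Vec m) (ξ : Tens n m) : quad A 0 w ξ = formA A ξ ξ := by
  simp [quad]

/-- The integral condition for `p = 2` implies the Legendre–Hadamard condition. -/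
theorem IsAdmissible.legendreHadamard (hadm : IsAdmissible Ω A B Λ K) :
    ∀ᵐ x ∂volume.restrict Ω, ∀ (w : Vec m) (a : Fin n → ℝ),
      0 ≤ formA (A x) (tens w a) (tens w a) := by
  obtain ⟨c, hc, hell⟩ := hadm.elliptic
  rw [hadm.intEllipticWith_iff] at hell
  -- for fixed directions
  have hfix : ∀ (w : Vec m) (a : Pt n), ∀ᵐ x ∂volume.restrict Ω,
      0 ≤ formA (A x) (tens w a) (tens w a) := by
    intro w a
    set τ : Tens n m := tens w a
    refine ae_nonneg_of_integral_sq_mul_nonneg hadm.isOpen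
      (C := (n * m) ^ 2 * Λ * ‖τ‖ * ‖τ‖)
      (aestronglyMeasurable_formA hadm.measA aestronglyMeasurable_const aestronglyMeasurable_const)
      (hadm.ae_boundA.mono fun x hx => abs_formA_le hx _ _) fun φ hφ => ?_
    have cφ := hφ.1.continuous
    let P : Pt n → Tens n m := fun x => tens w (gradR φ x)
    let Q : Pt n → Tens n m := fun x => (Complex.I * (φ x : ℝ)) • τ
    have lP : MemLp P 2 (volume.restrict Ω) := by
      have hP : Continuous P := by
        refine (PiLp.continuous_toLp 2 _).comp (continuous_pi fun i => ?_)
        exact (Complex.continuous_ofReal.comp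
          ((continuous_apply i.1).comp (continuous_gradR hφ.1))).mul continuous_const
      exact (hP.memLp_of_hasCompactSupport (HasCompactSupport.intro hφ.2.1.isCompact
        fun x hx => by simp [P, gradR_eq_zero hx])).restrict Ω
    have lQ : MemLp Q 2 (volume.restrict Ω) := by
      have hQ : Continuous Q :=
        (continuous_const.mul (Complex.continuous_ofReal.comp cφ)).smul continuous_const
      exact (hQ.memLp_of_hasCompactSupport (HasCompactSupport.intro hφ.2.1.isCompact
        fun x hx => by simp [Q, image_eq_zero_of_notMem_tsupport hx])).restrict Ω
    have iPP := integrable_formA hadm.measA hadm.ae_boundA lP lP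
    have iPQ := integrable_formA hadm.measA hadm.ae_boundA lP lQ
    have iQP := integrable_formA hadm.measA hadm.ae_boundA lQ lP
    have iQQ := integrable_formA hadm.measA hadm.ae_boundA lQ lQ
    -- Up to a unimodular factor the gradient of the plane wave of frequency s is P + sQ, so the
    -- ellipticity condition becomes the nonnegativity of a real quadratic polynomial in s.
    have hpoly : ∀ s : ℝ, 0 ≤ (∫ x in Ω, formA (A x) (P x) (P x)) +
        s * ((∫ x in Ω, formA (A x) (P x) (Q x)) + ∫ x in Ω, formA (A x) (Q x) (P x)) +
        s ^ 2 * ∫ x in Ω, formA (A x) (Q x) (Q x) := by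
      intro s
      have ht := isTest_planeWave hφ s a w
      have h1 := hell _ _ (IsW12Zero.of_isTest ht)
      have h2 : 0 ≤ c * ∫ x in Ω, ‖grad (planeWave φ s a w) x‖ ^ 2 :=
        mul_nonneg hc.le (integral_nonneg fun _ => by positivity)
      refine (h2.trans h1).trans (le_of_eq ?_)
      have iC : Integrable (fun x => s * (formA (A x) (P x) (Q x) + formA (A x) (Q x) (P x)))
        (volume.restrict Ω) := (iPQ.add iQP).const_mul s
      have iPC : Integrable (fun x => formA (A x) (P x) (P x) +
        s * (formA (A x) (P x) (Q x) + formA (A x) (Q x) (P x))) (volume.restrict Ω) := iPP.add iC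
      rw [← integral_add iPQ iQP, ← integral_const_mul, ← integral_const_mul,
        ← integral_add iPP iC, ← integral_add iPC (iQQ.const_mul (s ^ 2))]
      congr 1 with x
      have e1 : (Complex.I * (s * φ x : ℝ)) • τ = s • Q x := by
        ext i; simp [Q]; ring
      rw [div_self two_ne_zero, sub_self, quad_zero, grad_planeWave hφ.1, formA_smul_smul,
        Complex.norm_exp_ofReal_mul_I]
      simp only [one_pow, one_mul]
      rw [e1]
      simp only [map_add, map_smul, LinearMap.add_apply, LinearMap.smul_apply, smul_eq_mul,
        P]
      ring
    set I₀ := ∫ x in Ω, formA (A x) (P x) (P x)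
    set I₁ := (∫ x in Ω, formA (A x) (P x) (Q x)) + ∫ x in Ω, formA (A x) (Q x) (P x)
    have hI₂ : ∫ x in Ω, formA (A x) (Q x) (Q x) =
        ∫ x in Ω, φ x ^ 2 * formA (A x) τ τ := by
      congr 1 with x
      simp only [Q]
      rw [formA_smul_smul]
      simp
    rw [hI₂] at hpoly
    set I₂ := ∫ x in Ω, φ x ^ 2 * formA (A x) τ τ
    by_contra hneg
    have hneg' : 0 < -I₂ := by linarith [not_le.1 hneg]
    have h0 : 0 ≤ I₀ := by simpa using hpoly 0
    -- Chosen so that s² I₂ = -(I₀ + 1). Adding the values at s and -s cancels the linear term and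
    -- leaves -2, a contradiction.
    set s := √((I₀ + 1) / -I₂)
    have hs : s ^ 2 = (I₀ + 1) / -I₂ := Real.sq_sqrt (by positivity)
    have h1 := hpoly s
    have h2 := hpoly (-s)
    have h3 : s ^ 2 * I₂ = -(I₀ + 1) := by
      rw [hs, div_mul_eq_mul_div, div_eq_iff hneg'.ne']
      ring
    have h4 : (-s) ^ 2 * I₂ = -(I₀ + 1) := by rw [neg_sq, h3]
    linarith
  -- countably many directions, then density
  have hall : ∀ᵐ x ∂volume.restrict Ω, ∀ k l : ℕ,
      0 ≤ formA (A x) (tens (TopologicalSpace.denseSeq (Vec m) k)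
        (TopologicalSpace.denseSeq (Pt n) l)) (tens (TopologicalSpace.denseSeq (Vec m) k)
        (TopologicalSpace.denseSeq (Pt n) l)) := by
    simp only [ae_all_iff]
    exact fun k l => hfix _ _
  filter_upwards [hall] with x hx w a
  have hcont : Continuous fun q : Vec m × Pt n =>
      formA (A x) (tens q.1 q.2) (tens q.1 q.2) := by
    have h1 : Continuous fun q : Vec m × Pt n => (tens q.1 q.2 : Tens n m) := by
      refine (PiLp.continuous_toLp 2 _).comp (continuous_pi fun i => ?_)
      exact (Complex.continuous_ofReal.comp
        ((EuclideanSpace.proj (𝕜 := ℝ) i.1).continuous.comp continuous_snd)).mul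
        ((EuclideanSpace.proj (𝕜 := ℂ) i.2).continuous.comp continuous_fst)
    have h2 : Continuous fun ξ : Tens n m => applyA (A x) ξ := by
      refine (PiLp.continuous_toLp 2 _).comp (continuous_pi fun i => ?_)
      exact continuous_finsetSum _ fun k _ => continuous_finsetSum _ fun β _ =>
        continuous_const.mul (EuclideanSpace.proj (𝕜 := ℂ) (k, β)).continuous
    simp only [formA_apply]
    exact Complex.continuous_re.comp (h1.inner (h2.comp h1))
  have hdense : DenseRange fun kl : ℕ × ℕ => (TopologicalSpace.denseSeq (Vec m) kl.1,
      TopologicalSpace.denseSeq (Pt n) kl.2) :=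
    (TopologicalSpace.denseRange_denseSeq (Vec m)).prodMap
      (TopologicalSpace.denseRange_denseSeq (Pt n))
  have hclosed : IsClosed {q : Vec m × Pt n | 0 ≤ formA (A x) (tens q.1 q.2) (tens q.1 q.2)} :=
    isClosed_le continuous_const hcont
  have := hdense.induction_on (p := fun q : Vec m × Pt n =>
    0 ≤ formA (A x) (tens q.1 q.2) (tens q.1 q.2)) (w, WithLp.toLp 2 a) hclosed
    fun kl => hx kl.1 kl.2
  simpa using this

/-! ### The range of ellipticity -/

/-- The point is the sign of the quadratic term: it is minus the form on radial tensors. Under the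
Legendre–Hadamard condition the expression is thus concave in `t`, which drives the interpolation
between exponents. -/
theorem quad_expand (A : Coef2 n m) (t : ℝ) (w : Vec m) (ξ : Tens n m) :
    quad A t w ξ = formA A ξ ξ + t * (formA A ξ (radial w ξ) - formA A (radial w ξ) ξ)
      - t ^ 2 * formA A (radial w ξ) (radial w ξ) := by
  simp only [quad, map_sub, map_add, map_smul, LinearMap.sub_apply, LinearMap.smul_apply,
    smul_eq_mul]
  ring

/-- Ellipticity interpolates between `2` and `p`. -/
theorem IsAdmissible.intEllipticWith_interpolate (hadm : IsAdmissible Ω A B Λ K) {p q c₀ c₁ : ℝ}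
    (h₀ : IntEllipticWith Ω A 2 c₀) (h₁ : IntEllipticWith Ω A p c₁) (hq : 2 ≤ q) (hqp : q ≤ p) :
    IntEllipticWith Ω A q (min c₀ c₁) := by
  rcases hqp.eq_or_lt with rfl | hqp
  · exact h₁.mono (min_le_right _ _)
  rw [hadm.intEllipticWith_iff] at *
  intro v Dv hv
  have hp2 : 2 < p := hq.trans_lt hqp
  set t := 1 - 2 / p
  set s := 1 - 2 / q
  have ht : 0 < t := by
    simp only [t, sub_pos]
    rw [div_lt_one (by linarith)]; exact hp2
  have hs : 0 ≤ s := by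
    simp only [s, sub_nonneg]
    rw [div_le_one (by linarith)]; exact hq
  have hst : s ≤ t := by
    simp only [s, t]
    gcongr
  set τ := s / t
  have hτ0 : 0 ≤ τ := by positivity
  have hτ1 : τ ≤ 1 := (div_le_one ht).2 hst
  have hτt : s = τ * t := by simp only [τ]; field_simp
  have hmv := hv.memLp.aestronglyMeasurable
  have g0 := h₀ v Dv hv
  have g1 := h₁ v Dv hv
  rw [div_self two_ne_zero, sub_self] at g0
  set N := ∫ x in Ω, ‖Dv x‖ ^ 2
  have hN : 0 ≤ N := integral_nonneg fun _ => by positivity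
  have i0 := hadm.integrable_quad 0 hmv hv.memLp_grad
  have i1 := hadm.integrable_quad t hmv hv.memLp_grad
  have is := hadm.integrable_quad s hmv hv.memLp_grad
  -- Pointwise concavity in the parameter, at s = (1 - τ) · 0 + τt, integrated over Ω.
  have hle : (1 - τ) * (∫ x in Ω, quad (A x) 0 (v x) (Dv x)) +
      τ * (∫ x in Ω, quad (A x) t (v x) (Dv x)) ≤ ∫ x in Ω, quad (A x) s (v x) (Dv x) := by
    rw [← integral_const_mul, ← integral_const_mul,
      ← integral_add (i0.const_mul _) (i1.const_mul _)]
    refine integral_mono_ae ((i0.const_mul _).add (i1.const_mul _)) is ?_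
    filter_upwards [hadm.legendreHadamard] with x hx
    have h := hx (v x) (radialCoef (v x) (Dv x))
    rw [← radial_eq_tens] at h
    simp only [quad_expand]
    have h2 : 0 ≤ τ * (1 - τ) * t ^ 2 * formA (A x) (radial (v x) (Dv x)) (radial (v x) (Dv x)) :=
      mul_nonneg (mul_nonneg (mul_nonneg hτ0 (by linarith)) (sq_nonneg _)) h
    rw [hτt]
    linarith
  have k0 : (1 - τ) * (min c₀ c₁ * N) ≤ (1 - τ) * ∫ x in Ω, quad (A x) 0 (v x) (Dv x) := by
    refine mul_le_mul_of_nonneg_left (le_trans ?_ g0) (by linarith)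
    exact mul_le_mul_of_nonneg_right (min_le_left _ _) hN
  have k1 : τ * (min c₀ c₁ * N) ≤ τ * ∫ x in Ω, quad (A x) t (v x) (Dv x) := by
    refine mul_le_mul_of_nonneg_left (le_trans ?_ g1) hτ0
    exact mul_le_mul_of_nonneg_right (min_le_right _ _) hN
  linarith

/-- The ellipticity range is open at `2`. -/
theorem IsAdmissible.exists_gt_two (hadm : IsAdmissible Ω A B Λ K) :
    ∃ p : ℝ, 2 < p ∧ IntElliptic Ω A p := by
  obtain ⟨c, hc, h₀⟩ := hadm.elliptic
  set M : ℝ := 1 + (n * m) ^ 2 * Λ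
  have hM : 1 ≤ M := by simp only [M]; linarith [show (0 : ℝ) ≤ (n * m) ^ 2 * Λ by positivity]
  -- Passing from parameter 0 to t changes the form by at most 3Mt|ξ|², so t ≤ c/(6M) costs half of
  -- the constant. The bound 1/2 keeps p = 2/(1 - t) finite and gives t² ≤ t.
  set t := min (1 / 2) (c / (6 * M))
  have ht0 : 0 < t := lt_min (by norm_num) (by positivity)
  have ht1 : t ≤ 1 / 2 := min_le_left _ _
  have htc : 3 * M * t ≤ c / 2 := by
    have : t ≤ c / (6 * M) := min_le_right _ _
    rw [le_div_iff₀ (by positivity)] at this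
    linarith
  refine ⟨2 / (1 - t), ?_, c / 2, by positivity, ?_⟩
  · rw [lt_div_iff₀ (by linarith)]; linarith
  rw [hadm.intEllipticWith_iff] at *
  intro v Dv hv
  have e : 1 - 2 / (2 / (1 - t)) = t := by
    have : 1 - t ≠ 0 := by linarith
    field_simp; ring
  rw [e]
  have g0 := h₀ v Dv hv
  rw [div_self two_ne_zero, sub_self] at g0
  have hmv := hv.memLp.aestronglyMeasurable
  have i0 := hadm.integrable_quad 0 hmv hv.memLp_grad
  have i1 := hadm.integrable_quad t hmv hv.memLp_grad
  have iN : Integrable (fun x => ‖Dv x‖ ^ 2) (volume.restrict Ω) :=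
    hv.memLp_grad.integrable_norm_pow two_ne_zero
  have hle : (∫ x in Ω, quad (A x) 0 (v x) (Dv x)) - c / 2 * ∫ x in Ω, ‖Dv x‖ ^ 2 ≤
      ∫ x in Ω, quad (A x) t (v x) (Dv x) := by
    rw [← integral_const_mul, ← integral_sub i0 (iN.const_mul _)]
    refine integral_mono_ae (i0.sub (iN.const_mul _)) i1 ?_
    filter_upwards [hadm.ae_boundA] with x hx
    have hb : ∀ ξ ζ : Tens n m, ‖ξ‖ ≤ ‖Dv x‖ → ‖ζ‖ ≤ ‖Dv x‖ →
        |formA (A x) ξ ζ| ≤ M * ‖Dv x‖ ^ 2 := by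
      intro ξ ζ hξ hζ
      calc |formA (A x) ξ ζ| ≤ (n * m) ^ 2 * Λ * ‖ξ‖ * ‖ζ‖ := abs_formA_le hx _ _
        _ ≤ M * ‖Dv x‖ * ‖Dv x‖ := by
          gcongr
          simp only [M]; linarith
        _ = M * ‖Dv x‖ ^ 2 := by ring
    have hr := norm_radial_le (v x) (Dv x)
    have b1 := abs_le.1 (hb (Dv x) (radial (v x) (Dv x)) le_rfl hr)
    have b2 := abs_le.1 (hb (radial (v x) (Dv x)) (Dv x) hr le_rfl)
    have b3 := abs_le.1 (hb (radial (v x) (Dv x)) (radial (v x) (Dv x)) hr hr)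
    set N := ‖Dv x‖ ^ 2
    have hN : 0 ≤ N := sq_nonneg _
    simp only [quad_expand]
    set f₁ := formA (A x) (Dv x) (radial (v x) (Dv x))
    set f₂ := formA (A x) (radial (v x) (Dv x)) (Dv x)
    set f₃ := formA (A x) (radial (v x) (Dv x)) (radial (v x) (Dv x))
    have a1 : t * (-(2 * (M * N))) ≤ t * (f₁ - f₂) := by
      gcongr; linarith
    have a2 : t ^ 2 * f₃ ≤ t * (M * N) := by
      have : t ^ 2 ≤ t := by nlinarith
      calc t ^ 2 * f₃ ≤ t ^ 2 * (M * N) := by gcongr; exact b3.2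
        _ ≤ t * (M * N) := by gcongr
    have a3 : 3 * M * t * N ≤ c / 2 * N := by gcongr
    linarith
  linarith

end

section

/-! ### Slowly varying weights -/

theorem RadialWeight.bound_nonneg {g β : ℝ → ℝ} {M : ℝ} (h : RadialWeight g β M) : 0 ≤ M :=
  (abs_nonneg _).trans (h.abs_le 0 le_rfl)

/-- Logarithmic derivatives add. This is used for θφ, with exponent function α + a, and for φ², with
2a. -/
theorem RadialWeight.mul {g₁ g₂ β₁ β₂ : ℝ → ℝ} {M₁ M₂ : ℝ} (h₁ : RadialWeight g₁ β₁ M₁)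
    (h₂ : RadialWeight g₂ β₂ M₂) :
    RadialWeight (fun s => g₁ s * g₂ s) (fun s => β₁ s + β₂ s) (2 * (M₁ * M₂)) where
  hasDerivAt s hs := by
    refine ((h₁.hasDerivAt s hs).mul (h₂.hasDerivAt s hs)).congr_deriv ?_
    ring
  continuousOn := h₁.continuousOn.add h₂.continuousOn
  tendsto_zero := h₁.tendsto_zero.mul h₂.tendsto_zero
  tendsto_mul_zero := by
    have := (h₁.tendsto_mul_zero.mul h₂.tendsto_zero).add
      (h₁.tendsto_zero.mul h₂.tendsto_mul_zero)
    simp only [zero_mul, mul_zero, add_zero] at this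
    exact this.congr fun s => by ring
  abs_le s hs := by
    rw [abs_mul]
    have := mul_le_mul (h₁.abs_le s hs) (h₂.abs_le s hs) (abs_nonneg _) h₁.bound_nonneg
    have h0 : 0 ≤ M₁ * M₂ := mul_nonneg h₁.bound_nonneg h₂.bound_nonneg
    linarith
  abs_mul_le s hs := by
    have e : (β₁ s + β₂ s) * (g₁ s * g₂ s) = β₁ s * g₁ s * g₂ s + g₁ s * (β₂ s * g₂ s) := by ring
    rw [e]
    refine (abs_add_le _ _).trans ?_
    rw [abs_mul _ (g₂ s), abs_mul (g₁ s)]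
    have a1 := mul_le_mul (h₁.abs_mul_le s hs) (h₂.abs_le s hs.le) (abs_nonneg _) h₁.bound_nonneg
    have a2 := mul_le_mul (h₁.abs_le s hs.le) (h₂.abs_mul_le s hs) (abs_nonneg _) h₁.bound_nonneg
    linarith

theorem RadialWeight.const_mul {g β : ℝ → ℝ} {M : ℝ} (h : RadialWeight g β M) (C : ℝ) :
    RadialWeight (fun s => C * g s) β (|C| * M) where
  hasDerivAt s hs := ((h.hasDerivAt s hs).const_mul C).congr_deriv (by ring)
  continuousOn := h.continuousOn
  tendsto_zero := h.tendsto_zero.const_mul C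
  tendsto_mul_zero := by
    have := h.tendsto_mul_zero.const_mul C
    rw [mul_zero] at this
    exact this.congr fun s => by ring
  abs_le s hs := by
    rw [abs_mul]; exact mul_le_mul_of_nonneg_left (h.abs_le s hs) (abs_nonneg _)
  abs_mul_le s hs := by
    rw [show β s * (C * g s) = C * (β s * g s) by ring, abs_mul]
    exact mul_le_mul_of_nonneg_left (h.abs_mul_le s hs) (abs_nonneg _)

/-- The weight `(s^e / (k + s^e))^c`, increasing from `0` to `1`. -/
def upWeight (k c e s : ℝ) : ℝ := (s ^ e / (k + s ^ e)) ^ c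

/-- The weight `(k / (k + s^e))^c`, decreasing from `1` to `0`. -/
def downWeight (k c e s : ℝ) : ℝ := (k / (k + s ^ e)) ^ c

section

variable {k c e : ℝ}

theorem add_rpow_pos (hk : 0 < k) {s : ℝ} (hs : 0 ≤ s) : 0 < k + s ^ e :=
  add_pos_of_pos_of_nonneg hk (Real.rpow_nonneg hs e)

theorem upWeight_pos (hk : 0 < k) {s : ℝ} (hs : 0 < s) : 0 < upWeight k c e s :=
  Real.rpow_pos_of_pos (div_pos (Real.rpow_pos_of_pos hs e) (add_rpow_pos hk hs.le)) c

theorem downWeight_pos (hk : 0 < k) {s : ℝ} (hs : 0 ≤ s) : 0 < downWeight k c e s :=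
  Real.rpow_pos_of_pos (div_pos hk (add_rpow_pos hk hs)) c

theorem upWeight_mem (hk : 0 < k) (hc : 0 ≤ c) {s : ℝ} (hs : 0 ≤ s) :
    0 ≤ upWeight k c e s ∧ upWeight k c e s ≤ 1 := by
  have h1 := add_rpow_pos (e := e) hk hs
  have h2 : 0 ≤ s ^ e / (k + s ^ e) := div_nonneg (Real.rpow_nonneg hs e) h1.le
  exact ⟨Real.rpow_nonneg h2 c, Real.rpow_le_one h2 ((div_le_one h1).2 (by linarith)) hc⟩

theorem downWeight_le (hk : 0 < k) (hc : 0 ≤ c) {s : ℝ} (hs : 0 ≤ s) :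
    downWeight k c e s ≤ 1 := by
  have h1 := add_rpow_pos (e := e) hk hs
  have h2 : 0 ≤ s ^ e := Real.rpow_nonneg hs e
  exact Real.rpow_le_one (div_nonneg hk.le h1.le) ((div_le_one h1).2 (by linarith)) hc

theorem continuousAt_add_rpow_div (hk : 0 < k) (he : 0 < e) {f : ℝ → ℝ} (hf : Continuous f) :
    ContinuousAt (fun s : ℝ => f s / (k + s ^ e)) 0 := by
  have h1 : Continuous fun s : ℝ => s ^ e := Real.continuous_rpow_const he.le
  exact hf.continuousAt.div (continuous_const.add h1).continuousAt
    (add_rpow_pos hk le_rfl).ne'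

theorem continuousOn_add_rpow_div (hk : 0 < k) (he : 0 < e) {f : ℝ → ℝ} (hf : Continuous f) :
    ContinuousOn (fun s : ℝ => f s / (k + s ^ e)) (Set.Ioi 0) := by
  have h1 : Continuous fun s : ℝ => s ^ e := Real.continuous_rpow_const he.le
  exact hf.continuousOn.div (continuous_const.add h1).continuousOn
    fun s hs => (add_rpow_pos hk (le_of_lt hs)).ne'

theorem radialWeight_upWeight (hk : 0 < k) (hc : 0 ≤ c) (he : 0 < e) :
    RadialWeight (upWeight k c e) (fun s => c * e * k / (k + s ^ e)) (1 + c * e) := by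
  have hce : 0 ≤ c * e := by positivity
  have hpow : Continuous fun s : ℝ => s ^ e := Real.continuous_rpow_const he.le
  have hc0 : ContinuousAt (upWeight k c e) 0 :=
    ContinuousAt.rpow_const (continuousAt_add_rpow_div hk he hpow) (Or.inr hc)
  have hβ : ∀ s : ℝ, 0 < s → 0 ≤ c * e * k / (k + s ^ e) ∧ c * e * k / (k + s ^ e) ≤ c * e := by
    intro s hs
    have h1 := add_rpow_pos (e := e) hk hs.le
    refine ⟨by positivity, ?_⟩
    rw [div_le_iff₀ h1]
    have := Real.rpow_nonneg hs.le e
    gcongr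
    linarith
  refine ⟨fun s hs => ?_, continuousOn_add_rpow_div hk he continuous_const,
    hc0.tendsto.mono_left nhdsWithin_le_nhds, ?_, fun s hs => ?_, fun s hs => ?_⟩
  · have h1 := add_rpow_pos (e := e) hk hs.le
    have hse : 0 < s ^ e := Real.rpow_pos_of_pos hs e
    have d1 : HasDerivAt (fun s : ℝ => s ^ e) (e * s ^ (e - 1)) s :=
      Real.hasDerivAt_rpow_const (Or.inl hs.ne')
    have d2 := d1.fun_div (d1.const_add k) h1.ne'
    have hx : 0 < s ^ e / (k + s ^ e) := by positivity
    have d3 := d2.rpow_const (p := c) (Or.inl hx.ne')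
    refine d3.congr_deriv ?_
    rw [Real.rpow_sub_one hx.ne', Real.rpow_sub_one hs.ne', upWeight]
    field_simp
    ring
  · have h0 : c * e * k / (k + 0 ^ e) * upWeight k c e 0 = 0 := by
      rcases hc.eq_or_lt with rfl | hc
      · simp
      · simp [upWeight, Real.zero_rpow he.ne', Real.zero_rpow hc.ne']
    have h1 := (continuousAt_add_rpow_div hk he (f := fun _ => c * e * k) continuous_const).fun_mul hc0
    have h2 := h1.tendsto
    rw [h0] at h2
    exact h2.mono_left nhdsWithin_le_nhds
  · have h := upWeight_mem (e := e) hk hc hs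
    rw [abs_of_nonneg h.1]; linarith
  · have h := upWeight_mem (e := e) hk hc hs.le
    have hb := hβ s hs
    rw [abs_of_nonneg (mul_nonneg hb.1 h.1)]
    have := mul_le_mul hb.2 h.2 h.1 hce
    linarith

theorem radialWeight_downWeight (hk : 0 < k) (hc : 0 ≤ c) (he : 0 < e) :
    RadialWeight (downWeight k c e) (fun s => -(c * e * s ^ e) / (k + s ^ e)) (1 + c * e) := by
  have hce : 0 ≤ c * e := by positivity
  have hpow : Continuous fun s : ℝ => s ^ e := Real.continuous_rpow_const he.le
  have hc0 : ContinuousAt (downWeight k c e) 0 :=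
    ContinuousAt.rpow_const (continuousAt_add_rpow_div hk he continuous_const) (Or.inr hc)
  have hf : Continuous fun s : ℝ => -(c * e * s ^ e) := (continuous_const.mul hpow).neg
  refine ⟨fun s hs => ?_, continuousOn_add_rpow_div hk he hf,
    hc0.tendsto.mono_left nhdsWithin_le_nhds, ?_, fun s hs => ?_, fun s hs => ?_⟩
  · have h1 := add_rpow_pos (e := e) hk hs.le
    have hse : 0 < s ^ e := Real.rpow_pos_of_pos hs e
    have d1 : HasDerivAt (fun s : ℝ => s ^ e) (e * s ^ (e - 1)) s :=
      Real.hasDerivAt_rpow_const (Or.inl hs.ne')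
    have d2 := (hasDerivAt_const s k).fun_div (d1.const_add k) h1.ne'
    have hx : 0 < k / (k + s ^ e) := by positivity
    have d3 := d2.rpow_const (p := c) (Or.inl hx.ne')
    refine d3.congr_deriv ?_
    rw [Real.rpow_sub_one hx.ne', Real.rpow_sub_one hs.ne', downWeight]
    field_simp
    ring
  · have h1 := (continuousAt_add_rpow_div hk he hf).fun_mul hc0
    have h2 := h1.tendsto
    rw [Real.zero_rpow he.ne', mul_zero, neg_zero, zero_div, zero_mul] at h2
    exact h2.mono_left nhdsWithin_le_nhds
  · have h := downWeight_pos (c := c) (e := e) hk hs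
    rw [abs_of_nonneg h.le]; linarith [downWeight_le (e := e) hk hc hs]
  · have h := downWeight_pos (c := c) (e := e) hk hs.le
    have h' := downWeight_le (e := e) hk hc hs.le
    have h1 := add_rpow_pos (e := e) hk hs.le
    have hse := Real.rpow_nonneg hs.le e
    have hb : c * e * s ^ e / (k + s ^ e) ≤ c * e := by
      rw [div_le_iff₀ h1]
      gcongr
      linarith
    have hb0 : 0 ≤ c * e * s ^ e / (k + s ^ e) := by positivity
    rw [neg_div, neg_mul, abs_neg, abs_of_nonneg (mul_nonneg hb0 h.le)]
    have := mul_le_mul hb h' h.le hce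
    linarith

theorem upWeight_half_sq (hk : 0 < k) {s : ℝ} (hs : 0 ≤ s) :
    upWeight k (1 / 2) e s ^ 2 = s ^ e / (k + s ^ e) := by
  have h : 0 ≤ s ^ e / (k + s ^ e) :=
    div_nonneg (Real.rpow_nonneg hs e) (add_rpow_pos hk hs).le
  rw [upWeight, ← Real.sqrt_eq_rpow, Real.sq_sqrt h]

theorem downWeight_half_sq (hk : 0 < k) {s : ℝ} (hs : 0 ≤ s) :
    downWeight k (1 / 2) e s ^ 2 = k / (k + s ^ e) := by
  have h : 0 ≤ k / (k + s ^ e) := div_nonneg hk.le (add_rpow_pos hk hs).le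
  rw [downWeight, ← Real.sqrt_eq_rpow, Real.sq_sqrt h]

end

/-- Weights for the energy estimate at the exponent `p`: `φ` is a truncation of `s^(p/2 - 1)` with
logarithmic derivative `a`, and `θ₀² + θ₁² = 1` is a slowly varying partition adapted to it. -/
structure EnergyWeights (p ε M : ℝ) (φ a θ₀ α₀ θ₁ α₁ : ℝ → ℝ) : Prop where
  weight : RadialWeight φ a M
  weight₀ : RadialWeight θ₀ α₀ M
  weight₁ : RadialWeight θ₁ α₁ M
  pos : ∀ s, 0 < s → 0 < φ s ∧ 0 < θ₀ s ∧ 0 < θ₁ s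
  nonneg : 0 ≤ φ 0
  sq_add_sq : ∀ s, 0 ≤ s → θ₀ s ^ 2 + θ₁ s ^ 2 = 1
  rel : ∀ s, 0 ≤ s → a s * (1 - (1 - 2 / p) * θ₁ s ^ 2) = (1 - 2 / p) * θ₁ s ^ 2
  abs_le₀ : ∀ s, 0 ≤ s → |α₀ s| ≤ ε / 2
  abs_le₁ : ∀ s, 0 ≤ s → |α₁ s| ≤ ε / 2
  mul_le : ∀ s, 0 ≤ s → φ s * s ≤ s ^ (p / 2)

theorem RadialWeight.mono {g β : ℝ → ℝ} {M M' : ℝ} (h : RadialWeight g β M) (hM : M ≤ M') :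
    RadialWeight g β M' :=
  ⟨h.hasDerivAt, h.continuousOn, h.tendsto_zero, h.tendsto_mul_zero,
    fun s hs => (h.abs_le s hs).trans hM, fun s hs => (h.abs_mul_le s hs).trans hM⟩

theorem upWeight_alpha {k e s : ℝ} (hk : 0 < k) (he : 0 < e) (hs : 0 ≤ s) :
    |1 / 2 * e * k / (k + s ^ e)| ≤ e / 2 := by
  have h1 := add_rpow_pos (e := e) hk hs
  have h2 := Real.rpow_nonneg hs e
  rw [abs_of_nonneg (by positivity), div_le_iff₀ h1]
  nlinarith [mul_nonneg he.le h2]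

theorem downWeight_alpha {k e s : ℝ} (hk : 0 < k) (he : 0 < e) (hs : 0 ≤ s) :
    |-(1 / 2 * e * s ^ e) / (k + s ^ e)| ≤ e / 2 := by
  have h1 := add_rpow_pos (e := e) hk hs
  have h2 := Real.rpow_nonneg hs e
  rw [neg_div, abs_neg, abs_of_nonneg (by positivity), div_le_iff₀ h1]
  nlinarith [mul_nonneg he.le h2]

/-- Energy weights for `p ≥ 2`: truncation at large values. -/
theorem energyWeights_of_two_le {p ε L : ℝ} (hp : 2 ≤ p) (hε : 0 < ε) (hL : 0 < L) :
    ∃ M, EnergyWeights p ε M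
      (fun s => (2 * L / p) ^ ((p / 2 - 1) / ε) * upWeight (2 * L / p) ((p / 2 - 1) / ε) ε s)
      (fun s => (p / 2 - 1) / ε * ε * (2 * L / p) / (2 * L / p + s ^ ε))
      (upWeight L (1 / 2) ε) (fun s => 1 / 2 * ε * L / (L + s ^ ε))
      (downWeight L (1 / 2) ε) (fun s => -(1 / 2 * ε * s ^ ε) / (L + s ^ ε)) := by
  have hp0 : 0 < p := by linarith
  -- Forced by the relation between a and θ₁: with θ₁² = L/(L + s^ε), solving for a gives a = (p/2 -
  -- 1)k/(k + s^ε) with k = 2L/p. Integrating a/s yields φ = (k s^ε/(k + s^ε))^{(p/2-1)/ε}, which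
  -- behaves like s^{p/2-1} for small s and is bounded for large s.
  set k := 2 * L / p with hk'
  have hk : 0 < k := by positivity
  set b := p / 2 - 1 with hb'
  have hb : 0 ≤ b := by linarith
  have hc : 0 ≤ b / ε := by positivity
  have w := (radialWeight_upWeight hk hc hε).const_mul (k ^ (b / ε))
  have w₀ := radialWeight_upWeight hL (by norm_num : (0 : ℝ) ≤ 1 / 2) hε
  have w₁ := radialWeight_downWeight hL (by norm_num : (0 : ℝ) ≤ 1 / 2) hε
  have hkc : 0 < k ^ (b / ε) := Real.rpow_pos_of_pos hk _
  refine ⟨max (|k ^ (b / ε)| * (1 + b / ε * ε)) (1 + 1 / 2 * ε), w.mono (le_max_left _ _),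
    w₀.mono (le_max_right _ _), w₁.mono (le_max_right _ _),
    fun s hs => ⟨mul_pos hkc (upWeight_pos hk hs), upWeight_pos hL hs, downWeight_pos hL hs.le⟩,
    mul_nonneg hkc.le (upWeight_mem hk hc le_rfl).1, fun s hs => ?_, fun s hs => ?_,
    fun s hs => upWeight_alpha hL hε hs, fun s hs => downWeight_alpha hL hε hs, fun s hs => ?_⟩
  · rw [upWeight_half_sq hL hs, downWeight_half_sq hL hs]
    have := add_rpow_pos (e := ε) hL hs
    field_simp
    ring
  · rw [downWeight_half_sq hL hs]
    have h1 := add_rpow_pos (e := ε) hL hs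
    have h2 := add_rpow_pos (e := ε) hk hs
    have h3 : 2 * L + p * s ^ ε ≠ 0 := by
      have := Real.rpow_nonneg hs ε
      positivity
    have e1 : k + s ^ ε = (2 * L + p * s ^ ε) / p := by
      simp only [hk']; field_simp
    rw [e1]
    simp only [hk', hb']
    field_simp
    ring
  · have h2 := add_rpow_pos (e := ε) hk hs
    have h3 := Real.rpow_nonneg hs ε
    have e1 : k ^ (b / ε) * upWeight k (b / ε) ε s = (k * s ^ ε / (k + s ^ ε)) ^ (b / ε) := by
      rw [upWeight, ← Real.mul_rpow hk.le (by positivity), mul_div_assoc]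
    have e2 : (k * s ^ ε / (k + s ^ ε)) ^ (b / ε) ≤ s ^ b := by
      calc (k * s ^ ε / (k + s ^ ε)) ^ (b / ε) ≤ (s ^ ε) ^ (b / ε) := by
            refine Real.rpow_le_rpow (by positivity) ?_ hc
            rw [div_le_iff₀ h2]
            nlinarith
        _ = s ^ b := by
            rw [← Real.rpow_mul hs]; congr 1; field_simp
    calc _ = (k * s ^ ε / (k + s ^ ε)) ^ (b / ε) * s := by rw [e1]
      _ ≤ s ^ b * s := by gcongr
      _ = s ^ (p / 2) := by
        rw [show p / 2 = b + 1 by simp only [hb']; ring, Real.rpow_add' hs (by linarith),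
          Real.rpow_one]

/-- Energy weights for `p < 2`: truncation at small values. -/
theorem energyWeights_of_lt_two {p ε L : ℝ} (hp1 : 1 < p) (hp : p < 2) (hε : 0 < ε)
    (hL : 0 < L) :
    ∃ M, EnergyWeights p ε M
      (fun s => (p * L / 2) ^ (-((1 - p / 2) / ε)) * downWeight (p * L / 2) ((1 - p / 2) / ε) ε s)
      (fun s => -((1 - p / 2) / ε * ε * s ^ ε) / (p * L / 2 + s ^ ε))
      (downWeight L (1 / 2) ε) (fun s => -(1 / 2 * ε * s ^ ε) / (L + s ^ ε))
      (upWeight L (1 / 2) ε) (fun s => 1 / 2 * ε * L / (L + s ^ ε)) := by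
  have hp0 : 0 < p := by linarith
  -- With the roles of small and large values exchanged, θ₁² = s^ε/(L + s^ε), the same relation
  -- gives k = pL/2 and φ = (k + s^ε)^{-(1-p/2)/ε}. The singularity of s^{p/2-1} at 0 is thereby
  -- removed.
  set k := p * L / 2 with hk'
  have hk : 0 < k := by positivity
  set b := 1 - p / 2 with hb'
  have hb : 0 < b := by simp only [hb']; linarith
  have hc : 0 ≤ b / ε := by positivity
  have w := (radialWeight_downWeight hk hc hε).const_mul (k ^ (-(b / ε)))
  have w₁ := radialWeight_upWeight hL (by norm_num : (0 : ℝ) ≤ 1 / 2) hε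
  have w₀ := radialWeight_downWeight hL (by norm_num : (0 : ℝ) ≤ 1 / 2) hε
  have hkc : 0 < k ^ (-(b / ε)) := Real.rpow_pos_of_pos hk _
  refine ⟨max (|k ^ (-(b / ε))| * (1 + b / ε * ε)) (1 + 1 / 2 * ε), w.mono (le_max_left _ _),
    w₀.mono (le_max_right _ _), w₁.mono (le_max_right _ _),
    fun s hs => ⟨mul_pos hkc (downWeight_pos hk hs.le), downWeight_pos hL hs.le,
      upWeight_pos hL hs⟩,
    mul_nonneg hkc.le (downWeight_pos hk le_rfl).le, fun s hs => ?_, fun s hs => ?_,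
    fun s hs => downWeight_alpha hL hε hs, fun s hs => upWeight_alpha hL hε hs, fun s hs => ?_⟩
  · rw [upWeight_half_sq hL hs, downWeight_half_sq hL hs]
    have := add_rpow_pos (e := ε) hL hs
    field_simp
  · rw [upWeight_half_sq hL hs]
    have h1 := add_rpow_pos (e := ε) hL hs
    have h2 := add_rpow_pos (e := ε) hk hs
    have h3 : p * L + 2 * s ^ ε ≠ 0 := by
      have := Real.rpow_nonneg hs ε
      positivity
    have e1 : k + s ^ ε = (p * L + 2 * s ^ ε) / 2 := by
      simp only [hk']; ring
    rw [e1]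
    simp only [hb']
    field_simp
    ring
  · have h2 := add_rpow_pos (e := ε) hk hs
    rcases hs.eq_or_lt with rfl | hs
    · rw [mul_zero, Real.zero_rpow (by positivity)]
    have h3 := Real.rpow_pos_of_pos hs ε
    have e1 : k ^ (-(b / ε)) * downWeight k (b / ε) ε s = (k + s ^ ε) ^ (-(b / ε)) := by
      rw [downWeight, Real.div_rpow hk.le h2.le, Real.rpow_neg hk.le, Real.rpow_neg h2.le]
      have := (Real.rpow_pos_of_pos hk (b / ε)).ne'
      field_simp
    have e2 : (k + s ^ ε) ^ (-(b / ε)) ≤ s ^ (-b) := by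
      calc (k + s ^ ε) ^ (-(b / ε)) ≤ (s ^ ε) ^ (-(b / ε)) := by
            exact Real.rpow_le_rpow_of_nonpos h3 (by linarith) (by linarith)
        _ = s ^ (-b) := by
            rw [← Real.rpow_mul hs.le]; congr 1; field_simp
    calc _ = (k + s ^ ε) ^ (-(b / ε)) * s := by rw [e1]
      _ ≤ s ^ (-b) * s := by gcongr
      _ = s ^ (p / 2) := by
        rw [show p / 2 = -b + 1 by simp only [hb']; ring, Real.rpow_add_one hs.ne']

end

/-! ### Sequences of weights exhausting the power s^{p/2-1} -/

theorem tendsto_const_div_add_atTop (x C : ℝ) (hC : 0 < C) :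
    Tendsto (fun j : ℕ => C * (j + 1 : ℝ) / (C * (j + 1 : ℝ) + x)) atTop (𝓝 1) := by
  have h1 : Tendsto (fun j : ℕ => C * (j + 1 : ℝ)) atTop atTop :=
    Tendsto.const_mul_atTop hC (tendsto_atTop_add_const_right _ _ tendsto_natCast_atTop_atTop)
  have h2 : Tendsto (fun k : ℝ => k / (k + x)) atTop (𝓝 1) := by
    have h3 : Tendsto (fun k : ℝ => 1 - x / (k + x)) atTop (𝓝 (1 - 0)) :=
      tendsto_const_nhds.sub
        (tendsto_const_nhds.div_atTop (tendsto_atTop_add_const_right _ _ tendsto_id))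
    rw [sub_zero] at h3
    refine h3.congr' ?_
    filter_upwards [eventually_gt_atTop (-x)] with k hk
    have : k + x ≠ 0 := by linarith
    field_simp
    ring
  exact h2.comp h1

theorem tendsto_ofReal_weight {p l₀ l₁ s : ℝ} (hs : 0 ≤ s) (hsp : 2 ≤ p ∨ 0 < s)
    {φ θ₀ θ₁ : ℕ → ℝ} (hφ : Tendsto φ atTop (𝓝 (s ^ (p / 2 - 1))))
    (h₀ : Tendsto (fun j => θ₀ j ^ 2) atTop (𝓝 0))
    (h₁ : Tendsto (fun j => θ₁ j ^ 2) atTop (𝓝 1)) :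
    Tendsto (fun j => ENNReal.ofReal (θ₀ j ^ 2 * l₀ + θ₁ j ^ 2 * l₁) * ENNReal.ofReal (φ j) ^ 2)
      atTop (𝓝 (ENNReal.ofReal l₁ * ENNReal.ofReal s ^ (p - 2))) := by
  have hc : Tendsto (fun j => θ₀ j ^ 2 * l₀ + θ₁ j ^ 2 * l₁) atTop (𝓝 l₁) := by
    simpa using (h₀.mul_const l₀).add (h₁.mul_const l₁)
  have e : ENNReal.ofReal s ^ (p - 2) = ENNReal.ofReal (s ^ (p / 2 - 1)) ^ 2 := by
    have h1 : ENNReal.ofReal (s ^ (p / 2 - 1)) = ENNReal.ofReal s ^ (p / 2 - 1) := by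
      rcases hsp with h | h
      · exact (ENNReal.ofReal_rpow_of_nonneg hs (by linarith)).symm
      · exact (ENNReal.ofReal_rpow_of_pos h).symm
    rw [h1, ← ENNReal.rpow_natCast, ← ENNReal.rpow_mul]
    congr 1
    push_cast
    ring
  rw [e]
  exact ENNReal.Tendsto.mul (ENNReal.tendsto_ofReal hc) (Or.inr (by finiteness))
    (ENNReal.Tendsto.pow (ENNReal.tendsto_ofReal hφ)) (Or.inr (by finiteness))

/-- A sequence of energy weights that exhausts the weight `s^(p/2 - 1)`. -/
structure EnergyWeightsSeq (p ε : ℝ) (M : ℕ → ℝ) (φ a θ₀ α₀ θ₁ α₁ : ℕ → ℝ → ℝ) : Prop where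
  weights : ∀ j, EnergyWeights p ε (M j) (φ j) (a j) (θ₀ j) (α₀ j) (θ₁ j) (α₁ j)
  tendsto_mul : ∀ s, 0 ≤ s → Tendsto (fun j => φ j s * s) atTop (𝓝 (s ^ (p / 2)))
  tendsto_one : ∀ s, 0 < s → Tendsto (fun j => θ₁ j s) atTop (𝓝 1)
  tendsto_coef : ∀ l₀ l₁ s : ℝ, 0 < l₀ → 0 < l₁ → 0 ≤ s →
    Tendsto (fun j => ENNReal.ofReal (θ₀ j s ^ 2 * l₀ + θ₁ j s ^ 2 * l₁) *
      ENNReal.ofReal (φ j s) ^ 2) atTop (𝓝 (ENNReal.ofReal l₁ * ENNReal.ofReal s ^ (p - 2)))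

theorem tendsto_of_sq_tendsto_one {f : ℕ → ℝ} (hf : ∀ j, 0 ≤ f j)
    (h : Tendsto (fun j => f j ^ 2) atTop (𝓝 1)) : Tendsto f atTop (𝓝 1) := by
  have := h.sqrt
  rw [Real.sqrt_one] at this
  exact this.congr fun j => Real.sqrt_sq (hf j)

/-- The truncation parameter is L = j + 1. As L tends to infinity with ε fixed, θ₁² = L/(L + s^ε)
tends to 1 and φ to the full power. -/
theorem exists_energyWeightsSeq_of_two_le {p ε : ℝ} (hp : 2 ≤ p) (hε : 0 < ε) :
    ∃ M φ a θ₀ α₀ θ₁ α₁, EnergyWeightsSeq p ε M φ a θ₀ α₀ θ₁ α₁ := by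
  have hp0 : 0 < p := by linarith
  have hL : ∀ j : ℕ, (0 : ℝ) < j + 1 := fun j => by positivity
  choose M hM using fun j : ℕ => energyWeights_of_two_le hp hε (hL j)
  have hb : 0 ≤ p / 2 - 1 := by linarith
  have hφ : ∀ s : ℝ, 0 ≤ s → Tendsto (fun j : ℕ => (2 * (j + 1 : ℝ) / p) ^ ((p / 2 - 1) / ε) *
      upWeight (2 * (j + 1 : ℝ) / p) ((p / 2 - 1) / ε) ε s) atTop (𝓝 (s ^ (p / 2 - 1))) := by
    intro s hs
    have h1 := (tendsto_const_div_add_atTop (s ^ ε) (2 / p) (by positivity)).mul_const (s ^ ε)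
    have h2 := h1.rpow_const (p := (p / 2 - 1) / ε) (Or.inr (by positivity))
    rw [one_mul, ← Real.rpow_mul hs, mul_div_cancel₀ _ hε.ne'] at h2
    refine h2.congr fun j => ?_
    have hk : 0 < 2 * (j + 1 : ℝ) / p := by positivity
    have h3 := add_rpow_pos (e := ε) hk hs
    have h4 := Real.rpow_nonneg hs ε
    rw [upWeight, ← Real.mul_rpow hk.le (by positivity)]
    congr 1
    rw [show 2 / p * (j + 1 : ℝ) = 2 * (j + 1) / p by ring]
    ring
  have h₁ : ∀ s : ℝ, 0 ≤ s →
      Tendsto (fun j : ℕ => downWeight (j + 1) (1 / 2) ε s ^ 2) atTop (𝓝 1) := by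
    intro s hs
    refine (tendsto_const_div_add_atTop (s ^ ε) 1 one_pos).congr fun j => ?_
    rw [downWeight_half_sq (hL j) hs, one_mul]
  have h₀ : ∀ s : ℝ, 0 ≤ s →
      Tendsto (fun j : ℕ => upWeight (j + 1) (1 / 2) ε s ^ 2) atTop (𝓝 0) := by
    intro s hs
    have := (h₁ s hs).const_sub 1
    rw [sub_self] at this
    exact this.congr fun j => by linarith [(hM j).sq_add_sq s hs]
  refine ⟨M, _, _, _, _, _, _, ⟨hM, fun s hs => ?_, fun s hs => ?_, fun l₀ l₁ s _ _ hs => ?_⟩⟩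
  · have := (hφ s hs).mul_const s
    rwa [← Real.rpow_add_one' hs (by linarith), sub_add_cancel] at this
  · exact tendsto_of_sq_tendsto_one (fun j => (downWeight_pos (hL j) hs.le).le) (h₁ s hs.le)
  · exact tendsto_ofReal_weight hs (Or.inl hp) (hφ s hs) (h₀ s hs) (h₁ s hs)

/-- The truncation parameter is L = 1/(j + 1). As it tends to 0, θ₁ tends to 1 for each s > 0, but
θ₁(0) = 0 throughout, so the value s = 0 needs separate care. -/
theorem exists_energyWeightsSeq_of_lt_two {p ε : ℝ} (hp1 : 1 < p) (hp : p < 2) (hε : 0 < ε) :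
    ∃ M φ a θ₀ α₀ θ₁ α₁, EnergyWeightsSeq p ε M φ a θ₀ α₀ θ₁ α₁ := by
  have hp0 : 0 < p := by linarith
  have hL : ∀ j : ℕ, (0 : ℝ) < 1 / (j + 1) := fun j => by positivity
  have hL0 : Tendsto (fun j : ℕ => 1 / (j + 1 : ℝ)) atTop (𝓝 0) :=
    tendsto_one_div_add_atTop_nhds_zero_nat
  choose M hM using fun j : ℕ => energyWeights_of_lt_two hp1 hp hε (hL j)
  have hb : 0 < 1 - p / 2 := by linarith
  have hc : 0 < (1 - p / 2) / ε := by positivity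
  have hk : ∀ j : ℕ, 0 < p * (1 / (j + 1 : ℝ)) / 2 := fun j => by positivity
  have hk0 : Tendsto (fun j : ℕ => p * (1 / (j + 1 : ℝ)) / 2) atTop (𝓝 0) := by
    simpa using (hL0.const_mul p).div_const 2
  have hφ : ∀ s : ℝ, 0 < s → Tendsto (fun j : ℕ =>
      (p * (1 / (j + 1 : ℝ)) / 2) ^ (-((1 - p / 2) / ε)) *
      downWeight (p * (1 / (j + 1 : ℝ)) / 2) ((1 - p / 2) / ε) ε s) atTop
      (𝓝 (s ^ (p / 2 - 1))) := by
    intro s hs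
    have hse := Real.rpow_pos_of_pos hs ε
    have h1 := hk0.add_const (s ^ ε)
    rw [zero_add] at h1
    have h2 := h1.rpow_const (p := -((1 - p / 2) / ε)) (Or.inl hse.ne')
    rw [← Real.rpow_mul hs.le, show ε * -((1 - p / 2) / ε) = p / 2 - 1 by field_simp; ring] at h2
    refine h2.congr fun j => ?_
    have h2 := add_rpow_pos (e := ε) (hk j) hs.le
    rw [downWeight, Real.div_rpow (hk j).le h2.le, Real.rpow_neg (hk j).le, Real.rpow_neg h2.le]
    have := (Real.rpow_pos_of_pos (hk j) ((1 - p / 2) / ε)).ne'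
    field_simp
  have h₀ : ∀ s : ℝ, 0 < s →
      Tendsto (fun j : ℕ => downWeight (1 / (j + 1)) (1 / 2) ε s ^ 2) atTop (𝓝 0) := by
    intro s hs
    have hse := Real.rpow_pos_of_pos hs ε
    have h1 := hL0.add_const (s ^ ε)
    rw [zero_add] at h1
    have h2 := hL0.div h1 hse.ne'
    rw [zero_div] at h2
    exact h2.congr fun j => (downWeight_half_sq (hL j) hs.le).symm
  have h₁ : ∀ s : ℝ, 0 < s →
      Tendsto (fun j : ℕ => upWeight (1 / (j + 1)) (1 / 2) ε s ^ 2) atTop (𝓝 1) := by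
    intro s hs
    have := (h₀ s hs).const_sub 1
    rw [sub_zero] at this
    exact this.congr fun j => by linarith [(hM j).sq_add_sq s hs.le]
  refine ⟨M, _, _, _, _, _, _, ⟨hM, fun s hs => ?_, fun s hs => ?_, fun l₀ l₁ s hl₀ hl₁ hs => ?_⟩⟩
  · rcases hs.eq_or_lt with rfl | hs
    · have h2 : p / 2 ≠ 0 := by positivity
      simp [Real.zero_rpow h2]
    have := (hφ s hs).mul_const s
    rwa [← Real.rpow_add_one hs.ne', sub_add_cancel] at this
  · exact tendsto_of_sq_tendsto_one (fun j => (upWeight_pos (hL j) hs).le) (h₁ s hs)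
  · rcases hs.eq_or_lt with rfl | hs
    -- At s = 0 the limit is ∞. There θ₀ = 1 and θ₁ = 0, so the coefficient stays equal to l₀ > 0,
    -- while φ(0) = k^{-(1-p/2)/ε} blows up as k tends to 0.
    · rw [ENNReal.ofReal_zero, ENNReal.zero_rpow_of_neg (by linarith),
        ENNReal.mul_top (by simpa using hl₁)]
      have h1 : Tendsto (fun j : ℕ => ((p * (1 / (j + 1 : ℝ)) / 2) ^ ((1 - p / 2) / ε))⁻¹)
          atTop atTop := by
        refine Tendsto.inv_tendsto_nhdsGT_zero (tendsto_nhdsWithin_iff.2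
          ⟨?_, Eventually.of_forall fun j => Real.rpow_pos_of_pos (hk j) _⟩)
        have := hk0.rpow_const (p := (1 - p / 2) / ε) (Or.inr hc.le)
        rwa [Real.zero_rpow hc.ne'] at this
      have h2 : Tendsto (fun j : ℕ => ENNReal.ofReal l₀ *
          ENNReal.ofReal (((p * (1 / (j + 1 : ℝ)) / 2) ^ ((1 - p / 2) / ε))⁻¹) ^ 2)
          atTop (𝓝 (ENNReal.ofReal l₀ * (⊤ : ℝ≥0∞) ^ 2)) :=
        ENNReal.Tendsto.const_mul (ENNReal.Tendsto.pow
          (ENNReal.tendsto_ofReal_nhds_top.2 h1)) (Or.inr (by finiteness))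
      rw [ENNReal.top_pow two_ne_zero, ENNReal.mul_top (by simpa using hl₀)] at h2
      refine h2.congr fun j => ?_
      rw [downWeight_half_sq (hL j) le_rfl, upWeight_half_sq (hL j) le_rfl,
        Real.zero_rpow hε.ne', zero_div, zero_mul, add_zero, add_zero, div_self (hL j).ne',
        one_mul, downWeight, Real.zero_rpow hε.ne', add_zero, div_self (hk j).ne', Real.one_rpow,
        mul_one, Real.rpow_neg (hk j).le]
    · exact tendsto_ofReal_weight hs.le (Or.inr hs) (hφ s hs) (h₀ s hs) (h₁ s hs)

theorem exists_energyWeightsSeq {p ε : ℝ} (hp : 1 < p) (hε : 0 < ε) :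
    ∃ M φ a θ₀ α₀ θ₁ α₁, EnergyWeightsSeq p ε M φ a θ₀ α₀ θ₁ α₁ := by
  rcases le_or_gt 2 p with h | h
  · exact exists_energyWeightsSeq_of_two_le h hε
  · exact exists_energyWeightsSeq_of_lt_two hp h hε

section

/-! ### The energy estimate -/

variable {Ω : Set (Pt n)} {A : Pt n → Coef2 n m} {B : Pt n → Coef1 n m} {Λ K : ℝ≥0}
  {u : Pt n → Vec m} {Du : Pt n → Tens n m}

theorem IsWeakSolution.weak_eq_re (hadm : IsAdmissible Ω A B Λ K)
    (hu : IsWeakSolution Ω A B u Du) {v : Pt n → Vec m} {Dv : Pt n → Tens n m}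
    (hv : H1c Ω v Dv) :
    Integrable (fun x => formA (A x) (Du x) (Dv x) - (inner ℂ (v x) (applyB (B x) (Du x))).re)
        (volume.restrict Ω) ∧
      ∫ x in Ω, (formA (A x) (Du x) (Dv x) - (inner ℂ (v x) (applyB (B x) (Du x))).re) = 0 := by
  obtain ⟨S, hS, hSΩ, hv0, hDv0, -⟩ := hv.approx
  obtain ⟨d, hd, hdS⟩ := exists_le_bdryDist hadm.isOpen hS hSΩ
  have hsub : volume.restrict S ≤ volume.restrict Ω := Measure.restrict_mono_set _ hSΩ
  have lDu := hu.sobolev.memLp_grad S hS hSΩ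
  have lA : MemLp (fun x => applyA (A x) (Du x)) 2 (volume.restrict S) :=
    memLp_applyA (fun h k α β => (hadm.measA h k α β).mono_measure hsub)
      (ae_restrict_of_ae_restrict_of_subset hSΩ hadm.ae_boundA) lDu
  have lB : MemLp (fun x => applyB (B x) (Du x)) 2 (volume.restrict S) :=
    memLp_applyB (fun h α β => (hadm.measB h α β).mono_measure hsub)
      (hadm.ae_boundB_of_le hSΩ hS.measurableSet hd hdS) lDu
  have hint : IntegrableOn (fun x => inner ℂ (Dv x) (applyA (A x) (Du x)) -
      inner ℂ (v x) (applyB (B x) (Du x))) Ω :=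
    IntegrableOn.of_forall_sdiff_eq_zero (s := S)
      ((integrable_inner (hv.memLp_grad.restrict S) lA).sub
        (integrable_inner (hv.memLp.restrict S) lB)) hadm.isOpen.measurableSet
      fun x hx => by simp [hv0 x hx.2, hDv0 x hx.2]
  refine ⟨hint.re, ?_⟩
  have h1 := Complex.reCLM.integral_comp_comm hint
  rw [hu.weak_eq_h1c hadm hv, map_zero] at h1
  exact h1

/-- If the integral of `H` is infinite there is nothing to prove. Otherwise G ≤ H - F almost
everywhere with H - F integrable, and the integral of F is nonnegative. No measurability of `G` is
required. -/
theorem lintegral_ofReal_le_of_integral_nonneg {X : Type*} [MeasurableSpace X] {μ : Measure X}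
    {F G H : X → ℝ} (hF : Integrable F μ) (hF0 : 0 ≤ ∫ x, F x ∂μ) (hG : ∀ x, 0 ≤ G x)
    (hH : AEStronglyMeasurable H μ) (hH0 : ∀ x, 0 ≤ H x) (h : ∀ᵐ x ∂μ, F x ≤ -G x + H x) :
    ∫⁻ x, ENNReal.ofReal (G x) ∂μ ≤ ∫⁻ x, ENNReal.ofReal (H x) ∂μ := by
  by_cases hfin : ∫⁻ x, ENNReal.ofReal (H x) ∂μ = ⊤
  · rw [hfin]; exact le_top
  have hHi : Integrable H μ :=
    ⟨hH, (hasFiniteIntegral_iff_ofReal (Eventually.of_forall hH0)).2 (lt_top_iff_ne_top.2 hfin)⟩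
  calc ∫⁻ x, ENNReal.ofReal (G x) ∂μ ≤ ∫⁻ x, ENNReal.ofReal (H x - F x) ∂μ := by
        refine lintegral_mono_ae (h.mono fun x hx => ENNReal.ofReal_le_ofReal (by linarith))
    _ = ENNReal.ofReal (∫ x, (H x - F x) ∂μ) :=
        (ofReal_integral_eq_lintegral_ofReal (hHi.sub hF)
          (h.mono fun x hx => by have := hG x; simp only [Pi.zero_apply, Pi.sub_apply]; linarith)).symm
    _ ≤ ENNReal.ofReal (∫ x, H x ∂μ) := by
        rw [integral_sub hHi hF]
        exact ENNReal.ofReal_le_ofReal (by linarith)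
    _ = _ := ofReal_integral_eq_lintegral_ofReal hHi (Eventually.of_forall hH0)

/-- A zero of a nonnegative function is a minimum. This handles the points where the cutoff vanishes
and the test function no longer determines the direction of u. -/
theorem gradR_eq_zero_of_nonneg {η : Pt n → ℝ} (hη : ∀ y, 0 ≤ η y) {x : Pt n} (hx : η x = 0) :
    gradR η x = 0 := by
  have : IsLocalMin η x := Eventually.of_forall fun y => by rw [hx]; exact hη y
  ext h
  simp [gradR, this.fderiv_eq_zero]

theorem gradR_mul_self {η : Pt n → ℝ} (hη : ContDiff ℝ ∞ η) (x : Pt n) :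
    gradR (fun y => η y * η y) x = (2 * η x) • gradR η x := by
  ext h
  have hd := hη.differentiable (by simp) x
  simp only [gradR, Pi.smul_apply, smul_eq_mul]
  rw [fderiv_fun_mul hd hd]
  simp; ring

theorem IsTest.mul_self {η : Pt n → ℝ} (hη : IsTest Ω η) : IsTest Ω fun y => η y * η y :=
  ⟨hη.1.mul hη.1, hη.2.1.mul_left, (tsupport_mul_subset_left).trans hη.2.2⟩

theorem radial_smul_right (w : Vec m) (c : ℝ) (ξ : Tens n m) :
    radial w (c • ξ) = c • radial w ξ := (radialL w).map_smul c ξ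

/-- Three integral relations are combined: ellipticity at 2 for ηθ₀φ(|u|)u, ellipticity at p for
ηθ₁φ(|u|)u, and the equation tested with η²φ(|u|)²u. The resulting function F has a nonnegative
integral, and `pointwise_energy` bounds it above almost everywhere, with X = ηφ∇u and Y = φ u⊗∇η. -/
theorem energy_estimate (hadm : IsAdmissible Ω A B Λ K) (hu : IsWeakSolution Ω A B u Du)
    {η : Pt n → ℝ} (hη : IsTest Ω η) (hη0 : ∀ y, 0 ≤ η y) (hη1 : ∀ y, η y ≤ 1) {G d : ℝ}
    (hG : ∀ y, ∑ h, gradR η y h ^ 2 ≤ G) (hd : 0 ≤ d)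
    (hB : ∀ᵐ y ∂volume.restrict (tsupport η), ∀ h α β, ‖B y h α β‖ ≤ d)
    {p ε M₀ l₀ l₁ : ℝ} (ht : |1 - 2 / p| ≤ 1) {φ a θ₀ α₀ θ₁ α₁ : ℝ → ℝ}
    (hw : EnergyWeights p ε M₀ φ a θ₀ α₀ θ₁ α₁) (hl₀ : 0 < l₀) (hl₁ : 0 < l₁)
    (hl₀' : l₀ ≤ 1) (hl₁' : l₁ ≤ 1) (h₀ : IntEllipticWith Ω A 2 l₀)
    (h₁ : IntEllipticWith Ω A p l₁) (hε : ε ≤ 1)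
    (hεl₀ : 144 * (1 + (n * m) ^ 2 * Λ) * ε ≤ l₀) (hεl₁ : 144 * (1 + (n * m) ^ 2 * Λ) * ε ≤ l₁) :
    ∫⁻ y in tsupport η, ENNReal.ofReal ((θ₀ ‖u y‖ ^ 2 * l₀ + θ₁ ‖u y‖ ^ 2 * l₁) / 8 *
        ‖η y • chainTens φ a (u y) (Du y)‖ ^ 2) ≤
      ∫⁻ y in tsupport η, ENNReal.ofReal (300 * (1 + (n * m) ^ 2 * Λ) ^ 2 /
        (θ₀ ‖u y‖ ^ 2 * l₀ + θ₁ ‖u y‖ ^ 2 * l₁) *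
          ((G + (n * m ^ 2 * d) ^ 2) * (φ ‖u y‖ * ‖u y‖) ^ 2)) := by
  set M : ℝ := 1 + (n * m) ^ 2 * Λ with hMdef
  have hM : 1 ≤ M := by
    have : (0 : ℝ) ≤ (n * m) ^ 2 * Λ := by positivity
    linarith
  set S := tsupport η with hSdef
  have hS : IsCompact S := hη.2.1
  have hSΩ : S ⊆ Ω := hη.2.2
  set t := 1 - 2 / p with htdef
  have hφ0 : ∀ w : Vec m, 0 ≤ φ ‖w‖ := fun w => by
    rcases (norm_nonneg w).eq_or_lt with h | h
    · rw [← h]; exact hw.nonneg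
    · exact (hw.pos _ h).1.le
  have z1 : ∀ x, x ∉ S → η x = 0 := fun x hx => image_eq_zero_of_notMem_tsupport hx
  have z2 : ∀ x, x ∉ S → gradR η x = 0 := fun x hx => gradR_eq_zero hx
  -- the three test functions
  have H₀ := hu.sobolev.h1c_chain hadm.isOpen (hw.weight₀.mul hw.weight) hη
  have H₁ := hu.sobolev.h1c_chain hadm.isOpen (hw.weight₁.mul hw.weight) hη
  have Hψ := hu.sobolev.h1c_chain hadm.isOpen (hw.weight.mul hw.weight) hη.mul_self
  set X : Pt n → Tens n m := fun y => (η y * φ ‖u y‖) • Du y with hX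
  set Y : Pt n → Tens n m := fun y => φ ‖u y‖ • tens (u y) (gradR η y) with hY
  set W : Pt n → Tens n m := fun y => X y + a ‖u y‖ • radial (u y) (X y) with hW
  have eW : ∀ y, η y • chainTens φ a (u y) (Du y) = W y := fun y => by
    simp only [hW, hX, chainTens, radial_smul_right, smul_smul, smul_add]
    congr 2; ring
  -- Differentiating the partition function adds only the term with α, of size ε, to W; the cutoff
  -- contributes Y.
  have eD : ∀ (θ α : ℝ → ℝ) (y : Pt n),
      η y • chainTens (fun s => θ s * φ s) (fun s => α s + a s) (u y) (Du y) +
        tens (radialMap (fun s => θ s * φ s) (u y)) (gradR η y) =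
      θ ‖u y‖ • (W y + α ‖u y‖ • radial (u y) (X y) + Y y) := fun θ α y => by
    simp only [hW, hX, hY, chainTens, radialMap, radial_smul_right, smul_smul, smul_add,
      tens_smul_left, add_smul]
    module
  have eψ : ∀ y, (η y * η y) • chainTens (fun s => φ s * φ s) (fun s => a s + a s) (u y) (Du y) +
        tens (radialMap (fun s => φ s * φ s) (u y)) (gradR (fun y => η y * η y) y) =
      (η y * φ ‖u y‖) • (X y + (2 * a ‖u y‖) • radial (u y) (X y) + (2 : ℝ) • Y y) := fun y => by
    simp only [hX, hY, chainTens, radialMap, radial_smul_right, smul_smul, smul_add,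
      tens_smul_left, add_smul, gradR_mul_self hη.1, tens_smul_right]
    module
  -- The ellipticity condition projects along the test function, the pointwise estimate along u. The
  -- two agree, since the test function is a real multiple of u, and where that multiple vanishes
  -- with u ≠ 0, both η and ∇η are zero.
  have eR : ∀ (θ α : ℝ → ℝ) (_ : ∀ s, 0 < s → 0 < θ s) (y : Pt n),
      radial (η y • radialMap (fun s => θ s * φ s) (u y))
        (θ ‖u y‖ • (W y + α ‖u y‖ • radial (u y) (X y) + Y y)) =
      radial (u y) (θ ‖u y‖ • (W y + α ‖u y‖ • radial (u y) (X y) + Y y)) := fun θ α hθ y => by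
    by_cases huy : u y = 0
    · simp [huy, radialMap]
    have hpos : 0 < ‖u y‖ := norm_pos_iff.2 huy
    by_cases hηy : η y = 0
    · have : gradR η y = 0 := gradR_eq_zero_of_nonneg hη0 hηy
      have r0 : ∀ w : Vec m, radial w (0 : Tens n m) = 0 := fun w => (radialL w).map_zero
      simp [hW, hX, hY, hηy, this, r0]
    · rw [radialMap, smul_smul, radial_smul_left]
      exact mul_ne_zero hηy (mul_pos (hθ _ hpos) (hw.pos _ hpos).1).ne'
  simp only [eD] at H₀ H₁
  simp only [eψ] at Hψ
  set D₀ : Pt n → Tens n m := fun y =>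
    θ₀ ‖u y‖ • (W y + α₀ ‖u y‖ • radial (u y) (X y) + Y y) with hD₀
  set D₁ : Pt n → Tens n m := fun y =>
    θ₁ ‖u y‖ • (W y + α₁ ‖u y‖ • radial (u y) (X y) + Y y) with hD₁
  obtain ⟨iψ, eqψ⟩ := hu.weak_eq_re hadm Hψ
  set β : Pt n → ℝ := fun y => (inner ℂ ((η y * η y) • radialMap (fun s => φ s * φ s) (u y))
    (applyB (B y) (Du y))).re with hβ
  have eform : ∀ y, formA (A y) (Du y)
      ((η y * φ ‖u y‖) • (X y + (2 * a ‖u y‖) • radial (u y) (X y) + (2 : ℝ) • Y y)) =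
      formA (A y) (X y) (X y + (2 * a ‖u y‖) • radial (u y) (X y)) +
        2 * formA (A y) (X y) (Y y) := fun y => by
    have : formA (A y) (X y) = (η y * φ ‖u y‖) • formA (A y) (Du y) := by simp only [hX, map_smul]
    rw [this]
    simp only [map_smul, map_add, LinearMap.smul_apply, smul_eq_mul]
    ring
  simp only [eform] at iψ eqψ
  have I₀ := (hadm.intEllipticWith_iff.1 h₀) _ _ H₀.isW12Zero
  have I₁ := (hadm.intEllipticWith_iff.1 h₁) _ _ H₁.isW12Zero
  have q₀ := hadm.integrable_quad (1 - 2 / 2) (H₀.memLp.restrict Ω).aestronglyMeasurable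
    (H₀.memLp_grad.restrict Ω)
  have q₁ := hadm.integrable_quad (1 - 2 / p) (H₁.memLp.restrict Ω).aestronglyMeasurable
    (H₁.memLp_grad.restrict Ω)
  have s₀ := ((H₀.memLp_grad.restrict Ω).integrable_norm_pow (by norm_num)).const_mul l₀
  have s₁ := ((H₁.memLp_grad.restrict Ω).integrable_norm_pow (by norm_num)).const_mul l₁
  have eq₀ : ∀ y, quad (A y) (1 - 2 / 2) (η y • radialMap (fun s => θ₀ s * φ s) (u y)) (D₀ y) =
      formA (A y) (D₀ y) (D₀ y) := fun y => by
    rw [div_self two_ne_zero, sub_self, quad_zero]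
  have eq₁ : ∀ y, quad (A y) (1 - 2 / p) (η y • radialMap (fun s => θ₁ s * φ s) (u y)) (D₁ y) =
      formA (A y) (D₁ y - t • radial (u y) (D₁ y)) (D₁ y + t • radial (u y) (D₁ y)) := fun y => by
    simp only [quad, hD₁]
    rw [eR θ₁ α₁ fun s hs => (hw.pos s hs).2.2]
  simp only [eq₀] at I₀ q₀
  simp only [eq₁] at I₁ q₁
  set F : Pt n → ℝ := fun y => formA (A y) (D₀ y) (D₀ y) - l₀ * ‖D₀ y‖ ^ 2 +
    (formA (A y) (D₁ y - t • radial (u y) (D₁ y)) (D₁ y + t • radial (u y) (D₁ y))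
      - l₁ * ‖D₁ y‖ ^ 2) - (formA (A y) (X y) (X y + (2 * a ‖u y‖) • radial (u y) (X y)) +
        2 * formA (A y) (X y) (Y y) - β y) with hF
  have j₀ := q₀.sub s₀
  have j₁ := q₁.sub s₁
  have iF : Integrable F (volume.restrict Ω) := (j₀.add j₁).sub iψ
  have hF0 : 0 ≤ ∫ y in Ω, F y := by
    have e1 : ∫ y in Ω, F y = _ := integral_sub (j₀.add j₁) iψ
    have e2 := integral_add j₀ j₁
    have e3 := integral_sub q₀ s₀
    have e4 := integral_sub q₁ s₁
    rw [integral_const_mul] at e3 e4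
    simp only [Pi.sub_apply] at e1 e2 e3 e4
    rw [e1, eqψ, e2, e3, e4]
    linarith
  have hFz : ∀ x ∈ Ω \ S, F x = 0 := fun x hx => by
    have h1 := z1 x hx.2
    have h2 := z2 x hx.2
    have r0 : ∀ w : Vec m, radial w (0 : Tens n m) = 0 := fun w => (radialL w).map_zero
    simp [hF, hD₀, hD₁, hW, hX, hY, hβ, h1, h2, r0]
  rw [setIntegral_eq_of_subset_of_forall_sdiff_eq_zero hadm.isOpen.measurableSet hSΩ hFz] at hF0
  have iFS : Integrable F (volume.restrict S) := IntegrableOn.mono_set iF hSΩ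
  have hc : ∀ y, 0 < θ₀ ‖u y‖ ^ 2 * l₀ + θ₁ ‖u y‖ ^ 2 * l₁ := fun y => by
    have h1 := hw.sq_add_sq _ (norm_nonneg (u y))
    have h2 : 0 < min l₀ l₁ := lt_min hl₀ hl₁
    nlinarith [mul_le_mul_of_nonneg_left (min_le_left l₀ l₁) (sq_nonneg (θ₀ ‖u y‖)),
      mul_le_mul_of_nonneg_left (min_le_right l₀ l₁) (sq_nonneg (θ₁ ‖u y‖))]
  have hG0 : 0 ≤ G := (Finset.sum_nonneg fun h _ => sq_nonneg _).trans (hG 0)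
  have mu : AEStronglyMeasurable u (volume.restrict S) :=
    (hu.sobolev.memLp S hS hSΩ).aestronglyMeasurable
  have mφ := (hw.weight.continuous_comp_norm (V := Vec m)).comp_aestronglyMeasurable mu
  have m₀ := (hw.weight₀.continuous_comp_norm (V := Vec m)).comp_aestronglyMeasurable mu
  have m₁ := (hw.weight₁.continuous_comp_norm (V := Vec m)).comp_aestronglyMeasurable mu
  refine lintegral_ofReal_le_of_integral_nonneg iFS hF0
    (fun y => mul_nonneg (div_nonneg (hc y).le (by norm_num)) (sq_nonneg _)) ?_
    (fun y => by have := hc y; positivity) ?_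
  · refine AEStronglyMeasurable.mul ?_ (((mφ.mul mu.norm).pow 2).const_mul _)
    exact (AEMeasurable.const_div (((m₀.pow 2).mul_const l₀).add
      ((m₁.pow 2).mul_const l₁)).aemeasurable _).aestronglyMeasurable
  filter_upwards [hB, ae_restrict_of_ae_restrict_of_subset hSΩ hadm.ae_boundA,
    ae_restrict_of_ae_restrict_of_subset hSΩ hadm.legendreHadamard] with y hBy hAy hLH
  set b : ℝ := n * m ^ 2 * d * (η y * (φ ‖u y‖ * ‖u y‖)) with hb
  have hφy := hφ0 (u y)
  have hηy := hη0 y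
  have hb0 : 0 ≤ b := by positivity
  have hβb : |β y| ≤ b * ‖X y‖ := by
    have e1 : ‖(η y * η y) • radialMap (fun s => φ s * φ s) (u y)‖ =
        η y * φ ‖u y‖ * (η y * (φ ‖u y‖ * ‖u y‖)) := by
      rw [radialMap, norm_smul, norm_smul, Real.norm_of_nonneg (by positivity),
        Real.norm_of_nonneg (by positivity)]
      ring
    have e2 : ‖X y‖ = η y * φ ‖u y‖ * ‖Du y‖ := by
      simp only [hX]
      rw [norm_smul, Real.norm_of_nonneg (by positivity)]
    calc |β y| ≤ ‖inner ℂ ((η y * η y) • radialMap (fun s => φ s * φ s) (u y))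
          (applyB (B y) (Du y))‖ := Complex.abs_re_le_norm _
      _ ≤ _ := norm_inner_le_norm _ _
      _ ≤ η y * φ ‖u y‖ * (η y * (φ ‖u y‖ * ‖u y‖)) * (n * m ^ 2 * d * ‖Du y‖) := by
          rw [e1]; gcongr; exact norm_applyB_le hBy _
      _ = b * ‖X y‖ := by rw [e2, hb]; ring
  have key := pointwise_energy (formA (A y)) (radialL (u y)) hM
    (fun ξ ζ => (abs_formA_le hAy ξ ζ).trans (by gcongr; linarith))
    (norm_radial_le (u y)) (radial_radial (u y))
    (fun ξ => by
      have := hLH (u y) (radialCoef (u y) ξ)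
      rwa [← radial_eq_tens] at this) ht (hw.sq_add_sq _ (norm_nonneg (u y)))
    (hw.rel _ (norm_nonneg (u y))) (hw.abs_le₀ _ (norm_nonneg (u y)))
    (hw.abs_le₁ _ (norm_nonneg (u y))) hε hl₀ hl₁ hl₀' hl₁' hεl₀ hεl₁ (X y) (Y y) hb0 hβb
  refine key.trans ?_
  rw [eW y]
  have hcy := hc y
  have hYb : ‖Y y‖ ^ 2 + b ^ 2 ≤ (G + (n * m ^ 2 * d) ^ 2) * (φ ‖u y‖ * ‖u y‖) ^ 2 := by
    have e1 : ‖Y y‖ ^ 2 = (∑ h, gradR η y h ^ 2) * (φ ‖u y‖ * ‖u y‖) ^ 2 := by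
      simp only [hY]
      rw [norm_smul, mul_pow, norm_tens_sq, Real.norm_of_nonneg hφy]; ring
    have e2 : b ^ 2 ≤ (n * m ^ 2 * d) ^ 2 * (φ ‖u y‖ * ‖u y‖) ^ 2 := by
      rw [← mul_pow]
      refine pow_le_pow_left₀ hb0 ?_ 2
      rw [hb]
      refine mul_le_mul_of_nonneg_left ?_ (by positivity)
      exact mul_le_of_le_one_left (by positivity) (hη1 y)
    rw [e1, add_mul]
    exact add_le_add (mul_le_mul_of_nonneg_right (hG y) (sq_nonneg _)) e2
  exact add_le_add le_rfl (mul_le_mul_of_nonneg_left hYb (by positivity))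

end

/-! ### The Caccioppoli inequality for a general cutoff -/

section

variable {Ω : Set (Pt n)} {A : Pt n → Coef2 n m} {B : Pt n → Coef1 n m} {Λ K : ℝ≥0}
  {u : Pt n → Vec m} {Du : Pt n → Tens n m}

section Weights

variable {p ε M₀ : ℝ} {φ a θ₀ α₀ θ₁ α₁ : ℝ → ℝ}

theorem EnergyWeights.nonneg' (hw : EnergyWeights p ε M₀ φ a θ₀ α₀ θ₁ α₁) {s : ℝ} (hs : 0 ≤ s) :
    0 ≤ φ s := by
  rcases hs.eq_or_lt with rfl | h
  · exact hw.nonneg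
  · exact (hw.pos _ h).1.le

theorem EnergyWeights.sq_le_one (hw : EnergyWeights p ε M₀ φ a θ₀ α₀ θ₁ α₁) {s : ℝ}
    (hs : 0 ≤ s) : θ₁ s ^ 2 ≤ 1 := by
  linarith [hw.sq_add_sq s hs, sq_nonneg (θ₀ s)]

theorem EnergyWeights.min_le_coef (hw : EnergyWeights p ε M₀ φ a θ₀ α₀ θ₁ α₁) {s : ℝ}
    (hs : 0 ≤ s) (l₀ l₁ : ℝ) : min l₀ l₁ ≤ θ₀ s ^ 2 * l₀ + θ₁ s ^ 2 * l₁ := by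
  have h1 := hw.sq_add_sq s hs
  calc min l₀ l₁ = θ₀ s ^ 2 * min l₀ l₁ + θ₁ s ^ 2 * min l₀ l₁ := by rw [← add_mul, h1, one_mul]
    _ ≤ _ := by gcongr <;> simp

/-- The vector `ξ` is controlled by `ξ + a P ξ`. -/
theorem EnergyWeights.norm_le (hw : EnergyWeights p ε M₀ φ a θ₀ α₀ θ₁ α₁)
    (ht : |1 - 2 / p| ≤ 1) (w : Vec m) (ξ : Tens n m) :
    ‖ξ‖ ≤ 2 * ‖ξ + a ‖w‖ • radial w ξ‖ := by
  have hs := norm_nonneg w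
  set s := (1 - 2 / p) * θ₁ ‖w‖ ^ 2 with hsdef
  have hs1 : |s| ≤ 1 := by
    rw [hsdef, abs_mul, abs_of_nonneg (sq_nonneg (θ₁ ‖w‖))]
    exact mul_le_one₀ ht (sq_nonneg _) (hw.sq_le_one hs)
  have hrel : a ‖w‖ * (1 - s) = s := hw.rel _ hs
  set V := ξ + a ‖w‖ • radial w ξ with hV
  have hPV : radial w V = (1 + a ‖w‖) • radial w ξ := by
    have : radial w V = radial w ξ + radial w (a ‖w‖ • radial w ξ) := (radialL w).map_add _ _
    rw [this, radial_smul_right, radial_radial, add_smul, one_smul]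
  have e : ξ = V - s • radial w V := by
    rw [hPV, smul_smul, hV, show s * (1 + a ‖w‖) = a ‖w‖ by linarith]
    abel
  calc ‖ξ‖ = ‖V - s • radial w V‖ := by rw [← e]
    _ ≤ ‖V‖ + ‖s • radial w V‖ := norm_sub_le _ _
    _ ≤ ‖V‖ + 1 * ‖V‖ := by
        rw [norm_smul, Real.norm_eq_abs]
        gcongr
        exact norm_radial_le _ _
    _ = 2 * ‖V‖ := by ring

end Weights

theorem abs_one_sub_two_div_le {p : ℝ} (hp : 1 < p) : |1 - 2 / p| ≤ 1 := by
  have h1 : 0 < 2 / p := by positivity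
  have h2 : 2 / p ≤ 2 := by
    rw [div_le_iff₀ (by linarith)]; linarith
  rw [abs_le]; constructor <;> linarith

theorem ofReal_norm_rpow_half_sq (w : Vec m) {p : ℝ} (hp : 0 < p) :
    ENNReal.ofReal ((‖w‖ ^ (p / 2)) ^ 2) = ‖w‖ₑ ^ p := by
  rw [← Real.rpow_natCast, ← Real.rpow_mul (norm_nonneg w)]
  rw [show p / 2 * ((2 : ℕ) : ℝ) = p by push_cast; ring,
    ← ENNReal.ofReal_rpow_of_nonneg (norm_nonneg w) hp.le, ofReal_norm]

/-- The majorant is D/min(l₀, l₁) · |u|^p, by φ(s)s ≤ s^{p/2} and the fact that the denominator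
averages l₀ and l₁. In the limit θ₁ → 1, so the denominator becomes l₁ and the constant l₀ is lost.
-/
theorem EnergyWeightsSeq.tendsto_lintegral {p ε : ℝ} {M₀ : ℕ → ℝ} {φ a θ₀ α₀ θ₁ α₁ : ℕ → ℝ → ℝ}
    (hp : 0 < p) (hw : EnergyWeightsSeq p ε M₀ φ a θ₀ α₀ θ₁ α₁) {l₀ l₁ : ℝ} (hl₀ : 0 < l₀)
    (hl₁ : 0 < l₁) {X : Type*} [MeasurableSpace X] {μ : Measure X} {u : X → Vec m}
    (hu : AEStronglyMeasurable u μ) (hfin : ∫⁻ y, ‖u y‖ₑ ^ p ∂μ ≠ ⊤) {D : ℝ} (hD : 0 ≤ D) :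
    Tendsto (fun j => ∫⁻ y, ENNReal.ofReal (D / (θ₀ j ‖u y‖ ^ 2 * l₀ + θ₁ j ‖u y‖ ^ 2 * l₁) *
        (φ j ‖u y‖ * ‖u y‖) ^ 2) ∂μ) atTop
      (𝓝 (ENNReal.ofReal (D / l₁) * ∫⁻ y, ‖u y‖ₑ ^ p ∂μ)) := by
  have hl : 0 < min l₀ l₁ := lt_min hl₀ hl₁
  rw [← lintegral_const_mul' _ _ ENNReal.ofReal_ne_top]
  refine tendsto_lintegral_of_dominated_convergence'
    (bound := fun y => ENNReal.ofReal (D / min l₀ l₁) * ‖u y‖ₑ ^ p) (fun j => ?_) (fun j => ?_) ?_ ?_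
  · have mφ := ((hw.weights j).weight.continuous_comp_norm (V := Vec m)).comp_aestronglyMeasurable hu
    have m₀ := ((hw.weights j).weight₀.continuous_comp_norm (V := Vec m)).comp_aestronglyMeasurable hu
    have m₁ := ((hw.weights j).weight₁.continuous_comp_norm (V := Vec m)).comp_aestronglyMeasurable hu
    refine AEMeasurable.ennreal_ofReal (AEMeasurable.mul ?_ ((mφ.mul hu.norm).pow 2).aemeasurable)
    exact AEMeasurable.const_div (((m₀.pow 2).mul_const l₀).add
      ((m₁.pow 2).mul_const l₁)).aemeasurable _
  · refine Eventually.of_forall fun y => ?_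
    have hs := norm_nonneg (u y)
    have h1 := (hw.weights j).min_le_coef hs l₀ l₁
    have h2 := (hw.weights j).mul_le _ hs
    have h3 := (hw.weights j).nonneg' hs
    beta_reduce
    rw [← ofReal_norm_rpow_half_sq _ hp, ← ENNReal.ofReal_mul (by positivity)]
    exact ENNReal.ofReal_le_ofReal (by gcongr)
  · rw [lintegral_const_mul' _ _ ENNReal.ofReal_ne_top]
    exact ENNReal.mul_ne_top ENNReal.ofReal_ne_top hfin
  · refine Eventually.of_forall fun y => ?_
    have hs := norm_nonneg (u y)
    rw [← ofReal_norm_rpow_half_sq _ hp, ← ENNReal.ofReal_mul (by positivity)]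
    refine ENNReal.tendsto_ofReal ?_
    have t1 := (hw.tendsto_mul _ hs).pow 2
    rcases hs.eq_or_lt with h | h
    · rw [← h]
      have h2 : p / 2 ≠ 0 := by positivity
      simp [Real.zero_rpow h2]
    · have t2 := (hw.tendsto_one _ h).pow 2
      have t3 : Tendsto (fun j => θ₀ j ‖u y‖ ^ 2) atTop (𝓝 0) := by
        have := t2.const_sub 1
        rw [one_pow, sub_self] at this
        exact this.congr fun j => by linarith [(hw.weights j).sq_add_sq _ hs]
      have t4 : Tendsto (fun j => θ₀ j ‖u y‖ ^ 2 * l₀ + θ₁ j ‖u y‖ ^ 2 * l₁) atTop (𝓝 l₁) := by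
        simpa using (t3.mul_const l₀).add (t2.mul_const l₁)
      exact (tendsto_const_nhds.div t4 hl₁.ne').mul t1

/-- The data of a cutoff function for the energy estimate. -/
structure EnergyCutoff (Ω : Set (Pt n)) (B : Pt n → Coef1 n m) (η : Pt n → ℝ) (G d : ℝ) :
    Prop where
  isTest : IsTest Ω η
  nonneg : ∀ y, 0 ≤ η y
  le_one : ∀ y, η y ≤ 1
  grad_le : ∀ y, ∑ h, gradR η y h ^ 2 ≤ G
  pos : 0 < G
  nonneg_d : 0 ≤ d
  ae_le : ∀ᵐ y ∂volume.restrict (tsupport η), ∀ h α β, ‖B y h α β‖ ≤ d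

/-- Here ε may depend on the ellipticity constant l₀ at 2, which is not controlled by λ_p. This is
harmless, since ε does not enter the inequality and l₀ enters only through coefficients that
converge to l₁. -/
theorem exists_energy_sequence (hadm : IsAdmissible Ω A B Λ K) (hu : IsWeakSolution Ω A B u Du)
    {η : Pt n → ℝ} {G d : ℝ} (hη : EnergyCutoff Ω B η G d) {p l₁ : ℝ} (hp : 1 < p)
    (hl₁ : 0 < l₁) (hl₁' : l₁ ≤ 1) (h₁ : IntEllipticWith Ω A p l₁) :
    ∃ l₀ ε M₀ φ a θ₀ α₀ θ₁ α₁, 0 < l₀ ∧ ε ≤ 1 ∧ EnergyWeightsSeq p ε M₀ φ a θ₀ α₀ θ₁ α₁ ∧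
      ∀ j, ∫⁻ y in tsupport η, ENNReal.ofReal ((θ₀ j ‖u y‖ ^ 2 * l₀ + θ₁ j ‖u y‖ ^ 2 * l₁) / 8 *
          ‖η y • chainTens (φ j) (a j) (u y) (Du y)‖ ^ 2) ≤
        ∫⁻ y in tsupport η, ENNReal.ofReal (300 * (1 + (n * m) ^ 2 * Λ) ^ 2 *
          (G + (n * m ^ 2 * d) ^ 2) / (θ₀ j ‖u y‖ ^ 2 * l₀ + θ₁ j ‖u y‖ ^ 2 * l₁) *
            (φ j ‖u y‖ * ‖u y‖) ^ 2) := by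
  obtain ⟨c, hc, hc₀⟩ := hadm.elliptic
  set l₀ := min c 1
  have hl₀ : 0 < l₀ := lt_min hc one_pos
  have h₀ : IntEllipticWith Ω A 2 l₀ := hc₀.mono (min_le_left _ _)
  set M : ℝ := 1 + (n * m) ^ 2 * Λ with hMdef
  have hM : 1 ≤ M := by
    have : (0 : ℝ) ≤ (n * m) ^ 2 * Λ := by positivity
    linarith
  have hl : 0 < min l₀ l₁ := lt_min hl₀ hl₁
  set ε := min l₀ l₁ / (144 * M) with hεdef
  have hε : 0 < ε := by positivity
  have hεl : 144 * M * ε = min l₀ l₁ := by rw [hεdef]; field_simp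
  have hε1 : ε ≤ 1 := by
    have : min l₀ l₁ ≤ 1 := (min_le_left _ _).trans (min_le_right _ _)
    rw [hεdef, div_le_one (by positivity)]
    linarith
  obtain ⟨M₀, φ, a, θ₀, α₀, θ₁, α₁, hw⟩ := exists_energyWeightsSeq hp hε
  refine ⟨l₀, ε, M₀, φ, a, θ₀, α₀, θ₁, α₁, hl₀, hε1, hw, fun j => ?_⟩
  refine (energy_estimate hadm hu hη.isTest hη.nonneg hη.le_one hη.grad_le hη.nonneg_d hη.ae_le
    (abs_one_sub_two_div_le hp) (hw.weights j) hl₀ hl₁ (min_le_right _ _) hl₁' h₀ h₁ hε1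
    (hεl.le.trans (min_le_left _ _)) (hεl.le.trans (min_le_right _ _))).trans_eq ?_
  refine lintegral_congr fun y => ?_
  congr 1
  ring

/-- The Caccioppoli inequality with a general cutoff function. -/
theorem caccioppoli_of_cutoff (hadm : IsAdmissible Ω A B Λ K) (hu : IsWeakSolution Ω A B u Du)
    {η : Pt n → ℝ} {G d : ℝ} (hη : EnergyCutoff Ω B η G d) {p l₁ : ℝ} (hp : 1 < p)
    (hl₁ : 0 < l₁) (hl₁' : l₁ ≤ 1) (h₁ : IntEllipticWith Ω A p l₁) {T : Set (Pt n)}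
    (hT : MeasurableSet T) (hT1 : ∀ y ∈ T, η y = 1) :
    ∫⁻ y in T, ‖u y‖ₑ ^ (p - 2) * ‖Du y‖ₑ ^ 2 ≤
      ENNReal.ofReal (9600 * (1 + (n * m) ^ 2 * Λ) ^ 2 * (G + (n * m ^ 2 * d) ^ 2) / l₁ ^ 2) *
        ∫⁻ y in tsupport η, ‖u y‖ₑ ^ p := by
  set N : ℝ := 300 * (1 + (n * m) ^ 2 * Λ) ^ 2 * (G + (n * m ^ 2 * d) ^ 2) with hN
  have hG := hη.pos
  have hN0 : 0 < N := by positivity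
  have eN : 9600 * (1 + (n * m) ^ 2 * Λ) ^ 2 * (G + (n * m ^ 2 * d) ^ 2) / l₁ ^ 2 =
      32 / l₁ * (N / l₁) := by
    rw [hN]; field_simp; ring
  rw [eN]
  set S := tsupport η with hS
  -- Dominated convergence needs |u|^p integrable. If it is not, the right side is infinite, because
  -- G > 0 makes the constant positive.
  by_cases hfin : ∫⁻ y in S, ‖u y‖ₑ ^ p = ⊤
  · rw [hfin, ENNReal.mul_top (by simp only [ne_eq, ENNReal.ofReal_eq_zero, not_le]; positivity)]
    exact le_top
  have hTS : T ⊆ S := fun y hy => subset_tsupport _ (by simp [hT1 y hy])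
  obtain ⟨l₀, ε, M₀, φ, a, θ₀, α₀, θ₁, α₁, hl₀, hε, hw, hE⟩ :=
    exists_energy_sequence hadm hu hη hp hl₁ hl₁' h₁
  have mu : AEStronglyMeasurable u (volume.restrict S) :=
    (hu.sobolev.memLp S hη.isTest.2.1 hη.isTest.2.2).aestronglyMeasurable
  have mDu : AEStronglyMeasurable Du (volume.restrict S) :=
    (hu.sobolev.memLp_grad S hη.isTest.2.1 hη.isTest.2.2).aestronglyMeasurable
  have hlim := hw.tendsto_lintegral (by linarith) hl₀ hl₁ mu hfin hN0.le
  set f : ℕ → Pt n → ℝ≥0∞ := fun j y =>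
    ENNReal.ofReal (θ₀ j ‖u y‖ ^ 2 * l₀ + θ₁ j ‖u y‖ ^ 2 * l₁) *
      ENNReal.ofReal (φ j ‖u y‖) ^ 2 * ‖Du y‖ₑ ^ 2 with hf
  have hmono : volume.restrict T ≤ volume.restrict S := Measure.restrict_mono_set _ hTS
  have mf : ∀ j, AEMeasurable (f j) (volume.restrict T) := fun j => by
    have mu' := mu.mono_measure hmono
    have mφ := ((hw.weights j).weight.continuous_comp_norm (V := Vec m)).comp_aestronglyMeasurable mu'
    have m₀ := ((hw.weights j).weight₀.continuous_comp_norm (V := Vec m)).comp_aestronglyMeasurable mu'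
    have m₁ := ((hw.weights j).weight₁.continuous_comp_norm (V := Vec m)).comp_aestronglyMeasurable mu'
    refine AEMeasurable.mul (AEMeasurable.mul ?_ ?_) ((mDu.mono_measure hmono).enorm.pow_const 2)
    · exact (((m₀.pow 2).mul_const l₀).add ((m₁.pow 2).mul_const l₁)).aemeasurable.ennreal_ofReal
    · exact mφ.aemeasurable.ennreal_ofReal.pow_const 2
  have hptw : ∀ y, Tendsto (fun j => f j y) atTop
      (𝓝 (ENNReal.ofReal l₁ * ‖u y‖ₑ ^ (p - 2) * ‖Du y‖ₑ ^ 2)) := fun y => by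
    have := hw.tendsto_coef l₀ l₁ _ hl₀ hl₁ (norm_nonneg (u y))
    rw [ofReal_norm] at this
    exact ENNReal.Tendsto.mul_const this (Or.inr (by finiteness))
  -- The factor 32 is 8 · 4: the energy carries 1/8, and ‖ξ‖ ≤ 2‖ξ + aPξ‖ is squared. With the 300
  -- inside N this gives the 9600 of the statement.
  have hfj : ∀ j, ∫⁻ y in T, f j y ≤ ENNReal.ofReal 32 *
      ∫⁻ y in S, ENNReal.ofReal (N / (θ₀ j ‖u y‖ ^ 2 * l₀ + θ₁ j ‖u y‖ ^ 2 * l₁) *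
        (φ j ‖u y‖ * ‖u y‖) ^ 2) := fun j => by
    refine le_trans ?_ (mul_le_mul_right (hE j) _)
    rw [← lintegral_const_mul' _ _ ENNReal.ofReal_ne_top]
    refine le_trans ?_ (lintegral_mono' hmono le_rfl)
    refine lintegral_mono_ae ((ae_restrict_mem hT).mono fun y hy => ?_)
    have hs := norm_nonneg (u y)
    have hφ := (hw.weights j).nonneg' hs
    have hc := (lt_min hl₀ hl₁).le.trans ((hw.weights j).min_le_coef hs l₀ l₁)
    simp only [hf]
    rw [← ofReal_norm (Du y), ← ENNReal.ofReal_pow hφ, ← ENNReal.ofReal_pow (norm_nonneg _),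
      ← ENNReal.ofReal_mul hc, ← ENNReal.ofReal_mul (by positivity),
      ← ENNReal.ofReal_mul (by norm_num), hT1 y hy, one_smul]
    refine ENNReal.ofReal_le_ofReal ?_
    have h := (hw.weights j).norm_le (abs_one_sub_two_div_le hp) (u y) (Du y)
    rw [chainTens, norm_smul, Real.norm_of_nonneg hφ, mul_pow]
    have h2 : ‖Du y‖ ^ 2 ≤ 4 * ‖Du y + a j ‖u y‖ • radial (u y) (Du y)‖ ^ 2 := by
      calc ‖Du y‖ ^ 2 ≤ (2 * ‖Du y + a j ‖u y‖ • radial (u y) (Du y)‖) ^ 2 := by gcongr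
        _ = _ := by ring
    calc _ ≤ (θ₀ j ‖u y‖ ^ 2 * l₀ + θ₁ j ‖u y‖ ^ 2 * l₁) * φ j ‖u y‖ ^ 2 *
          (4 * ‖Du y + a j ‖u y‖ • radial (u y) (Du y)‖ ^ 2) := by gcongr
      _ = _ := by ring
  -- Fatou's lemma also covers the set where u = 0: for p < 2 the integrands there converge to ∞ ·
  -- |∇u|², with the convention ∞ · 0 = 0 of the Caccioppoli inequality.
  have hfatou : ENNReal.ofReal l₁ * ∫⁻ y in T, ‖u y‖ₑ ^ (p - 2) * ‖Du y‖ₑ ^ 2 ≤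
      ENNReal.ofReal 32 * (ENNReal.ofReal (N / l₁) * ∫⁻ y in S, ‖u y‖ₑ ^ p) := by
    rw [← lintegral_const_mul' _ _ ENNReal.ofReal_ne_top]
    calc _ = ∫⁻ y in T, liminf (fun j => f j y) atTop := by
          refine lintegral_congr fun y => ?_
          rw [(hptw y).liminf_eq, mul_assoc]
      _ ≤ liminf (fun j => ∫⁻ y in T, f j y) atTop := lintegral_liminf_le' mf
      _ ≤ liminf (fun j => ENNReal.ofReal 32 * ∫⁻ y in S, ENNReal.ofReal
          (N / (θ₀ j ‖u y‖ ^ 2 * l₀ + θ₁ j ‖u y‖ ^ 2 * l₁) * (φ j ‖u y‖ * ‖u y‖) ^ 2)) atTop :=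
          liminf_le_liminf (Eventually.of_forall hfj)
      _ = _ := (ENNReal.Tendsto.const_mul hlim (Or.inr ENNReal.ofReal_ne_top)).liminf_eq
  have hl₁0 : ENNReal.ofReal l₁ ≠ 0 := by simpa using hl₁
  rw [mul_comm, ← ENNReal.le_div_iff_mul_le (Or.inl hl₁0) (Or.inl ENNReal.ofReal_ne_top)] at hfatou
  refine hfatou.trans_eq ?_
  have e32 : ENNReal.ofReal (32 / l₁) = ENNReal.ofReal 32 / ENNReal.ofReal l₁ :=
    ENNReal.ofReal_div_of_pos hl₁
  rw [ENNReal.ofReal_mul (by positivity), e32]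
  generalize ENNReal.ofReal (N / l₁) = z
  simp only [div_eq_mul_inv]
  ring

end

/-! ### Cutoff functions for balls -/

theorem exists_deriv_smoothTransition_bound :
    ∃ C : ℝ, 0 < C ∧ ∀ x, |deriv Real.smoothTransition x| ≤ C := by
  have hc : Continuous (deriv Real.smoothTransition) :=
    (Real.smoothTransition.contDiff (n := 1)).continuous_deriv le_rfl
  have h0 : ∀ x, x ∉ Set.Icc (0 : ℝ) 1 → deriv Real.smoothTransition x = 0 := fun x hx => by
    rw [Set.mem_Icc, not_and_or, not_le, not_le] at hx
    rcases hx with hx | hx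
    · have : Real.smoothTransition =ᶠ[𝓝 x] fun _ => 0 := by
        filter_upwards [Iio_mem_nhds hx] with y hy
        exact Real.smoothTransition.zero_of_nonpos (le_of_lt hy)
      rw [this.deriv_eq, deriv_const]
    · have : Real.smoothTransition =ᶠ[𝓝 x] fun _ => 1 := by
        filter_upwards [Ioi_mem_nhds hx] with y hy
        exact Real.smoothTransition.one_of_one_le (le_of_lt hy)
      rw [this.deriv_eq, deriv_const]
  obtain ⟨C, hC⟩ := (HasCompactSupport.intro isCompact_Icc h0).exists_bound_of_continuous hc
  exact ⟨max C 1, lt_max_of_lt_right one_pos, fun x => (hC x).trans (le_max_left _ _)⟩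

/-- A cutoff function between concentric balls, with the natural bound of its gradient. -/
theorem exists_ball_cutoff (n : ℕ) : ∃ C : ℝ, 0 < C ∧ ∀ (x : Pt n) (ρ ρ' : ℝ), 0 < ρ → ρ < ρ' →
    ∃ η : Pt n → ℝ, IsTest (Metric.ball x ρ') η ∧ (∀ y, 0 ≤ η y) ∧ (∀ y, η y ≤ 1) ∧
      (∀ y ∈ Metric.ball x ρ, η y = 1) ∧ ∀ y, ∑ h, gradR η y h ^ 2 ≤ C / (ρ' - ρ) ^ 2 := by
  obtain ⟨C, hC, hCb⟩ := exists_deriv_smoothTransition_bound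
  refine ⟨16 * C ^ 2, by positivity, fun x ρ ρ₁ hρ hρρ₁ => ?_⟩
  -- The support lies in the closed ball of the middle radius, hence inside the open ball of radius
  -- ρ₁. Halving the gap turns the factor 4 of the gradient bound into 16.
  set ρ' := (ρ + ρ₁) / 2 with hρ'
  have hρρ' : ρ < ρ' := by linarith
  have hρ'ρ₁ : ρ' < ρ₁ := by linarith
  set D := ρ' ^ 2 - ρ ^ 2 with hD
  have hD0 : 0 < D := by
    rw [hD]; nlinarith
  set g : Pt n → ℝ := fun y => (ρ' ^ 2 - ‖y - x‖ ^ 2) / D with hg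
  have hgs : ContDiff ℝ ∞ g :=
    (contDiff_const.sub ((contDiff_id.sub contDiff_const).norm_sq ℝ)).div_const D
  set η : Pt n → ℝ := fun y => Real.smoothTransition (g y) with hη
  have hηs : ContDiff ℝ ∞ η := Real.smoothTransition.contDiff.comp hgs
  have h0 : ∀ y, y ∉ Metric.closedBall x ρ' → η y = 0 := fun y hy => by
    rw [mem_closedBall_iff_norm, not_le] at hy
    refine Real.smoothTransition.zero_of_nonpos (div_nonpos_of_nonpos_of_nonneg ?_ hD0.le)
    have : 0 < ρ' := hρ.trans hρρ'
    nlinarith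
  have hts : tsupport η ⊆ Metric.closedBall x ρ' :=
    closure_minimal (fun y hy => by by_contra h; exact hy (h0 y h)) Metric.isClosed_closedBall
  refine ⟨η, ⟨hηs, HasCompactSupport.intro (isCompact_closedBall x ρ') h0,
    hts.trans (Metric.closedBall_subset_ball hρ'ρ₁)⟩,
    fun y => Real.smoothTransition.nonneg _, fun y => Real.smoothTransition.le_one _,
    fun y hy => ?_, fun y => ?_⟩
  · rw [mem_ball_iff_norm] at hy
    refine Real.smoothTransition.one_of_one_le ((one_le_div hD0).2 ?_)
    have := norm_nonneg (y - x)
    rw [hD]; nlinarith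
  · by_cases hy : y ∈ tsupport η
    · have hyn : ‖y - x‖ ≤ ρ' := mem_closedBall_iff_norm.1 (hts hy)
      have e : ∀ h, gradR η y h = deriv Real.smoothTransition (g y) * (-(2 * (y - x) h) / D) := by
        intro h
        have d1 : HasFDerivAt (fun y : Pt n => ‖y - x‖ ^ 2)
            ((2 : ℕ) • (innerSL ℝ (y - x)).comp (ContinuousLinearMap.id ℝ (Pt n))) y :=
          ((hasFDerivAt_id y).sub_const x).norm_sq
        have d2 : HasFDerivAt g _ y := (d1.const_sub (ρ' ^ 2)).mul_const D⁻¹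
        have d3 := ((Real.smoothTransition.contDiff (n := 1)).differentiable one_ne_zero
          (g y)).hasDerivAt.comp_hasFDerivAt y d2
        rw [gradR, show η = Real.smoothTransition ∘ g from rfl, d3.fderiv]
        simp [EuclideanSpace.inner_single_right]
        ring
      have hsq : ∑ h, (y - x) h ^ 2 = ‖y - x‖ ^ 2 := by
        rw [EuclideanSpace.norm_sq_eq]; simp
      calc ∑ h, gradR η y h ^ 2
          = deriv Real.smoothTransition (g y) ^ 2 * (4 * ‖y - x‖ ^ 2 / D ^ 2) := by
            rw [← hsq]
            simp only [e, Finset.mul_sum, Finset.sum_div]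
            refine Finset.sum_congr rfl fun h _ => ?_
            ring_nf
        _ ≤ C ^ 2 * (4 * ρ' ^ 2 / D ^ 2) := by
            gcongr ?_ * (4 * ?_ / D ^ 2)
            · exact sq_le_sq' (abs_le.1 (hCb _)).1 (abs_le.1 (hCb _)).2
            · gcongr
        _ ≤ C ^ 2 * (4 / (ρ' - ρ) ^ 2) := by
            have hr : 0 < ρ' - ρ := by linarith
            gcongr ?_ * ?_
            rw [div_le_div_iff₀ (by positivity) (by positivity)]
            have : D = (ρ' - ρ) * (ρ' + ρ) := by rw [hD]; ring
            rw [this, mul_pow]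
            have h2 : ρ' ^ 2 ≤ (ρ' + ρ) ^ 2 := by
              have : 0 < ρ' := hρ.trans hρρ'
              gcongr; linarith
            nlinarith [sq_nonneg (ρ' - ρ)]
        _ = 16 * C ^ 2 / (ρ₁ - ρ) ^ 2 := by
            have hr : ρ' - ρ = (ρ₁ - ρ) / 2 := by rw [hρ']; ring
            have hr0 : ρ₁ - ρ ≠ 0 := by linarith
            rw [hr]; field_simp; ring
    · rw [gradR_eq_zero hy]
      simp only [Pi.zero_apply, ne_eq, OfNat.ofNat_ne_zero, not_false_eq_true, zero_pow,
        Finset.sum_const_zero]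
      positivity

/-! ### The Sobolev inequality -/

theorem IsTest.mono {F : Type*} [NormedAddCommGroup F] [NormedSpace ℝ F] {U Ω : Set (Pt n)}
    {φ : Pt n → F} (h : IsTest U φ) (hU : U ⊆ Ω) : IsTest Ω φ :=
  ⟨h.1, h.2.1, h.2.2.trans hU⟩

theorem IsW12Loc.mono {U Ω : Set (Pt n)} (hΩ : MeasurableSet Ω) {u : Pt n → Vec m}
    {Du : Pt n → Tens n m} (hu : IsW12Loc Ω u Du) (hU : U ⊆ Ω) : IsW12Loc U u Du where
  memLp S hS hSU := hu.memLp S hS (hSU.trans hU)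
  memLp_grad S hS hSU := hu.memLp_grad S hS (hSU.trans hU)
  weak_deriv φ hφ h α := by
    have := hu.weak_deriv φ (hφ.mono hU) h α
    rw [setIntegral_eq_of_subset_of_forall_sdiff_eq_zero hΩ hU,
      setIntegral_eq_of_subset_of_forall_sdiff_eq_zero hΩ hU] at this
    · exact this
    · intro x hx
      rw [image_eq_zero_of_notMem_tsupport fun h => hx.2 (hφ.2.2 h)]
      simp
    · intro x hx
      have := congrFun (gradR_eq_zero (η := φ) fun h => hx.2 (hφ.2.2 h)) h
      simp only [gradR, Pi.zero_apply] at this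
      simp [this]

theorem norm_fderiv_le_grad (φ : Pt n → Vec m) (x : Pt n) :
    ‖fderiv ℝ φ x‖ ≤ n * ‖grad φ x‖ := by
  refine ContinuousLinearMap.opNorm_le_bound _ (by positivity) fun v => ?_
  have hv : v = ∑ h, v h • (EuclideanSpace.single h (1 : ℝ) : Pt n) := by
    ext i
    simp [Finset.sum_apply, Pi.single_apply]
  have hrow : ∀ h, ‖fderiv ℝ φ x (EuclideanSpace.single h 1)‖ ≤ ‖grad φ x‖ := fun h => by
    refine le_of_sq_le_sq ?_ (norm_nonneg _)
    rw [EuclideanSpace.norm_sq_eq, EuclideanSpace.norm_sq_eq, Fintype.sum_prod_type]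
    exact Finset.single_le_sum (f := fun h => ∑ α, ‖grad φ x (h, α)‖ ^ 2)
      (fun i _ => Finset.sum_nonneg fun _ _ => sq_nonneg _) (Finset.mem_univ h)
  calc ‖fderiv ℝ φ x v‖ = ‖∑ h, v h • fderiv ℝ φ x (EuclideanSpace.single h 1)‖ := by
        conv_lhs => rw [hv]
        simp only [map_sum, map_smul]
    _ ≤ ∑ h : Fin n, ‖v‖ * ‖grad φ x‖ := by
        refine (norm_sum_le _ _).trans (Finset.sum_le_sum fun h _ => ?_)
        rw [norm_smul]
        gcongr
        · exact PiLp.norm_apply_le v h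
        · exact hrow h
    _ = n * ‖grad φ x‖ * ‖v‖ := by simp; ring

/-- Sobolev's inequality for compactly supported functions. -/
theorem exists_sobolev_const (m : ℕ) (hn : 2 ≤ n) {χ : ℝ} (hχ : 1 ≤ χ)
    (hχn : 1 / 2 ≤ 1 / (n : ℝ) + 1 / (2 * χ)) :
    ∃ C : ℝ≥0, ∀ (U : Set (Pt n)) (v : Pt n → Vec m) (Dv : Pt n → Tens n m),
      volume U ≠ ⊤ → H1c U v Dv →
      eLpNorm v (ENNReal.ofReal (2 * χ)) volume ≤
        C * volume U ^ (1 / (n : ℝ) + 1 / (2 * χ) - 1 / 2) * eLpNorm Dv 2 volume := by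
  set σ : ℝ := 1 / (n : ℝ) + 1 / (2 * χ) with hσ
  have hn0 : (2 : ℝ) ≤ n := by exact_mod_cast hn
  have hσ1 : σ ≤ 1 := by
    have h1 : 1 / (n : ℝ) ≤ 1 / 2 := by gcongr
    have h2 : 1 / (2 * χ) ≤ 1 / 2 := by gcongr; linarith
    linarith
  have hσ0 : 0 < σ := by linarith
  -- The exponent whose Sobolev conjugate is 2χ. It lies in [1, 2], so the inequality with the L^s
  -- norm of the gradient is followed by Hölder's inequality on U, which produces the power of the
  -- volume.
  set s : ℝ≥0 := Real.toNNReal σ⁻¹ with hs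
  have hsr : (s : ℝ) = σ⁻¹ := Real.coe_toNNReal _ (by positivity)
  have hs1 : 1 ≤ s := by
    rw [← NNReal.coe_le_coe, hsr]
    exact (one_le_inv₀ hσ0).2 hσ1
  have hs2 : s ≤ 2 := by
    rw [← NNReal.coe_le_coe, hsr]
    exact inv_le_of_inv_le₀ (by norm_num) (by norm_num at hχn ⊢; exact hχn)
  set s' : ℝ≥0 := Real.toNNReal (2 * χ)
  have hsr' : (s' : ℝ) = 2 * χ := Real.coe_toNNReal _ (by positivity)
  have hfr : Module.finrank ℝ (Pt n) = n := by simp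
  have hss' : (s' : ℝ)⁻¹ = (s : ℝ)⁻¹ - (Module.finrank ℝ (Pt n) : ℝ)⁻¹ := by
    rw [hfr, hsr, hsr', inv_inv, hσ]; simp
  set C₀ := SNormLESNormFDerivOfEqConst (Vec m) (volume : Measure (Pt n)) s
  refine ⟨C₀ * n, fun U v Dv hU hv => ?_⟩
  obtain ⟨S, hS, hSU, -, -, φ, hφ, hφS, hφv, hDφ⟩ := hv.approx
  have htest : ∀ j, eLpNorm (φ j) (ENNReal.ofReal (2 * χ)) volume ≤
      (C₀ * n : ℝ≥0) * volume U ^ (σ - 1 / 2) * eLpNorm (grad (φ j)) 2 volume := fun j => by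
    have h1 := eLpNorm_le_eLpNorm_fderiv_of_eq (volume : Measure (Pt n))
      ((hφ j).1.of_le (by simp)) (hφ j).2.1 hs1 (by rw [hfr]; omega) hss'
    have h2 : eLpNorm (fderiv ℝ (φ j)) s volume ≤ n * eLpNorm (grad (φ j)) s volume := by
      have := eLpNorm_le_nnreal_smul_eLpNorm_of_ae_le_mul (c := (n : ℝ≥0)) (μ := volume)
        (Eventually.of_forall fun x => (norm_fderiv_le_grad (φ j) x : _ ≤ ((n : ℝ≥0) : ℝ) * _)) s
      rwa [ENNReal.smul_def, smul_eq_mul, ENNReal.coe_natCast] at this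
    have h3 : eLpNorm (grad (φ j)) s volume = eLpNorm (grad (φ j)) s (volume.restrict S) := by
      refine (eLpNorm_restrict_eq_of_support_subset fun x hx => ?_).symm
      by_contra hxS
      exact hx (grad_eq_zero fun h => hxS (hφS j h))
    have h4 : eLpNorm (grad (φ j)) s (volume.restrict S) ≤
        eLpNorm (grad (φ j)) 2 (volume.restrict S) * volume U ^ (σ - 1 / 2) := by
      refine (eLpNorm_le_eLpNorm_mul_rpow_measure_univ (p := s) (q := 2) (by exact_mod_cast hs2)
        (continuous_grad (hφ j).1).aestronglyMeasurable).trans ?_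
      have e : 1 / ((s : ℝ≥0∞)).toReal - 1 / (2 : ℝ≥0∞).toReal = σ - 1 / 2 := by
        simp [hsr]
      rw [e, Measure.restrict_apply_univ]
      gcongr
    calc _ = eLpNorm (φ j) s' volume := rfl
      _ ≤ _ := h1
      _ ≤ C₀ * (n * (eLpNorm (grad (φ j)) 2 volume * volume U ^ (σ - 1 / 2))) := by
          gcongr
          refine h2.trans ?_
          gcongr
          rw [h3]
          refine h4.trans ?_
          gcongr
          exact Measure.restrict_le_self
      _ = _ := by push_cast; ring
  have hDlim : Tendsto (fun j => eLpNorm (grad (φ j)) 2 volume) atTop (𝓝 (eLpNorm Dv 2 volume)) := by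
    refine tendsto_of_tendsto_of_tendsto_of_le_of_le
      (g := fun j => eLpNorm Dv 2 volume - eLpNorm (grad (φ j) - Dv) 2 volume)
      (h := fun j => eLpNorm Dv 2 volume + eLpNorm (grad (φ j) - Dv) 2 volume) ?_ ?_ ?_ ?_
    · simpa using ENNReal.Tendsto.sub (tendsto_const_nhds (x := eLpNorm Dv 2 volume)) hDφ
        (Or.inl hv.memLp_grad.2.ne)
    · simpa using (tendsto_const_nhds (x := eLpNorm Dv 2 volume)).add hDφ
    · intro j
      have := eLpNorm_sub_le (isTest_memLp_grad (hφ j)).1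
        ((isTest_memLp_grad (hφ j)).1.sub hv.memLp_grad.1) (p := 2) (by norm_num)
      rw [sub_sub_cancel] at this
      exact tsub_le_iff_right.2 this
    · intro j
      have := eLpNorm_add_le hv.memLp_grad.1
        ((isTest_memLp_grad (hφ j)).1.sub hv.memLp_grad.1) (p := 2) (by norm_num)
      rwa [add_sub_cancel] at this
  -- The L^{2χ} norm is lower semicontinuous under almost everywhere convergence, so no convergence
  -- of the approximations in L^{2χ} is needed.
  obtain ⟨k, hk, hae⟩ := (tendstoInMeasure_of_tendsto_eLpNorm (p := 2) (by norm_num)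
    (fun j => (isTest_memLp (hφ j)).1) hv.memLp.1 hφv).exists_seq_tendsto_ae
  have htop : (C₀ * n : ℝ≥0) * volume U ^ (σ - 1 / 2) ≠ ⊤ :=
    ENNReal.mul_ne_top ENNReal.coe_ne_top
      (ENNReal.rpow_ne_top_of_nonneg (by linarith) hU)
  have hlim := (ENNReal.Tendsto.const_mul (hDlim.comp hk.tendsto_atTop) (Or.inr htop)).liminf_eq
  refine (Lp.eLpNorm_lim_le_liminf_eLpNorm (fun j => (isTest_memLp (hφ (k j))).1) v hae).trans ?_
  rw [← hlim]
  exact liminf_le_liminf (Eventually.of_forall fun j => htest (k j))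

section

/-! ### Gain of integrability -/

/-- The Sobolev inequality is applied with θ₁φ instead of φ because θ₁² ≤ (θ₀²l₀ + θ₁²l₁)/l₁: the
weighted energy then controls the gradient with a constant free of l₀. -/
theorem EnergyWeights.norm_grad_sq_le {p ε M₀ l₀ l₁ G : ℝ} {φ a θ₀ α₀ θ₁ α₁ : ℝ → ℝ}
    (hw : EnergyWeights p ε M₀ φ a θ₀ α₀ θ₁ α₁) (ht : |1 - 2 / p| ≤ 1) (hε : ε ≤ 1)
    (hl₀ : 0 < l₀) (hl₁ : 0 < l₁) (w : Vec m) (ξ : Tens n m) {e : ℝ} (he : 0 ≤ e) {b : Fin n → ℝ}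
    (hb : ∑ h, b h ^ 2 ≤ G) :
    ‖e • chainTens (fun s => θ₁ s * φ s) (fun s => α₁ s + a s) w ξ +
        tens (radialMap (fun s => θ₁ s * φ s) w) b‖ ^ 2 ≤
      64 / l₁ * ((θ₀ ‖w‖ ^ 2 * l₀ + θ₁ ‖w‖ ^ 2 * l₁) / 8 * ‖e • chainTens φ a w ξ‖ ^ 2) +
        2 * G * (φ ‖w‖ * ‖w‖) ^ 2 := by
  have hs := norm_nonneg w
  have hφ := hw.nonneg' hs
  have hG : 0 ≤ G := (Finset.sum_nonneg fun h _ => sq_nonneg _).trans hb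
  set V := ξ + a ‖w‖ • radial w ξ with hV
  have h1 := hw.norm_le ht w ξ
  have e1 : e • chainTens (fun s => θ₁ s * φ s) (fun s => α₁ s + a s) w ξ =
      (e * (θ₁ ‖w‖ * φ ‖w‖)) • (V + α₁ ‖w‖ • radial w ξ) := by
    simp only [chainTens, smul_smul, hV, add_smul, smul_add]
    module
  have e2 : ‖e • chainTens φ a w ξ‖ = e * φ ‖w‖ * ‖V‖ := by
    rw [chainTens, smul_smul, norm_smul, Real.norm_of_nonneg (by positivity)]
  have h2 : ‖V + α₁ ‖w‖ • radial w ξ‖ ≤ 2 * ‖V‖ := by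
    have h3 : |α₁ ‖w‖| ≤ 1 / 2 := (hw.abs_le₁ _ hs).trans (by linarith)
    calc _ ≤ ‖V‖ + ‖α₁ ‖w‖ • radial w ξ‖ := norm_add_le _ _
      _ ≤ ‖V‖ + 1 / 2 * (2 * ‖V‖) := by
          rw [norm_smul, Real.norm_eq_abs]
          gcongr
          exact (norm_radial_le _ _).trans h1
      _ = _ := by ring
  have h3 : ‖e • chainTens (fun s => θ₁ s * φ s) (fun s => α₁ s + a s) w ξ‖ ^ 2 ≤
      4 * θ₁ ‖w‖ ^ 2 * ‖e • chainTens φ a w ξ‖ ^ 2 := by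
    rw [e1, e2, norm_smul, mul_pow, Real.norm_eq_abs, sq_abs]
    calc _ ≤ (e * (θ₁ ‖w‖ * φ ‖w‖)) ^ 2 * (2 * ‖V‖) ^ 2 := by gcongr
      _ = _ := by ring
  have h4 : ‖tens (radialMap (fun s => θ₁ s * φ s) w) b‖ ^ 2 ≤ G * (φ ‖w‖ * ‖w‖) ^ 2 := by
    rw [norm_tens_sq, radialMap, norm_smul, Real.norm_eq_abs, mul_pow, sq_abs]
    calc _ ≤ G * ((θ₁ ‖w‖ * φ ‖w‖) ^ 2 * ‖w‖ ^ 2) := by gcongr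
      _ = θ₁ ‖w‖ ^ 2 * (G * (φ ‖w‖ * ‖w‖) ^ 2) := by ring
      _ ≤ 1 * (G * (φ ‖w‖ * ‖w‖) ^ 2) := by gcongr; exact hw.sq_le_one hs
      _ = _ := one_mul _
  have h5 : θ₁ ‖w‖ ^ 2 ≤ (θ₀ ‖w‖ ^ 2 * l₀ + θ₁ ‖w‖ ^ 2 * l₁) / l₁ := by
    rw [le_div_iff₀ hl₁]
    have : 0 ≤ θ₀ ‖w‖ ^ 2 * l₀ := by positivity
    linarith
  calc _ ≤ (‖e • chainTens (fun s => θ₁ s * φ s) (fun s => α₁ s + a s) w ξ‖ +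
        ‖tens (radialMap (fun s => θ₁ s * φ s) w) b‖) ^ 2 := by gcongr; exact norm_add_le _ _
    _ ≤ 2 * ‖e • chainTens (fun s => θ₁ s * φ s) (fun s => α₁ s + a s) w ξ‖ ^ 2 +
        2 * ‖tens (radialMap (fun s => θ₁ s * φ s) w) b‖ ^ 2 := by
        linarith [add_sq_le (a := ‖e • chainTens (fun s => θ₁ s * φ s) (fun s => α₁ s + a s) w ξ‖)
          (b := ‖tens (radialMap (fun s => θ₁ s * φ s) w) b‖)]
    _ ≤ 2 * (4 * θ₁ ‖w‖ ^ 2 * ‖e • chainTens φ a w ξ‖ ^ 2) + 2 * (G * (φ ‖w‖ * ‖w‖) ^ 2) := by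
        gcongr
    _ ≤ 2 * (4 * ((θ₀ ‖w‖ ^ 2 * l₀ + θ₁ ‖w‖ ^ 2 * l₁) / l₁) * ‖e • chainTens φ a w ξ‖ ^ 2) +
        2 * (G * (φ ‖w‖ * ‖w‖) ^ 2) := by gcongr
    _ = _ := by field_simp; ring

theorem lintegral_rpow_le_of_eLpNorm_le {X E F : Type*} [MeasurableSpace X] {μ : Measure X}
    [NormedAddCommGroup E] [NormedAddCommGroup F] {v : X → E} {w : X → F} {χ : ℝ} (hχ : 1 ≤ χ)
    {C : ℝ≥0∞} (h : eLpNorm v (ENNReal.ofReal (2 * χ)) μ ≤ C * eLpNorm w 2 μ) :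
    ∫⁻ x, ‖v x‖ₑ ^ (2 * χ) ∂μ ≤ (C ^ 2 * ∫⁻ x, ‖w x‖ₑ ^ 2 ∂μ) ^ χ := by
  set s : ℝ≥0 := Real.toNNReal (2 * χ)
  have hs : (s : ℝ) = 2 * χ := Real.coe_toNNReal _ (by positivity)
  have hs0 : s ≠ 0 := by
    rw [← NNReal.coe_ne_zero, hs]; positivity
  have h1 := eLpNorm_nnreal_pow_eq_lintegral (μ := μ) (f := v) hs0
  have h2 := eLpNorm_nnreal_pow_eq_lintegral (μ := μ) (f := w) (p := 2) (by norm_num)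
  rw [hs] at h1
  have h2' : ∫⁻ x, ‖w x‖ₑ ^ 2 ∂μ = eLpNorm w 2 μ ^ 2 := by
    have e : ∀ z : ℝ≥0∞, z ^ ((2 : ℝ≥0) : ℝ) = z ^ 2 := fun z => by
      rw [← ENNReal.rpow_natCast]; norm_num
    simp only [e] at h2
    exact h2.symm
  rw [← h1, h2', ← mul_pow, ← ENNReal.rpow_natCast, ← ENNReal.rpow_mul]
  push_cast
  exact ENNReal.rpow_le_rpow h (by positivity)

/-- The solution gains integrability. -/
theorem exists_gain_const (m : ℕ) (hn : 2 ≤ n) {χ : ℝ} (hχ : 1 ≤ χ)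
    (hχn : 1 / 2 ≤ 1 / (n : ℝ) + 1 / (2 * χ)) :
    ∃ C : ℝ≥0, ∀ (Ω : Set (Pt n)) (A : Pt n → Coef2 n m) (B : Pt n → Coef1 n m) (Λ K : ℝ≥0)
      (u : Pt n → Vec m) (Du : Pt n → Tens n m) (η : Pt n → ℝ) (G d p l₁ : ℝ) (U T : Set (Pt n)),
      IsAdmissible Ω A B Λ K → IsWeakSolution Ω A B u Du → EnergyCutoff Ω B η G d → IsOpen U →
      U ⊆ Ω → volume U ≠ ⊤ → tsupport η ⊆ U → 1 < p → 0 < l₁ → l₁ ≤ 1 →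
      IntEllipticWith Ω A p l₁ → MeasurableSet T → (∀ y ∈ T, η y = 1) →
      ∫⁻ y in tsupport η, ‖u y‖ₑ ^ p ≠ ⊤ →
      (∫⁻ y in T, ‖u y‖ₑ ^ (p * χ)) ^ (1 / χ) ≤
        C * volume U ^ (2 / (n : ℝ) + 1 / χ - 1) *
          (ENNReal.ofReal (19202 * (1 + (n * m) ^ 2 * Λ) ^ 2 * (G + (n * m ^ 2 * d) ^ 2) / l₁ ^ 2) *
            ∫⁻ y in tsupport η, ‖u y‖ₑ ^ p) := by
  obtain ⟨C, hC⟩ := exists_sobolev_const m hn hχ hχn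
  refine ⟨C ^ 2, fun Ω A B Λ K u Du η G d p l₁ U T hadm hu hη hUo hUΩ hUv hηU hp hl₁ hl₁' h₁ hT
    hT1 hfin => ?_⟩
  set σ : ℝ := 1 / (n : ℝ) + 1 / (2 * χ) - 1 / 2 with hσ
  have eσ : (C * volume U ^ σ) ^ 2 = (C ^ 2 : ℝ≥0) * volume U ^ (2 / (n : ℝ) + 1 / χ - 1) := by
    rw [mul_pow, ← ENNReal.rpow_natCast (volume U ^ σ), ← ENNReal.rpow_mul]
    push_cast
    congr 2
    rw [hσ]
    field_simp
  rw [← eσ]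
  set N : ℝ := 300 * (1 + (n * m) ^ 2 * Λ) ^ 2 * (G + (n * m ^ 2 * d) ^ 2) with hN
  have hG := hη.pos
  have hN0 : 0 < N := by positivity
  have hχ0 : 0 < χ := by linarith
  set S := tsupport η with hS
  have hSc : IsCompact S := hη.isTest.2.1
  have ht := abs_one_sub_two_div_le hp
  obtain ⟨l₀, ε, M₀, φ, a, θ₀, α₀, θ₁, α₁, hl₀, hε, hw, hE⟩ :=
    exists_energy_sequence hadm hu hη hp hl₁ hl₁' h₁
  have mu : AEStronglyMeasurable u (volume.restrict S) :=
    (hu.sobolev.memLp S hSc hη.isTest.2.2).aestronglyMeasurable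
  have hlim := hw.tendsto_lintegral (by linarith) hl₀ hl₁ mu hfin hN0.le
  set I := ∫⁻ y in S, ‖u y‖ₑ ^ p with hI
  set R : ℕ → ℝ≥0∞ := fun j => ∫⁻ y in S,
    ENNReal.ofReal (N / (θ₀ j ‖u y‖ ^ 2 * l₀ + θ₁ j ‖u y‖ ^ 2 * l₁) *
      (φ j ‖u y‖ * ‖u y‖) ^ 2) with hR
  have hU := hu.sobolev.mono hadm.isOpen.measurableSet hUΩ
  have hηt : IsTest U η := ⟨hη.isTest.1, hη.isTest.2.1, hηU⟩
  have H : ∀ j, H1c U _ _ := fun j =>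
    hU.h1c_chain hUo ((hw.weights j).weight₁.mul (hw.weights j).weight) hηt
  set v : ℕ → Pt n → Vec m := fun j y => η y • radialMap (fun s => θ₁ j s * φ j s) (u y) with hv
  set D : ℕ → Pt n → Tens n m := fun j y =>
    η y • chainTens (fun s => θ₁ j s * φ j s) (fun s => α₁ j s + a j s) (u y) (Du y) +
      tens (radialMap (fun s => θ₁ j s * φ j s) (u y)) (gradR η y) with hD
  have hDj : ∀ j, ∫⁻ y, ‖D j y‖ₑ ^ 2 ≤ ENNReal.ofReal (64 / l₁) * R j + ENNReal.ofReal (2 * G) * I := by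
    intro j
    have e1 : ∫⁻ y, ‖D j y‖ₑ ^ 2 = ∫⁻ y in S, ‖D j y‖ₑ ^ 2 := by
      refine (setLIntegral_eq_of_support_subset ?_).symm
      intro y hy
      by_contra hyS
      refine hy ?_
      simp only [hD]
      rw [gradR_eq_zero hyS, image_eq_zero_of_notMem_tsupport hyS]
      simp
    rw [e1]
    calc ∫⁻ y in S, ‖D j y‖ₑ ^ 2
        ≤ ∫⁻ y in S, (ENNReal.ofReal (64 / l₁) *
            ENNReal.ofReal ((θ₀ j ‖u y‖ ^ 2 * l₀ + θ₁ j ‖u y‖ ^ 2 * l₁) / 8 *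
              ‖η y • chainTens (φ j) (a j) (u y) (Du y)‖ ^ 2) +
            ENNReal.ofReal (2 * G) * ‖u y‖ₑ ^ p) := by
          refine lintegral_mono fun y => ?_
          have hs := norm_nonneg (u y)
          have hφ := (hw.weights j).nonneg' hs
          have hc := (lt_min hl₀ hl₁).le.trans ((hw.weights j).min_le_coef hs l₀ l₁)
          rw [← ofReal_norm_rpow_half_sq _ (by linarith : 0 < p), ← ofReal_norm,
            ← ENNReal.ofReal_pow (norm_nonneg _), ← ENNReal.ofReal_mul (by positivity),
            ← ENNReal.ofReal_mul (by positivity),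
            ← ENNReal.ofReal_add (by positivity) (by positivity)]
          refine ENNReal.ofReal_le_ofReal (((hw.weights j).norm_grad_sq_le ht hε hl₀ hl₁ (u y) (Du y)
            (hη.nonneg y) (hη.grad_le y)).trans ?_)
          gcongr
          exact (hw.weights j).mul_le _ hs
      _ = ENNReal.ofReal (64 / l₁) * (∫⁻ y in S, ENNReal.ofReal
            ((θ₀ j ‖u y‖ ^ 2 * l₀ + θ₁ j ‖u y‖ ^ 2 * l₁) / 8 *
              ‖η y • chainTens (φ j) (a j) (u y) (Du y)‖ ^ 2)) + ENNReal.ofReal (2 * G) * I := by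
          rw [lintegral_add_right' _ ((mu.enorm.pow_const p).const_mul _),
            lintegral_const_mul' _ _ ENNReal.ofReal_ne_top,
            lintegral_const_mul' _ _ ENNReal.ofReal_ne_top]
      _ ≤ _ := by gcongr; exact hE j
  have hvj : ∀ j, ∫⁻ y in T, ‖v j y‖ₑ ^ (2 * χ) ≤ ((C * volume U ^ σ) ^ 2 *
      (ENNReal.ofReal (64 / l₁) * R j + ENNReal.ofReal (2 * G) * I)) ^ χ := fun j => by
    have h1 := lintegral_rpow_le_of_eLpNorm_le hχ (hC U (v j) (D j) hUv (H j))
    refine (lintegral_mono' Measure.restrict_le_self le_rfl).trans (h1.trans ?_)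
    gcongr
    exact hDj j
  have mT : AEStronglyMeasurable u (volume.restrict T) :=
    mu.mono_measure (Measure.restrict_mono_set _ fun y hy => subset_tsupport _ (by simp [hT1 y hy]))
  have hTv : ∀ y ∈ T, ∀ j, ‖v j y‖ₑ = ENNReal.ofReal (θ₁ j ‖u y‖ * (φ j ‖u y‖ * ‖u y‖)) := by
    intro y hy j
    simp only [hv]
    rw [hT1 y hy, one_smul, radialMap, ← ofReal_norm, norm_smul]
    congr 1
    have hs := norm_nonneg (u y)
    rcases hs.eq_or_lt with h | h
    · rw [← h]; simp
    · rw [Real.norm_of_nonneg (mul_nonneg ((hw.weights j).pos _ h).2.2.le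
        ((hw.weights j).nonneg' hs)), mul_assoc]
  have hptw : ∀ y ∈ T, Tendsto (fun j => ‖v j y‖ₑ ^ (2 * χ)) atTop (𝓝 (‖u y‖ₑ ^ (p * χ))) := by
    intro y hy
    have hs := norm_nonneg (u y)
    have h1 : Tendsto (fun j => θ₁ j ‖u y‖ * (φ j ‖u y‖ * ‖u y‖)) atTop (𝓝 (‖u y‖ ^ (p / 2))) := by
      rcases hs.eq_or_lt with h | h
      · rw [← h]
        have h2 : p / 2 ≠ 0 := by positivity
        simp [Real.zero_rpow h2]
      · simpa using (hw.tendsto_one _ h).mul (hw.tendsto_mul _ hs)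
    have h2 := (ENNReal.continuous_rpow_const (y := 2 * χ)).tendsto _ |>.comp
      (ENNReal.tendsto_ofReal h1)
    have e : ENNReal.ofReal (‖u y‖ ^ (p / 2)) ^ (2 * χ) = ‖u y‖ₑ ^ (p * χ) := by
      rw [← ENNReal.ofReal_rpow_of_nonneg hs (by positivity), ofReal_norm, ← ENNReal.rpow_mul]
      congr 1; ring
    rw [e] at h2
    exact h2.congr fun j => by simp only [Function.comp_apply]; rw [hTv y hy j]
  set Q := ENNReal.ofReal (64 / l₁) * (ENNReal.ofReal (N / l₁) * I) + ENNReal.ofReal (2 * G) * I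
  have hUtop : (C * volume U ^ σ) ^ 2 ≠ ⊤ := ENNReal.pow_ne_top (ENNReal.mul_ne_top
    ENNReal.coe_ne_top (ENNReal.rpow_ne_top_of_nonneg (by linarith) hUv))
  have hQlim : Tendsto (fun j => ((C * volume U ^ σ) ^ 2 *
      (ENNReal.ofReal (64 / l₁) * R j + ENNReal.ofReal (2 * G) * I)) ^ χ) atTop
      (𝓝 (((C * volume U ^ σ) ^ 2 * Q) ^ χ)) :=
    (ENNReal.continuous_rpow_const (y := χ)).tendsto _ |>.comp (ENNReal.Tendsto.const_mul
      ((ENNReal.Tendsto.const_mul hlim (Or.inr ENNReal.ofReal_ne_top)).add tendsto_const_nhds)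
      (Or.inr hUtop))
  have hfatou : ∫⁻ y in T, ‖u y‖ₑ ^ (p * χ) ≤ ((C * volume U ^ σ) ^ 2 * Q) ^ χ := by
    calc ∫⁻ y in T, ‖u y‖ₑ ^ (p * χ)
        = ∫⁻ y in T, liminf (fun j => ‖v j y‖ₑ ^ (2 * χ)) atTop :=
          setLIntegral_congr_fun hT fun y hy => ((hptw y hy).liminf_eq).symm
      _ ≤ liminf (fun j => ∫⁻ y in T, ‖v j y‖ₑ ^ (2 * χ)) atTop :=
          lintegral_liminf_le' fun j => ((H j).memLp.1.mono_measure
            Measure.restrict_le_self).enorm.pow_const _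
      _ ≤ liminf _ atTop := liminf_le_liminf (Eventually.of_forall hvj)
      _ = _ := hQlim.liminf_eq
  -- 19202 = 64 · 300 + 2: the energy term contributes 64 · 300, and the term 2G from
  -- differentiating the cutoff is absorbed using l₁ ≤ 1.
  have hQ : Q ≤ ENNReal.ofReal (19202 * (1 + (n * m) ^ 2 * Λ) ^ 2 *
      (G + (n * m ^ 2 * d) ^ 2) / l₁ ^ 2) * I := by
    simp only [Q]
    rw [← mul_assoc, ← add_mul, ← ENNReal.ofReal_mul (by positivity),
      ← ENNReal.ofReal_add (by positivity) (by positivity)]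
    gcongr
    have hM : 1 ≤ (1 + (n * m : ℝ) ^ 2 * Λ) ^ 2 := by
      have : (0 : ℝ) ≤ (n * m) ^ 2 * Λ := by positivity
      nlinarith
    have e1 : 2 * G ≤ 2 * ((1 + (n * m : ℝ) ^ 2 * Λ) ^ 2 * (G + (n * m ^ 2 * d) ^ 2)) / l₁ ^ 2 := by
      rw [le_div_iff₀ (by positivity)]
      have h2 : l₁ ^ 2 ≤ 1 := pow_le_one₀ hl₁.le hl₁'
      have h3 : G ≤ G + (n * m ^ 2 * d) ^ 2 := by linarith [sq_nonneg (n * m ^ 2 * d)]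
      have h4 : G ≤ (1 + (n * m : ℝ) ^ 2 * Λ) ^ 2 * (G + (n * m ^ 2 * d) ^ 2) := by
        calc G = 1 * G := (one_mul G).symm
          _ ≤ _ := mul_le_mul hM h3 hG.le (by positivity)
      calc 2 * G * l₁ ^ 2 ≤ 2 * G * 1 := by gcongr
        _ ≤ _ := by linarith
    calc _ ≤ 64 / l₁ * (N / l₁) +
          2 * ((1 + (n * m : ℝ) ^ 2 * Λ) ^ 2 * (G + (n * m ^ 2 * d) ^ 2)) / l₁ ^ 2 := by gcongr
      _ = _ := by rw [hN]; field_simp; ring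
  calc (∫⁻ y in T, ‖u y‖ₑ ^ (p * χ)) ^ (1 / χ)
      ≤ (((C * volume U ^ σ) ^ 2 * Q) ^ χ) ^ (1 / χ) := by gcongr
    _ = (C * volume U ^ σ) ^ 2 * Q := by
        rw [← ENNReal.rpow_mul, mul_one_div_cancel hχ0.ne', ENNReal.rpow_one]
    _ ≤ _ := by gcongr

end

section

/-! ### Local higher integrability -/

variable {Ω : Set (Pt n)} {A : Pt n → Coef2 n m} {B : Pt n → Coef1 n m} {Λ K : ℝ≥0}
  {u : Pt n → Vec m} {Du : Pt n → Tens n m}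

/-- `|u|^s` is integrable on compact subsets of `Ω`. -/
def LocRpowIntegrable (Ω : Set (Pt n)) (u : Pt n → Vec m) (s : ℝ) : Prop :=
  ∀ S : Set (Pt n), IsCompact S → S ⊆ Ω → ∫⁻ y in S, ‖u y‖ₑ ^ s ≠ ⊤

theorem LocRpowIntegrable.mono {s t : ℝ} (h : LocRpowIntegrable Ω u s) (ht : 0 ≤ t)
    (hts : t ≤ s) : LocRpowIntegrable Ω u t := fun S hS hSΩ => by
  refine ne_top_of_le_ne_top ?_ (lintegral_mono (g := fun y => 1 + ‖u y‖ₑ ^ s) fun y => ?_)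
  · rw [lintegral_add_left measurable_const, lintegral_one, Measure.restrict_apply_univ]
    exact ENNReal.add_ne_top.2 ⟨hS.measure_lt_top.ne, h S hS hSΩ⟩
  · rcases le_total ‖u y‖ₑ 1 with h1 | h1
    · exact (ENNReal.rpow_le_one h1 ht).trans le_self_add
    · exact (ENNReal.rpow_le_rpow_of_exponent_le h1 hts).trans le_add_self

theorem IsW12Loc.locRpowIntegrable_two (hu : IsW12Loc Ω u Du) : LocRpowIntegrable Ω u 2 :=
  fun S hS hSΩ => by
  have h := (hu.memLp S hS hSΩ).2
  have h2 := eLpNorm_nnreal_pow_eq_lintegral (μ := volume.restrict S) (f := u) (p := 2)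
    (by norm_num)
  have e : ((2 : ℝ≥0) : ℝ) = 2 := rfl
  rw [e] at h2
  rw [← h2]
  exact ENNReal.rpow_ne_top_of_nonneg (by norm_num) h.ne

/-- A qualitative use of the gain of integrability: the cutoff equals 1 on the given compact set,
and only the finiteness of its bounds matters. -/
theorem IsWeakSolution.locRpowIntegrable_mul (hadm : IsAdmissible Ω A B Λ K)
    (hu : IsWeakSolution Ω A B u Du) (hn : 2 ≤ n) {χ : ℝ} (hχ : 1 ≤ χ)
    (hχn : 1 / 2 ≤ 1 / (n : ℝ) + 1 / (2 * χ)) {p l : ℝ} (hp : 1 < p) (hl : 0 < l) (hl' : l ≤ 1)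
    (hell : IntEllipticWith Ω A p l) (h : LocRpowIntegrable Ω u p) :
    LocRpowIntegrable Ω u (p * χ) := fun S hS hSΩ => by
  obtain ⟨C, hC⟩ := exists_gain_const m hn hχ hχn
  obtain ⟨T, hT, hST, hTΩ⟩ := exists_compact_between hS hadm.isOpen hSΩ
  obtain ⟨η, hη, hη1, hηI⟩ := exists_cutoff hS isOpen_interior hST
  have hUΩ : interior T ⊆ Ω := interior_subset.trans hTΩ
  have hηΩ := hη.mono hUΩ
  obtain ⟨c, hc, -, hcg⟩ := exists_gradR_bound hη.1 hη.2.1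
  obtain ⟨d, hd, hdS⟩ := exists_le_bdryDist hadm.isOpen hη.2.1 hηΩ.2.2
  -- The summand 1 keeps the gradient bound strictly positive, as `EnergyCutoff` demands.
  have hcut : EnergyCutoff Ω B η (c ^ 2 + 1) (K / d) :=
    ⟨hηΩ, fun y => (hηI y).1, fun y => (hηI y).2, fun y => by
      have h1 := Finset.sum_sq_le_sq_sum_of_nonneg (s := Finset.univ) (f := fun h => |gradR η y h|)
        fun i _ => abs_nonneg _
      simp only [sq_abs] at h1
      have h2 : (∑ h, |gradR η y h|) ^ 2 ≤ c ^ 2 :=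
        pow_le_pow_left₀ (Finset.sum_nonneg fun _ _ => abs_nonneg _) (hcg y) 2
      linarith, by positivity, by positivity,
      hadm.ae_boundB_of_le hηΩ.2.2 hη.2.1.measurableSet hd hdS⟩
  have hUv : volume (interior T) ≠ ⊤ :=
    ((measure_mono interior_subset).trans_lt hT.measure_lt_top).ne
  have hfin := h _ hη.2.1 hηΩ.2.2
  have key := hC Ω A B Λ K u Du η _ _ p l (interior T) S hadm hu hcut isOpen_interior hUΩ hUv
    hη.2.2 hp hl hl' hell hS.measurableSet hη1 hfin
  intro htop
  rw [htop, ENNReal.top_rpow_of_pos (by positivity), top_le_iff] at key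
  refine ENNReal.mul_ne_top (ENNReal.mul_ne_top ENNReal.coe_ne_top
    (ENNReal.rpow_ne_top_of_nonneg ?_ hUv)) (ENNReal.mul_ne_top ENNReal.ofReal_ne_top hfin) key
  have : 1 / χ = 2 * (1 / (2 * χ)) := by field_simp
  have : 2 / (n : ℝ) = 2 * (1 / n) := by ring
  linarith

/-- For p ≤ 2 the integrability of |u|^p follows from L². For p > 2 it is reached in finitely many
gains by the factor χ, and one last gain leads to pχ. -/
theorem IsWeakSolution.locRpowIntegrable (hadm : IsAdmissible Ω A B Λ K)
    (hu : IsWeakSolution Ω A B u Du) (hn : 2 ≤ n) {χ : ℝ} (hχ : 1 < χ)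
    (hχn : 1 / 2 ≤ 1 / (n : ℝ) + 1 / (2 * χ)) {p l : ℝ} (hp : 1 < p) (hl : 0 < l) (hl' : l ≤ 1)
    (hell : IntEllipticWith Ω A p l) : LocRpowIntegrable Ω u (p * χ) := by
  have h2 := hu.sobolev.locRpowIntegrable_two
  refine hu.locRpowIntegrable_mul hadm hn hχ.le hχn hp hl hl' hell ?_
  rcases le_total p 2 with hp2 | hp2
  · exact h2.mono (by linarith) hp2
  obtain ⟨c, hc, hc₀⟩ := hadm.elliptic
  -- Each intermediate exponent lies between 2 and p, where ellipticity holds by interpolation. Its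
  -- constant involves the one at 2, which does no harm in a purely qualitative argument.
  have hk : ∀ k : ℕ, LocRpowIntegrable Ω u (min p (2 * χ ^ k)) := by
    intro k
    induction k with
    | zero => simpa [hp2] using h2
    | succ k ih =>
      have h1 : 1 ≤ χ ^ k := one_le_pow₀ hχ.le
      have hq2 : 2 ≤ min p (2 * χ ^ k) := le_min hp2 (by linarith)
      have hq := hadm.intEllipticWith_interpolate hc₀ hell hq2 (min_le_left _ _)
      have h3 := hu.locRpowIntegrable_mul hadm hn hχ.le hχn (by linarith) (lt_min hc hl)
        ((min_le_right _ _).trans hl') hq ih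
      refine h3.mono (le_min (by linarith) (by positivity)) ?_
      rw [min_mul_of_nonneg _ _ (by linarith)]
      refine min_le_min ?_ (by rw [pow_succ, mul_assoc])
      nlinarith
  obtain ⟨k, hkp⟩ := pow_unbounded_of_one_lt p hχ
  have := hk k
  rwa [min_eq_left (by linarith [show 0 < p by linarith])] at this

/-! ### Iteration -/

/-- The sequence a E^{j/(1-γ)} solves the recursion with equality. The quotients y_j then satisfy
y_j ≤ y_{j+1}^γ, so their supremum Y satisfies Y ≤ Y^γ, which forces Y ≤ 1. The a priori bound `b`
serves only to make Y finite. -/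
theorem le_of_iteration {γ D E : ℝ} (hγ0 : 0 < γ) (hγ : γ < 1) (hD : 0 < D) (hE : 1 ≤ E)
    {z : ℕ → ℝ} (hz : ∀ j, 0 ≤ z j) {b : ℝ} (hb : ∀ j, z j ≤ b)
    (h : ∀ j : ℕ, z j ≤ D * E ^ (j : ℝ) * z (j + 1) ^ γ) :
    z 0 ≤ (D * E ^ (γ / (1 - γ))) ^ (1 / (1 - γ)) := by
  have hγ' : 0 < 1 - γ := by linarith
  have hE0 : 0 < E := by linarith
  set s := 1 / (1 - γ) with hs
  have hs0 : 0 < s := by positivity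
  set a := (D * E ^ (γ / (1 - γ))) ^ s with ha
  have ha0 : 0 < a := by positivity
  have haa : a = D * E ^ (γ * s) * a ^ γ := by
    have h1 : a = a ^ (1 - γ) * a ^ γ := by
      rw [← Real.rpow_add ha0]; simp
    have h2 : a ^ (1 - γ) = D * E ^ (γ * s) := by
      rw [ha, ← Real.rpow_mul (by positivity), hs, one_div_mul_cancel hγ'.ne', Real.rpow_one]
      congr 2; ring
    rw [← h2]; exact h1
  set y : ℕ → ℝ := fun j => z j / (a * E ^ (s * j)) with hy
  have hpos : ∀ j : ℕ, 0 < a * E ^ (s * (j : ℝ)) := fun j => by positivity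
  have hy0 : ∀ j, 0 ≤ y j := fun j => div_nonneg (hz j) (hpos j).le
  have hyz : ∀ j, z j = y j * (a * E ^ (s * (j : ℝ))) := fun j => by
    simp only [hy]; rw [div_mul_cancel₀ _ (hpos j).ne']
  have hyy : ∀ j, y j ≤ y (j + 1) ^ γ := fun j => by
    have h1 := h j
    rw [hyz j, hyz (j + 1), Real.mul_rpow (hy0 _) (hpos _).le, Real.mul_rpow ha0.le (by positivity),
      ← Real.rpow_mul hE0.le] at h1
    have e1 : E ^ (j : ℝ) * E ^ (s * ((j + 1 : ℕ) : ℝ) * γ) = E ^ (γ * s) * E ^ (s * (j : ℝ)) := by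
      rw [← Real.rpow_add hE0, ← Real.rpow_add hE0]
      congr 1
      have : s * γ = s - 1 := by rw [hs]; field_simp; ring
      push_cast
      linear_combination (j : ℝ) * this
    have e2 : D * E ^ (j : ℝ) * (y (j + 1) ^ γ * (a ^ γ * E ^ (s * ((j + 1 : ℕ) : ℝ) * γ))) =
        y (j + 1) ^ γ * (a * E ^ (s * (j : ℝ))) := by
      calc _ = D * a ^ γ * y (j + 1) ^ γ *
            (E ^ (j : ℝ) * E ^ (s * ((j + 1 : ℕ) : ℝ) * γ)) := by ring
        _ = (D * E ^ (γ * s) * a ^ γ) * (y (j + 1) ^ γ * E ^ (s * (j : ℝ))) := by rw [e1]; ring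
        _ = _ := by rw [← haa]; ring
    rw [e2] at h1
    exact le_of_mul_le_mul_right h1 (hpos j)
  have hbdd : BddAbove (Set.range y) := by
    refine ⟨b / a, ?_⟩
    rintro _ ⟨j, rfl⟩
    have hb0 : 0 ≤ b := (hz 0).trans (hb 0)
    simp only [hy]
    gcongr
    · exact hb j
    · exact le_mul_of_one_le_right ha0.le (Real.one_le_rpow hE (by positivity))
  set Y := ⨆ j, y j with hY
  have hYle : ∀ j, y j ≤ Y := fun j => le_ciSup hbdd j
  have hY0 : 0 ≤ Y := (hy0 0).trans (hYle 0)
  have hYY : Y ≤ Y ^ γ := ciSup_le fun j =>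
    (hyy j).trans (Real.rpow_le_rpow (hy0 _) (hYle _) hγ0.le)
  have hY1 : Y ≤ 1 := by
    by_contra hcon
    rw [not_le] at hcon
    have := Real.rpow_lt_rpow_of_exponent_lt hcon hγ
    rw [Real.rpow_one] at this
    linarith
  have h0 := (hYle 0).trans hY1
  have e := hyz 0
  rw [Nat.cast_zero, mul_zero, Real.rpow_zero, mul_one] at e
  rw [e]
  exact mul_le_of_le_one_left ha0.le h0

/-- The identity for `Q` says that F^Q has the homogeneity of the recursion. Dividing by F^Q reduces
it to `le_of_iteration` with γ = bχ < 1, and the result does not depend on `Xmax`. -/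
theorem exists_iteration_const {χ b Q C : ℝ} (hχ : 1 < χ) (hb0 : 0 < b) (hb : b * χ < 1)
    (hQ : (1 - b) * χ + Q * (b * χ) = Q) (hQ0 : 0 < Q) (hC : 0 < C) :
    ∃ a : ℝ≥0, ∀ (X : ℕ → ℝ≥0∞) (Xmax F : ℝ≥0∞), Xmax ≠ ⊤ → F ≠ ⊤ → (∀ j, X j ≤ Xmax) →
      (∀ j : ℕ, X j ^ (1 / χ) ≤ ENNReal.ofReal (C * 4 ^ (j + 1)) * (F ^ (1 - b) * X (j + 1) ^ b)) →
      X 0 ≤ a * F ^ Q := by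
  have hχ0 : 0 < χ := by linarith
  have hb1 : b < 1 := by nlinarith
  set γ := b * χ with hγ
  set D : ℝ := (C * 4) ^ χ with hD
  set E : ℝ := 4 ^ χ with hE
  refine ⟨Real.toNNReal ((D * E ^ (γ / (1 - γ))) ^ (1 / (1 - γ))),
    fun X Xmax F hXmax hF hX h => ?_⟩
  have hXt : ∀ j, X j ≠ ⊤ := fun j => ne_top_of_le_ne_top hXmax (hX j)
  have hFb : F ^ (1 - b) ≠ ⊤ := ENNReal.rpow_ne_top_of_nonneg (by linarith) hF
  have hXb : ∀ j, X j ^ b ≠ ⊤ := fun j => ENNReal.rpow_ne_top_of_nonneg hb0.le (hXt j)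
  -- Normalisation by F^Q is impossible here, but since b < 1 the factor F^{1-b} vanishes and
  -- already gives X 0 = 0.
  by_cases hF0 : F = 0
  · have h0 := h 0
    rw [hF0, ENNReal.zero_rpow_of_pos (by linarith), zero_mul, mul_zero, nonpos_iff_eq_zero,
      ENNReal.rpow_eq_zero_iff] at h0
    rcases h0 with h0 | h0
    · rw [h0.1]; exact zero_le
    · exact absurd h0.1 (hXt 0)
  set f := F.toReal with hf
  have hf0 : 0 < f := ENNReal.toReal_pos hF0 hF
  have hfQ : 0 < f ^ Q := by positivity
  set x : ℕ → ℝ := fun j => (X j).toReal with hx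
  have hx0 : ∀ j, 0 ≤ x j := fun j => ENNReal.toReal_nonneg
  have hxx : ∀ j, x j ≤ (C * 4 ^ (j + 1) * (f ^ (1 - b) * x (j + 1) ^ b)) ^ χ := fun j => by
    have h1 := ENNReal.toReal_mono
      (ENNReal.mul_ne_top ENNReal.ofReal_ne_top (ENNReal.mul_ne_top hFb (hXb (j + 1)))) (h j)
    rw [ENNReal.toReal_mul, ENNReal.toReal_ofReal (by positivity), ENNReal.toReal_mul,
      ← ENNReal.toReal_rpow, ← ENNReal.toReal_rpow, ← ENNReal.toReal_rpow] at h1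
    have h2 := Real.rpow_le_rpow (Real.rpow_nonneg (hx0 j) _) h1 hχ0.le
    rwa [← Real.rpow_mul (hx0 j), one_div_mul_cancel hχ0.ne', Real.rpow_one] at h2
  set z : ℕ → ℝ := fun j => x j / f ^ Q with hz
  have hz0 : ∀ j, 0 ≤ z j := fun j => div_nonneg (hx0 j) hfQ.le
  have key := le_of_iteration (D := D) (E := E) (mul_pos hb0 hχ0) hb (by positivity)
    (Real.one_le_rpow (by norm_num) hχ0.le) hz0 (b := Xmax.toReal / f ^ Q)
    (fun j => by
      simp only [hz]
      gcongr
      exact ENNReal.toReal_mono hXmax (hX j))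
    (fun j => by
      have hxz : x (j + 1) = z (j + 1) * f ^ Q := by
        simp only [hz]; rw [div_mul_cancel₀ _ hfQ.ne']
      have h1 := hxx j
      rw [hxz] at h1
      have e1 : (C * 4 ^ (j + 1) * (f ^ (1 - b) * (z (j + 1) * f ^ Q) ^ b)) ^ χ =
          D * E ^ (j : ℝ) * z (j + 1) ^ γ * f ^ Q := by
        have hzj := hz0 (j + 1)
        rw [pow_succ, show C * (4 ^ j * 4) * (f ^ (1 - b) * (z (j + 1) * f ^ Q) ^ b) =
          (C * 4) * 4 ^ j * (f ^ (1 - b) * (z (j + 1) * f ^ Q) ^ b) by ring,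
          Real.mul_rpow (x := C * 4 * 4 ^ j) (by positivity) (by positivity),
          Real.mul_rpow (x := C * 4) (by positivity) (by positivity),
          Real.mul_rpow (x := f ^ (1 - b)) (by positivity) (by positivity),
          Real.mul_rpow hzj hfQ.le,
          Real.mul_rpow (x := z (j + 1) ^ b) (by positivity) (by positivity),
          ← Real.rpow_mul hzj, ← Real.rpow_mul hf0.le, ← Real.rpow_mul hf0.le,
          ← Real.rpow_mul hf0.le]
        have e2 : ((4 : ℝ) ^ j) ^ χ = E ^ (j : ℝ) := by
          rw [hE, ← Real.rpow_natCast, ← Real.rpow_mul (by norm_num), ← Real.rpow_mul (by norm_num),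
            mul_comm]
        have e3 : f ^ ((1 - b) * χ) * f ^ (Q * b * χ) = f ^ Q := by
          rw [← Real.rpow_add hf0]
          congr 1
          rw [mul_assoc]; exact hQ
        rw [e2, ← e3]
        ring
      rw [e1] at h1
      exact (div_le_iff₀ hfQ).2 h1)
  have h3 : x 0 ≤ (D * E ^ (γ / (1 - γ))) ^ (1 / (1 - γ)) * f ^ Q := (div_le_iff₀ hfQ).1 key
  calc X 0 = ENNReal.ofReal (x 0) := (ENNReal.ofReal_toReal (hXt 0)).symm
    _ ≤ ENNReal.ofReal ((D * E ^ (γ / (1 - γ))) ^ (1 / (1 - γ)) * f ^ Q) :=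
        ENNReal.ofReal_le_ofReal h3
    _ = _ := by
        rw [ENNReal.ofReal_mul (by positivity), ← ENNReal.ofReal_rpow_of_nonneg hf0.le hQ0.le,
          hf, ENNReal.ofReal_toReal hF]
        rfl

end

section

/-! ### Estimates on balls -/

variable {Ω : Set (Pt n)} {A : Pt n → Coef2 n m} {B : Pt n → Coef1 n m} {Λ K : ℝ≥0}
  {u : Pt n → Vec m} {Du : Pt n → Tens n m}

/-- The ball is connected and contains no frontier point, so it is covered by the disjoint open sets
Ω and the complement of its closure. Its centre lies in Ω. -/
theorem closedBall_subset_of_lt_bdryDist (hΩ : IsOpen Ω) {x : Pt n} (hx : x ∈ Ω) {R : ℝ}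
    (hR : 0 ≤ R) (h : ENNReal.ofReal R < bdryDist Ω x) : Metric.closedBall x R ⊆ Ω := by
  refine (convex_closedBall x R).isPreconnected.subset_left_of_subset_union hΩ
    (isClosed_closure (s := Ω)).isOpen_compl
    (Set.disjoint_left.2 fun y hy hy' => hy' (subset_closure hy)) (fun z hz => ?_)
    ⟨x, Metric.mem_closedBall_self hR, hx⟩
  by_contra hcon
  rw [Set.mem_union, not_or, Set.mem_compl_iff, not_not] at hcon
  have hzf : z ∈ frontier Ω := by
    rw [frontier, hΩ.interior_eq]
    exact ⟨hcon.2, hcon.1⟩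
  have h1 : bdryDist Ω x ≤ edist x z := Metric.infEDist_le_edist_of_mem hzf
  have h2 : edist x z ≤ ENNReal.ofReal R := by
    rw [edist_dist, dist_comm]
    exact ENNReal.ofReal_le_ofReal hz
  exact absurd (h1.trans h2) (not_le.2 h)

theorem ofReal_three_mul_lt {x : Pt n} {r : ℝ} (h : ENNReal.ofReal r < bdryDist Ω x / 3) :
    ENNReal.ofReal (3 * r) < bdryDist Ω x := by
  rw [ENNReal.lt_div_iff_mul_lt (Or.inl (by norm_num)) (Or.inl (by norm_num))] at h
  rw [mul_comm, ENNReal.ofReal_mul' (by norm_num)]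
  simpa using h

theorem le_bdryDist_of_mem {x y : Pt n} {r : ℝ} (hr : 0 < r)
    (h : ENNReal.ofReal r < bdryDist Ω x / 3) (hy : y ∈ Metric.closedBall x (2 * r)) :
    ENNReal.ofReal r ≤ bdryDist Ω y := by
  have h1 := ofReal_three_mul_lt h
  have h2 : bdryDist Ω x ≤ edist x y + bdryDist Ω y := Metric.infEDist_le_edist_add_infEDist
  have h3 : edist x y ≤ ENNReal.ofReal (2 * r) := by
    rw [edist_dist, dist_comm]
    exact ENNReal.ofReal_le_ofReal hy
  rw [show 3 * r = 2 * r + r by ring, ENNReal.ofReal_add (by positivity) hr.le] at h1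
  have h4 : ENNReal.ofReal (2 * r) + ENNReal.ofReal r ≤ ENNReal.ofReal (2 * r) + bdryDist Ω y :=
    h1.le.trans (h2.trans (by gcongr))
  exact (ENNReal.add_le_add_iff_left ENNReal.ofReal_ne_top).1 h4

/-- Since δ(x) > 3r, every point of the ball of radius 2r has distance at least r to the boundary,
whence |B| ≤ K/r there. This scales like the gradient of the cutoff. -/
theorem exists_ball_energyCutoff (n m : ℕ) : ∃ C : ℝ, 0 < C ∧
    ∀ (Ω : Set (Pt n)) (A : Pt n → Coef2 n m) (B : Pt n → Coef1 n m) (Λ K : ℝ≥0) (x : Pt n)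
      (r ρ ρ' : ℝ), IsAdmissible Ω A B Λ K → x ∈ Ω → 0 < r →
      ENNReal.ofReal r < bdryDist Ω x / 3 → r ≤ ρ → ρ < ρ' → ρ' ≤ 2 * r →
      ∃ η : Pt n → ℝ, EnergyCutoff Ω B η (C / (ρ' - ρ) ^ 2) (K / r) ∧
        tsupport η ⊆ Metric.ball x ρ' ∧ ∀ y ∈ Metric.ball x ρ, η y = 1 := by
  obtain ⟨C, hC, h⟩ := exists_ball_cutoff n
  refine ⟨C, hC, fun Ω A B Λ K x r ρ ρ' hadm hx hr hδ hrρ hρρ' hρ'r => ?_⟩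
  obtain ⟨η, hη, h0, h1, hη1, hgrad⟩ := h x ρ ρ' (by linarith) hρρ'
  have hsub : Metric.ball x ρ' ⊆ Metric.closedBall x (2 * r) :=
    Metric.ball_subset_closedBall.trans (Metric.closedBall_subset_closedBall hρ'r)
  have hsubΩ : Metric.closedBall x (2 * r) ⊆ Ω :=
    (Metric.closedBall_subset_closedBall (by linarith)).trans
      (closedBall_subset_of_lt_bdryDist hadm.isOpen hx (by positivity) (ofReal_three_mul_lt hδ))
  have hηΩ : IsTest Ω η := hη.mono (hsub.trans hsubΩ)
  have hρ : 0 < ρ' - ρ := by linarith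
  refine ⟨η, ⟨hηΩ, h0, h1, hgrad, by positivity, by positivity, ?_⟩, hη.2.2, hη1⟩
  exact hadm.ae_boundB_of_le hηΩ.2.2 hη.2.1.measurableSet hr
    fun y hy => le_bdryDist_of_mem hr hδ (hsub (hη.2.2 hy))

theorem volume_ball_eq (x : Pt n) {R : ℝ} (hR : 0 < R) :
    volume (Metric.ball x R) =
      ENNReal.ofReal (R ^ n * (volume (Metric.ball (0 : Pt n) 1)).toReal) := by
  rw [Measure.addHaar_ball_of_pos _ _ hR, finrank_euclideanSpace_fin, ENNReal.ofReal_mul (by positivity),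
    ENNReal.ofReal_toReal measure_ball_lt_top.ne]

theorem volume_unit_ball_pos : 0 < (volume (Metric.ball (0 : Pt n) 1)).toReal :=
  ENNReal.toReal_pos (Metric.measure_ball_pos _ _ one_pos).ne' measure_ball_lt_top.ne

/-- With radii r and 2r the cutoff estimate has a constant of the form N/r², and 2^n is the ratio of
the two volumes. Replacing `c` by `min c 1` meets the normalisation l₁ ≤ 1. -/
theorem exists_caccioppoli_const (n m : ℕ) (K Λ : ℝ≥0) {p c : ℝ} (hp : 1 < p) (hc : 0 < c) :
    ∃ C : ℝ≥0, ∀ (Ω : Set (Pt n)) (A : Pt n → Coef2 n m) (B : Pt n → Coef1 n m),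
      IsAdmissible Ω A B Λ K → IntEllipticWith Ω A p c →
      ∀ (u : Pt n → Vec m) (Du : Pt n → Tens n m), IsWeakSolution Ω A B u Du →
      ∀ x ∈ Ω, ∀ r : ℝ, 0 < r → ENNReal.ofReal r < bdryDist Ω x / 3 → Caccioppoli u Du p C x r := by
  obtain ⟨C₀, hC₀, hcut⟩ := exists_ball_energyCutoff n m
  set l := min c 1 with hl
  have hl0 : 0 < l := lt_min hc one_pos
  set N : ℝ := 9600 * (1 + (n * m) ^ 2 * Λ) ^ 2 * (C₀ + (n * m ^ 2 * K) ^ 2) / l ^ 2 with hN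
  have hN0 : 0 < N := by positivity
  refine ⟨Real.toNNReal (2 ^ n * N), fun Ω A B hadm hell u Du hu x hx r hr hδ => ?_⟩
  obtain ⟨η, hη, hηs, hη1⟩ := hcut Ω A B Λ K x r r (2 * r) hadm hx hr hδ le_rfl (by linarith) le_rfl
  have key := caccioppoli_of_cutoff hadm hu hη hp hl0 (min_le_right _ _)
    (hell.mono (min_le_left _ _)) measurableSet_ball hη1
  have e1 : 9600 * (1 + (n * m : ℝ) ^ 2 * Λ) ^ 2 *
      (C₀ / (2 * r - r) ^ 2 + (n * m ^ 2 * (K / r)) ^ 2) / l ^ 2 = N / r ^ 2 := by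
    rw [hN, show 2 * r - r = r by ring]; field_simp
  rw [e1] at key
  set κ := (volume (Metric.ball (0 : Pt n) 1)).toReal
  have hκ : 0 < κ := volume_unit_ball_pos
  rw [Caccioppoli, setLAverage_eq, setLAverage_eq, volume_ball_eq x hr,
    volume_ball_eq x (by positivity : 0 < 2 * r)]
  set I := ∫⁻ y in Metric.ball x (2 * r), ‖u y‖ₑ ^ p
  have hI : ∫⁻ y in tsupport η, ‖u y‖ₑ ^ p ≤ I := lintegral_mono_set hηs
  have e2 : ENNReal.ofReal (N / r ^ 2) / ENNReal.ofReal (r ^ n * κ) =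
      Real.toNNReal (2 ^ n * N) / ENNReal.ofReal r ^ 2 / ENNReal.ofReal ((2 * r) ^ n * κ) := by
    rw [← ENNReal.ofReal_pow hr.le, ← ENNReal.ofReal_div_of_pos (by positivity)]
    change _ = ENNReal.ofReal (2 ^ n * N) / _ / _
    rw [← ENNReal.ofReal_div_of_pos (by positivity), ← ENNReal.ofReal_div_of_pos (by positivity)]
    congr 1
    rw [mul_pow]
    field_simp
  calc _ ≤ ENNReal.ofReal (N / r ^ 2) * I / ENNReal.ofReal (r ^ n * κ) := by
        gcongr
        exact key.trans (by gcongr)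
    _ = ENNReal.ofReal (N / r ^ 2) / ENNReal.ofReal (r ^ n * κ) * I := by
        rw [ENNReal.mul_div_right_comm]
    _ = _ := by
        rw [e2]
        simp only [div_eq_mul_inv]
        ring

/-- The gain of integrability on concentric balls, in scale invariant form. -/
theorem exists_ball_gain_const (m : ℕ) (hn : 2 ≤ n) (K Λ : ℝ≥0) {χ : ℝ} (hχ : 1 < χ)
    (hχn : 1 / 2 ≤ 1 / (n : ℝ) + 1 / (2 * χ)) {p c : ℝ} (hp : 1 < p) (hc : 0 < c) :
    ∃ C : ℝ, 0 < C ∧ ∀ (Ω : Set (Pt n)) (A : Pt n → Coef2 n m) (B : Pt n → Coef1 n m)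
      (u : Pt n → Vec m) (Du : Pt n → Tens n m) (x : Pt n) (r ρ ρ' : ℝ),
      IsAdmissible Ω A B Λ K → IntEllipticWith Ω A p c → IsWeakSolution Ω A B u Du → x ∈ Ω →
      0 < r → ENNReal.ofReal r < bdryDist Ω x / 3 → r ≤ ρ → ρ < ρ' → ρ' ≤ 2 * r →
      ((volume (Metric.ball x (2 * r)))⁻¹ * ∫⁻ y in Metric.ball x ρ, ‖u y‖ₑ ^ (p * χ)) ^ (1 / χ) ≤
        ENNReal.ofReal (C * (r / (ρ' - ρ)) ^ 2) *
          ((volume (Metric.ball x (2 * r)))⁻¹ * ∫⁻ y in Metric.ball x ρ', ‖u y‖ₑ ^ p) := by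
  obtain ⟨C₀, hC₀, hcut⟩ := exists_ball_energyCutoff n m
  obtain ⟨C₁, hgain⟩ := exists_gain_const m hn hχ.le hχn
  set l := min c 1 with hl
  have hl0 : 0 < l := lt_min hc one_pos
  have hl1 : l ≤ 1 := min_le_right _ _
  have hχ0 : 0 < χ := by linarith
  have hn0 : (n : ℝ) ≠ 0 := by positivity
  set N : ℝ := 19202 * (1 + (n * m) ^ 2 * Λ) ^ 2 * (C₀ + (n * m ^ 2 * K) ^ 2) / l ^ 2 with hN
  have hN0 : 0 < N := by positivity
  set e : ℝ := 2 / (n : ℝ) + 1 / χ - 1 with he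
  set κ := (volume (Metric.ball (0 : Pt n) 1)).toReal
  have hκ : 0 < κ := volume_unit_ball_pos
  refine ⟨(C₁ + 1) * ((3 / 2) ^ n) ^ e * N * (2 ^ n * κ) ^ (2 / (n : ℝ)), by positivity,
    fun Ω A B u Du x r ρ ρ' hadm hell hu hx hr hδ hrρ hρρ' hρ'r => ?_⟩
  have hell' : IntEllipticWith Ω A p l := hell.mono (min_le_left _ _)
  obtain ⟨η, hη, hηs, hη1⟩ := hcut Ω A B Λ K x r ρ ρ' hadm hx hr hδ hrρ hρρ' hρ'r
  have h3Ω : Metric.closedBall x (3 * r) ⊆ Ω :=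
    closedBall_subset_of_lt_bdryDist hadm.isOpen hx (by positivity) (ofReal_three_mul_lt hδ)
  have hloc : LocRpowIntegrable Ω u p :=
    (hu.locRpowIntegrable hadm hn hχ hχn hp hl0 hl1 hell').mono (by linarith) (by nlinarith)
  have hfin := hloc _ hη.isTest.2.1 hη.isTest.2.2
  have key := hgain Ω A B Λ K u Du η _ _ p l (Metric.ball x (3 * r)) (Metric.ball x ρ) hadm hu hη
    Metric.isOpen_ball (Metric.ball_subset_closedBall.trans h3Ω) measure_ball_lt_top.ne
    (hηs.trans (Metric.ball_subset_ball (by linarith))) hp hl0 hl1 hell' measurableSet_ball hη1 hfin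
  set I := ∫⁻ y in Metric.ball x ρ', ‖u y‖ₑ ^ p
  have hI : ∫⁻ y in tsupport η, ‖u y‖ₑ ^ p ≤ I := lintegral_mono_set hηs
  have hd : 0 < ρ' - ρ := by linarith
  have hdr : ρ' - ρ ≤ r := by linarith
  have hNle : 19202 * (1 + (n * m : ℝ) ^ 2 * Λ) ^ 2 *
      (C₀ / (ρ' - ρ) ^ 2 + (n * m ^ 2 * (K / r)) ^ 2) / l ^ 2 ≤ N / (ρ' - ρ) ^ 2 := by
    have h1 : (n * m ^ 2 * (K / r) : ℝ) ≤ n * m ^ 2 * (K / (ρ' - ρ)) := by gcongr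
    calc _ ≤ 19202 * (1 + (n * m : ℝ) ^ 2 * Λ) ^ 2 *
          (C₀ / (ρ' - ρ) ^ 2 + (n * m ^ 2 * (K / (ρ' - ρ))) ^ 2) / l ^ 2 := by gcongr
      _ = _ := by rw [hN]; field_simp
  set v : ℝ := (2 * r) ^ n * κ with hv
  have hv0 : 0 < v := by positivity
  have hU : volume (Metric.ball x (3 * r)) = ENNReal.ofReal ((3 / 2) ^ n * v) := by
    rw [volume_ball_eq x (by positivity)]
    congr 1
    rw [hv, ← mul_assoc, ← mul_pow]
    congr 2; ring
  have hV : volume (Metric.ball x (2 * r)) = ENNReal.ofReal v := volume_ball_eq x (by positivity)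
  rw [hU] at key
  rw [hV, ← ENNReal.ofReal_inv_of_pos hv0, ENNReal.mul_rpow_of_nonneg _ _ (by positivity)]
  -- Scale invariance: the exponents of the volume v combine to v^{2/n} v⁻¹, and v^{2/n} is a
  -- constant times r², which turns (ρ' - ρ)^{-2} into (r/(ρ' - ρ))².
  have hreal : (v⁻¹) ^ (1 / χ) * ((C₁ + 1) * ((3 / 2) ^ n * v) ^ e * (N / (ρ' - ρ) ^ 2)) =
      (C₁ + 1) * ((3 / 2) ^ n) ^ e * N * (2 ^ n * κ) ^ (2 / (n : ℝ)) * (r / (ρ' - ρ)) ^ 2 * v⁻¹ := by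
    have e1 : (v⁻¹) ^ (1 / χ) * v ^ e = v ^ (2 / (n : ℝ)) * v⁻¹ := by
      rw [Real.inv_rpow hv0.le, ← Real.rpow_neg hv0.le, ← Real.rpow_neg_one v,
        ← Real.rpow_add hv0, ← Real.rpow_add hv0]
      congr 1; rw [he]; ring
    have e2 : v ^ (2 / (n : ℝ)) = (2 ^ n * κ) ^ (2 / (n : ℝ)) * r ^ 2 := by
      have : v = 2 ^ n * κ * r ^ n := by rw [hv, mul_pow]; ring
      rw [this, Real.mul_rpow (by positivity) (by positivity), ← Real.rpow_natCast r n,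
        ← Real.rpow_mul hr.le, mul_div_cancel₀ _ hn0, ← Real.rpow_natCast r 2]
      norm_num
    rw [Real.mul_rpow (by positivity) hv0.le]
    calc _ = (C₁ + 1) * ((3 / 2) ^ n) ^ e * (N / (ρ' - ρ) ^ 2) * ((v⁻¹) ^ (1 / χ) * v ^ e) := by ring
      _ = _ := by rw [e1, e2]; field_simp
  have hC1 : (C₁ : ℝ≥0∞) ≤ ENNReal.ofReal (C₁ + 1) := by
    rw [← ENNReal.ofReal_coe_nnreal]
    exact ENNReal.ofReal_le_ofReal (by linarith)
  calc _ ≤ ENNReal.ofReal v⁻¹ ^ (1 / χ) * (ENNReal.ofReal (C₁ + 1) *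
        ENNReal.ofReal ((3 / 2) ^ n * v) ^ e * (ENNReal.ofReal (N / (ρ' - ρ) ^ 2) * I)) := by
        gcongr
        refine key.trans ?_
        gcongr
    _ = ENNReal.ofReal ((v⁻¹) ^ (1 / χ) *
          ((C₁ + 1) * ((3 / 2) ^ n * v) ^ e * (N / (ρ' - ρ) ^ 2))) * I := by
        rw [ENNReal.ofReal_rpow_of_pos (by positivity), ENNReal.ofReal_rpow_of_pos (by positivity),
          ENNReal.ofReal_mul (by positivity), ENNReal.ofReal_mul (by positivity),
          ENNReal.ofReal_mul (p := C₁ + 1) (by positivity)]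
        ring
    _ = _ := by
        rw [hreal, ENNReal.ofReal_mul (by positivity)]
        ring

end

section

/-! ### The reverse Hölder inequality -/

/-- On an increasing sequence of balls, the gain from p to Q = pχ is combined with the interpolation
of L^p between L¹ and L^Q. The recursion is closed by `exists_iteration_const`, and Jensen's
inequality descends from Q to q. -/
theorem exists_reverseHolder_const (m : ℕ) (hn : 2 ≤ n) (K Λ : ℝ≥0) {χ : ℝ} (hχ : 1 < χ)
    (hχn : 1 / 2 ≤ 1 / (n : ℝ) + 1 / (2 * χ)) {p c q : ℝ} (hp : 1 < p) (hc : 0 < c) (hq : 1 ≤ q)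
    (hqp : q ≤ p * χ) :
    ∃ C : ℝ≥0, ∀ (Ω : Set (Pt n)) (A : Pt n → Coef2 n m) (B : Pt n → Coef1 n m),
      IsAdmissible Ω A B Λ K → IntEllipticWith Ω A p c →
      ∀ (u : Pt n → Vec m) (Du : Pt n → Tens n m), IsWeakSolution Ω A B u Du →
      ∀ x ∈ Ω, ∀ r : ℝ, 0 < r → ENNReal.ofReal r < bdryDist Ω x / 3 → ReverseHolder u q C x r := by
  obtain ⟨C₁, hC₁, hgain⟩ := exists_ball_gain_const m hn K Λ hχ hχn hp hc
  set Q := p * χ with hQ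
  have hχ0 : 0 < χ := by linarith
  have hpQ : p < Q := by rw [hQ]; nlinarith
  have hQ1 : 0 < Q - 1 := by linarith
  have hQ0 : 0 < Q := by linarith
  -- The interpolation exponent: p = (1 - b) · 1 + bQ. The iteration converges because bχ < 1, that
  -- is (p - 1)χ < pχ - 1, which is just χ > 1.
  set b := (p - 1) / (Q - 1) with hb
  have hb0 : 0 < b := div_pos (by linarith) hQ1
  have hb1 : b < 1 := (div_lt_one hQ1).2 (by linarith)
  have hbχ : b * χ < 1 := by
    rw [hb, div_mul_eq_mul_div, div_lt_one hQ1, hQ]; nlinarith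
  have hbp : 1 - b + Q * b = p := by
    rw [hb]; field_simp; ring
  obtain ⟨a, ha⟩ := exists_iteration_const hχ hb0 hbχ (Q := Q)
    (by rw [← mul_assoc, ← add_mul, hbp]) hQ0 hC₁
  refine ⟨(2 ^ n * a) ^ (1 / Q), fun Ω A B hadm hell u Du hu x hx r hr hδ => ?_⟩
  have hloc : LocRpowIntegrable Ω u Q :=
    hu.locRpowIntegrable hadm hn hχ hχn hp (lt_min hc one_pos) (min_le_right _ _)
      (hell.mono (min_le_left _ _))
  have h2Ω : Metric.closedBall x (2 * r) ⊆ Ω :=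
    (Metric.closedBall_subset_closedBall (by linarith)).trans
      (closedBall_subset_of_lt_bdryDist hadm.isOpen hx (by positivity) (ofReal_three_mul_lt hδ))
  have hcomp : IsCompact (Metric.closedBall x (2 * r)) := isCompact_closedBall x (2 * r)
  have mu : AEStronglyMeasurable u (volume.restrict (Metric.ball x (2 * r))) :=
    (hu.sobolev.memLp _ hcomp h2Ω).1.mono_measure
      (Measure.restrict_mono_set _ Metric.ball_subset_closedBall)
  set V := volume (Metric.ball x (2 * r)) with hV
  have hVi : V⁻¹ ≠ ⊤ := ENNReal.inv_ne_top.2 (Metric.measure_ball_pos _ _ (by positivity)).ne'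
  -- The gaps are r/2^{j+1}, so the constant of the gain grows like 4^{j+1}. The radii start at r
  -- and stay below 2r.
  set ρ : ℕ → ℝ := fun j => 2 * r - r / 2 ^ j with hρ
  have hρ0 : ρ 0 = r := by simp only [hρ]; ring
  have hρr : ∀ j, r ≤ ρ j := fun j => by
    have : r / 2 ^ j ≤ r := div_le_self hr.le (one_le_pow₀ (by norm_num))
    simp only [hρ]; linarith
  have hρ2 : ∀ j, ρ j ≤ 2 * r := fun j => by
    have : 0 < r / 2 ^ j := by positivity
    simp only [hρ]; linarith
  have hρd : ∀ j, ρ (j + 1) - ρ j = r / 2 ^ (j + 1) := fun j => by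
    simp only [hρ]; field_simp; ring
  have hρlt : ∀ j, ρ j < ρ (j + 1) := fun j => by
    have := hρd j
    have : 0 < r / 2 ^ (j + 1) := by positivity
    linarith
  have hsub : ∀ j, Metric.ball x (ρ j) ⊆ Metric.ball x (2 * r) := fun j =>
    Metric.ball_subset_ball (hρ2 j)
  set X : ℕ → ℝ≥0∞ := fun j => V⁻¹ * ∫⁻ y in Metric.ball x (ρ j), ‖u y‖ₑ ^ Q with hX
  set F := V⁻¹ * ∫⁻ y in Metric.ball x (2 * r), ‖u y‖ₑ with hF
  have hball : ∀ s : ℝ, LocRpowIntegrable Ω u s →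
      ∫⁻ y in Metric.ball x (2 * r), ‖u y‖ₑ ^ s ≠ ⊤ := fun s hs =>
    ne_top_of_le_ne_top (hs _ hcomp h2Ω) (lintegral_mono_set Metric.ball_subset_closedBall)
  have hFt : F ≠ ⊤ := by
    refine ENNReal.mul_ne_top hVi ?_
    have := hball 1 (hloc.mono (by norm_num) (by linarith))
    simpa using this
  have hiter : ∀ j : ℕ,
      X j ^ (1 / χ) ≤ ENNReal.ofReal (C₁ * 4 ^ (j + 1)) * (F ^ (1 - b) * X (j + 1) ^ b) := by
    intro j
    have h1 := hgain Ω A B u Du x r (ρ j) (ρ (j + 1)) hadm hell hu hx hr hδ (hρr j) (hρlt j)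
      (hρ2 (j + 1))
    have e1 : (r / (ρ (j + 1) - ρ j)) ^ 2 = 4 ^ (j + 1) := by
      rw [hρd j, div_div_eq_mul_div, mul_div_cancel_left₀ _ hr.ne', ← pow_mul, mul_comm, pow_mul]
      norm_num
    rw [e1] at h1
    refine h1.trans (mul_le_mul_right ?_ _)
    set ν : Measure (Pt n) := V⁻¹ • volume.restrict (Metric.ball x (ρ (j + 1))) with hν
    have mu' : AEMeasurable (fun y => ‖u y‖ₑ) ν :=
      ((mu.mono_measure (Measure.restrict_mono_set _ (hsub (j + 1)))).enorm).smul_measure _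
    have h2 := ENNReal.lintegral_mul_norm_pow_le mu' (mu'.pow_const Q)
      (by linarith : 0 ≤ 1 - b) hb0.le (by ring)
    have e2 : ∀ z : ℝ≥0∞, z ^ (1 - b) * (z ^ Q) ^ b = z ^ p := fun z => by
      rw [← ENNReal.rpow_mul, ← ENNReal.rpow_add_of_nonneg _ _ (by linarith) (by positivity), hbp]
    simp only [e2] at h2
    rw [hν, lintegral_smul_measure, lintegral_smul_measure, lintegral_smul_measure] at h2
    refine h2.trans ?_
    gcongr
    · exact mul_le_mul_right (lintegral_mono_set (hsub (j + 1))) _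
    · exact le_rfl
  have key := ha X (V⁻¹ * ∫⁻ y in Metric.ball x (2 * r), ‖u y‖ₑ ^ Q) F
    (ENNReal.mul_ne_top hVi (hball Q hloc)) hFt
    (fun j => mul_le_mul_right (lintegral_mono_set (hsub j)) _) hiter
  have eF : ⨍⁻ y in Metric.ball x (2 * r), ‖u y‖ₑ ∂volume = F := by
    rw [setLAverage_eq, hF, div_eq_mul_inv, mul_comm]
  have hvol : (volume (Metric.ball x r))⁻¹ = 2 ^ n * V⁻¹ := by
    have hκ : 0 < (volume (Metric.ball (0 : Pt n) 1)).toReal := volume_unit_ball_pos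
    rw [hV, volume_ball_eq x hr, volume_ball_eq x (by positivity : 0 < 2 * r),
      ← ENNReal.ofReal_inv_of_pos (by positivity), ← ENNReal.ofReal_inv_of_pos (by positivity)]
    have e2 : (2 : ℝ≥0∞) ^ n = ENNReal.ofReal (2 ^ n) := by
      rw [ENNReal.ofReal_pow (by norm_num)]; norm_num
    rw [e2, ← ENNReal.ofReal_mul (by positivity)]
    congr 1
    rw [mul_pow]
    field_simp
  have eX : ⨍⁻ y in Metric.ball x r, ‖u y‖ₑ ^ Q ∂volume = 2 ^ n * X 0 := by
    rw [setLAverage_eq, div_eq_mul_inv, hvol]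
    simp only [hX]
    rw [hρ0]; ring
  -- The average is taken with respect to a probability measure, for which power means increase with
  -- the exponent.
  have hjensen : (⨍⁻ y in Metric.ball x r, ‖u y‖ₑ ^ q ∂volume) ^ (1 / q) ≤
      (⨍⁻ y in Metric.ball x r, ‖u y‖ₑ ^ Q ∂volume) ^ (1 / Q) := by
    set μ := volume.restrict (Metric.ball x r) with hμ
    have hμ0 : NeZero μ := ⟨by
      rw [hμ, Ne, Measure.restrict_eq_zero]
      exact (Metric.measure_ball_pos _ _ hr).ne'⟩
    have hμf : IsFiniteMeasure μ := ⟨by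
      rw [hμ, Measure.restrict_apply_univ]; exact measure_ball_lt_top⟩
    have mur : AEStronglyMeasurable u μ :=
      mu.mono_measure (Measure.restrict_mono_set _ (Metric.ball_subset_ball (by linarith)))
    exact eLpNorm'_le_eLpNorm'_of_exponent_le (by linarith) hqp ((μ Set.univ)⁻¹ • μ)
      (mur.smul_measure _)
  rw [ReverseHolder, eF]
  refine hjensen.trans ?_
  rw [eX]
  calc (2 ^ n * X 0) ^ (1 / Q) ≤ (2 ^ n * (a * F ^ Q)) ^ (1 / Q) := by gcongr
    _ = _ := by
        rw [← mul_assoc, ENNReal.mul_rpow_of_nonneg _ _ (by positivity), ← ENNReal.rpow_mul,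
          mul_one_div_cancel hQ0.ne', ENNReal.rpow_one,
          ENNReal.coe_rpow_of_nonneg _ (by positivity : 0 ≤ 1 / Q)]
        push_cast
        rfl

/-! ### The range of exponents -/

variable {Ω : Set (Pt n)} {A : Pt n → Coef2 n m} {B : Pt n → Coef1 n m} {Λ K : ℝ≥0}

theorem one_lt_of_conjExponent_lt {s : ℝ≥0∞} {p : ℝ}
    (h : ENNReal.conjExponent s < ENNReal.ofReal p) : 1 < p := by
  have h1 : 1 < ENNReal.ofReal p := lt_of_le_of_lt (by rw [ENNReal.conjExponent]; exact le_self_add) h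
  simpa using h1

theorem IsAdmissible.two_lt_pZero (hadm : IsAdmissible Ω A B Λ K) : 2 < pZero Ω A := by
  obtain ⟨p, hp, hell⟩ := hadm.exists_gt_two
  refine lt_of_lt_of_le ?_ (le_sSup ⟨p, ⟨by linarith, hell⟩, rfl⟩)
  rw [show (2 : ℝ≥0∞) = ENNReal.ofReal 2 by norm_num]
  exact (ENNReal.ofReal_lt_ofReal_iff (by linarith)).2 hp

theorem IsAdmissible.conjExponent_pZero_le (hadm : IsAdmissible Ω A B Λ K) :
    ENNReal.conjExponent (pZero Ω A) ≤ 2 := by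
  have h1 : 1 ≤ pZero Ω A - 1 := by
    have : (2 : ℝ≥0∞) - 1 ≤ pZero Ω A - 1 := tsub_le_tsub_right hadm.two_lt_pZero.le 1
    calc (1 : ℝ≥0∞) = 2 - 1 := by rw [← one_add_one_eq_two]; simp
      _ ≤ _ := this
  rw [ENNReal.conjExponent, ← one_add_one_eq_two]
  gcongr
  exact ENNReal.inv_le_one.2 h1

/-- Below the supremum there is an exponent of ellipticity larger than `p`, and interpolation with 2
fills the gap. The range thus has no holes above 2. -/
theorem IsAdmissible.intElliptic_of_lt (hadm : IsAdmissible Ω A B Λ K) {p : ℝ} (hp : 2 ≤ p)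
    (h : ENNReal.ofReal p < pZero Ω A) : IntElliptic Ω A p := by
  obtain ⟨_, ⟨p₁, ⟨hp₁, c₁, hc₁, h₁⟩, rfl⟩, hlt⟩ := lt_sSup_iff.1 h
  obtain ⟨c, hc, h₀⟩ := hadm.elliptic
  have hpp : p < p₁ := (ENNReal.ofReal_lt_ofReal_iff (by linarith)).1 hlt
  exact ⟨min c c₁, lt_min hc hc₁, hadm.intEllipticWith_interpolate h₀ h₁ hp hpp.le⟩

/-- The condition on q is the lower bound t > q(n - 2)/n, satisfied by p₀, hence by some t < p₀ that
can also be taken larger than 2. Such t exceeds p₀' ≤ 2 and belongs to the range of ellipticity. -/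
theorem IsAdmissible.exists_exponent (hadm : IsAdmissible Ω A B Λ K) (hn : 2 ≤ n) {q : ℝ}
    (hq : ENNReal.ofReal q < sobolevExp n (pZero Ω A)) :
    ∃ p : ℝ, ENNReal.conjExponent (pZero Ω A) < ENNReal.ofReal p ∧
      ENNReal.ofReal p < pZero Ω A ∧ ENNReal.ofReal q < sobolevExp n (ENNReal.ofReal p) ∧
      IntElliptic Ω A p := by
  have hmono : ∃ s : ℝ≥0∞, s < pZero Ω A ∧ ∀ t, s < t → ENNReal.ofReal q < sobolevExp n t := by
    have hn0 : (n : ℝ≥0∞) ≠ 0 := by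
      rw [Ne, Nat.cast_eq_zero]; omega
    have hiff : ∀ t, ENNReal.ofReal q < sobolevExp n t ↔
        ENNReal.ofReal q * ((n - 2 : ℕ) : ℝ≥0∞) / n < t := fun t => by
      rw [sobolevExp, ENNReal.lt_div_iff_mul_lt (Or.inr ENNReal.ofReal_ne_top)
        (Or.inl (ENNReal.natCast_ne_top _)), ENNReal.div_lt_iff (Or.inl hn0)
        (Or.inl (ENNReal.natCast_ne_top _))]
    exact ⟨_, (hiff _).1 hq, fun t ht => (hiff t).2 ht⟩
  obtain ⟨s, hs, hst⟩ := hmono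
  obtain ⟨t, ht, htp⟩ := exists_between (max_lt hs hadm.two_lt_pZero)
  have htt : t ≠ ⊤ := htp.ne_top
  have h2t : 2 < t := (le_max_right _ _).trans_lt ht
  refine ⟨t.toReal, ?_⟩
  rw [ENNReal.ofReal_toReal htt]
  refine ⟨hadm.conjExponent_pZero_le.trans_lt h2t, htp, hst t ((le_max_left _ _).trans_lt ht),
    hadm.intElliptic_of_lt ?_ (by rwa [ENNReal.ofReal_toReal htt])⟩
  have := ENNReal.toReal_mono htt h2t.le
  simpa using this

/-- The Sobolev gain `χ` reaches the exponent `q`. -/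
theorem exists_gain_exponent (hn : 2 ≤ n) {p q : ℝ} (hp : 0 < p)
    (hq : ENNReal.ofReal q < sobolevExp n (ENNReal.ofReal p)) :
    ∃ χ : ℝ, 1 < χ ∧ 1 / 2 ≤ 1 / (n : ℝ) + 1 / (2 * χ) ∧ q ≤ p * χ := by
  rcases hn.eq_or_lt with rfl | hn3
  -- In dimension 2 every χ is admissible, because 1/n already equals 1/2. For n ≥ 3 the choice n/(n
  -- - 2) is the limiting case, with equality.
  · refine ⟨max 2 (q / p), lt_max_of_lt_left (by norm_num), ?_, ?_⟩
    · have : (0 : ℝ) < max 2 (q / p) := lt_max_of_lt_left (by norm_num)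
      push_cast
      have : 0 < 1 / (2 * max 2 (q / p)) := by positivity
      linarith
    · calc q = p * (q / p) := by field_simp
        _ ≤ _ := by gcongr; exact le_max_right _ _
  · have hn3' : (3 : ℝ) ≤ n := by exact_mod_cast hn3
    have h0 : (0 : ℝ) < n - 2 := by linarith
    refine ⟨n / (n - 2), (one_lt_div h0).2 (by linarith), le_of_eq ?_, ?_⟩
    · field_simp
      ring
    · rw [sobolevExp, ← ENNReal.ofReal_natCast, ← ENNReal.ofReal_natCast,
        ← ENNReal.ofReal_mul hp.le, Nat.cast_sub hn, Nat.cast_ofNat,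
        ← ENNReal.ofReal_div_of_pos h0] at hq
      have := (ENNReal.ofReal_lt_ofReal_iff (by positivity)).1 hq
      rw [← mul_div_assoc]
      exact this.le

end

end EllipticSystem

end

/-! ### Choice of the constants and conclusion -/

theorem theorem3p1 (n m : ℕ) (hn : 2 ≤ n) (K Λ : ℝ≥0) :
    -- Caccioppoli inequality: `C` is a function of `n, m, K, Λ, p` and of the constant `c = λ_p`
    (∀ p : ℝ, ∃ C : ℝ → ℝ≥0,
      ∀ (Ω : Set (EllipticSystem.Pt n)) (A : EllipticSystem.Pt n → EllipticSystem.Coef2 n m)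
        (B : EllipticSystem.Pt n → EllipticSystem.Coef1 n m),
        EllipticSystem.IsAdmissible Ω A B Λ K →
        ENNReal.conjExponent (EllipticSystem.pZero Ω A) < ENNReal.ofReal p →
        ENNReal.ofReal p < EllipticSystem.pZero Ω A →
        (2 ≤ p → EllipticSystem.IntElliptic Ω A p) ∧
        ∀ c : ℝ, 0 < c → EllipticSystem.IntEllipticWith Ω A p c →
          ∀ (u : EllipticSystem.Pt n → EllipticSystem.Vec m)
            (Du : EllipticSystem.Pt n → EllipticSystem.Tens n m),
            EllipticSystem.IsWeakSolution Ω A B u Du →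
            ∀ x ∈ Ω, ∀ r : ℝ, 0 < r → ENNReal.ofReal r < EllipticSystem.bdryDist Ω x / 3 →
              EllipticSystem.Caccioppoli u Du p (C c) x r) ∧
    -- reverse Hölder inequality: `C` is a function of `n, m, K, Λ, q` and of `p` and `c = λ_p`,
    -- for any exponent `p` of the ellipticity range such that `q < p n / (n - 2)`
    (∀ q : ℝ, 1 ≤ q → ∃ C : ℝ → ℝ → ℝ≥0,
      ∀ (Ω : Set (EllipticSystem.Pt n)) (A : EllipticSystem.Pt n → EllipticSystem.Coef2 n m)
        (B : EllipticSystem.Pt n → EllipticSystem.Coef1 n m),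
        EllipticSystem.IsAdmissible Ω A B Λ K →
        ENNReal.ofReal q < EllipticSystem.sobolevExp n (EllipticSystem.pZero Ω A) →
        (∃ p : ℝ, ENNReal.conjExponent (EllipticSystem.pZero Ω A) < ENNReal.ofReal p ∧
          ENNReal.ofReal p < EllipticSystem.pZero Ω A ∧
          ENNReal.ofReal q < EllipticSystem.sobolevExp n (ENNReal.ofReal p) ∧
          EllipticSystem.IntElliptic Ω A p) ∧
        ∀ p : ℝ, ENNReal.conjExponent (EllipticSystem.pZero Ω A) < ENNReal.ofReal p →
          ENNReal.ofReal p < EllipticSystem.pZero Ω A →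
          ENNReal.ofReal q < EllipticSystem.sobolevExp n (ENNReal.ofReal p) →
          ∀ c : ℝ, 0 < c → EllipticSystem.IntEllipticWith Ω A p c →
            ∀ (u : EllipticSystem.Pt n → EllipticSystem.Vec m)
              (Du : EllipticSystem.Pt n → EllipticSystem.Tens n m),
              EllipticSystem.IsWeakSolution Ω A B u Du →
              ∀ x ∈ Ω, ∀ r : ℝ, 0 < r → ENNReal.ofReal r < EllipticSystem.bdryDist Ω x / 3 →
                EllipticSystem.ReverseHolder u q (C p c) x r) := by
  refine ⟨fun p => ?_, fun q hq => ?_⟩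
  -- The constant is selected before the domain, the coefficients and the solution, as a total
  -- function of `c`; its value is 0 where 1 < p or 0 < c fails.
  · have hC : ∀ c : ℝ, ∃ C : ℝ≥0, 1 < p → 0 < c →
        ∀ (Ω : Set (EllipticSystem.Pt n)) (A : EllipticSystem.Pt n → EllipticSystem.Coef2 n m)
          (B : EllipticSystem.Pt n → EllipticSystem.Coef1 n m),
          EllipticSystem.IsAdmissible Ω A B Λ K → EllipticSystem.IntEllipticWith Ω A p c →
          ∀ (u : EllipticSystem.Pt n → EllipticSystem.Vec m)
            (Du : EllipticSystem.Pt n → EllipticSystem.Tens n m),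
            EllipticSystem.IsWeakSolution Ω A B u Du →
            ∀ x ∈ Ω, ∀ r : ℝ, 0 < r → ENNReal.ofReal r < EllipticSystem.bdryDist Ω x / 3 →
              EllipticSystem.Caccioppoli u Du p C x r := fun c => by
      by_cases h : 1 < p ∧ 0 < c
      · obtain ⟨C, hC⟩ := EllipticSystem.exists_caccioppoli_const n m K Λ h.1 h.2
        exact ⟨C, fun _ _ => hC⟩
      · exact ⟨0, fun h1 h2 => absurd ⟨h1, h2⟩ h⟩
    choose C hC using hC
    refine ⟨C, fun Ω A B hadm hp' hp₀ => ⟨fun hp2 => hadm.intElliptic_of_lt hp2 hp₀,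
      fun c hc hell => ?_⟩⟩
    exact hC c (EllipticSystem.one_lt_of_conjExponent_lt hp') hc Ω A B hadm hell
  · have hC : ∀ p c : ℝ, ∃ C : ℝ≥0, 1 < p → 0 < c →
        ENNReal.ofReal q < EllipticSystem.sobolevExp n (ENNReal.ofReal p) →
        ∀ (Ω : Set (EllipticSystem.Pt n)) (A : EllipticSystem.Pt n → EllipticSystem.Coef2 n m)
          (B : EllipticSystem.Pt n → EllipticSystem.Coef1 n m),
          EllipticSystem.IsAdmissible Ω A B Λ K → EllipticSystem.IntEllipticWith Ω A p c →
          ∀ (u : EllipticSystem.Pt n → EllipticSystem.Vec m)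
            (Du : EllipticSystem.Pt n → EllipticSystem.Tens n m),
            EllipticSystem.IsWeakSolution Ω A B u Du →
            ∀ x ∈ Ω, ∀ r : ℝ, 0 < r → ENNReal.ofReal r < EllipticSystem.bdryDist Ω x / 3 →
              EllipticSystem.ReverseHolder u q C x r := fun p c => by
      by_cases h : 1 < p ∧ 0 < c ∧
          ENNReal.ofReal q < EllipticSystem.sobolevExp n (ENNReal.ofReal p)
      · obtain ⟨χ, hχ, hχn, hqχ⟩ := EllipticSystem.exists_gain_exponent hn (by linarith) h.2.2
        obtain ⟨C, hC⟩ := EllipticSystem.exists_reverseHolder_const m hn K Λ hχ hχn h.1 h.2.1 hq hqχ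
        exact ⟨C, fun _ _ _ => hC⟩
      · exact ⟨0, fun h1 h2 h3 => absurd ⟨h1, h2, h3⟩ h⟩
    choose C hC using hC
    refine ⟨C, fun Ω A B hadm hq₀ => ⟨hadm.exists_exponent hn hq₀, fun p hp' hp₀ hqp c hc hell => ?_⟩⟩
    exact hC p c (EllipticSystem.one_lt_of_conjExponent_lt hp') hc hqp Ω A B hadm hell
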